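/- Let $X$ be a smooth projective (connected) curve over $\mathbb{C}$ with canonical bundle $K_X$, and let $E, F, G$ be vector bundles on $X$. Put $V = \mathrm{Hom}(F,E)$ and let $\pi : \mathbb{P}V \to X$ be the bundle of lines in the fibres of $V$, with $\Upsilon = \pi^*K_X \otimes \mathcal{O}_{\mathbb{P}V}(1)$. Thus $H^0(\mathbb{P}V,\Upsilon) = H^0(X, K_X\otimes V^*)$, and by Serre duality (sum of residues of the contraction with a principal part) $H^1(X,V) = H^0(\mathbb{P}V,\Upsilon)^*$. Let $\psi : \mathbb{P}V \dashrightarrow \mathbb{P}H^1(X,V)$ be the map sending $\langle v\rangle$ over $x$ to the line spanned by the class of the principal part $v/z$ supported at $x$, $z$ being a local coordinate at $x$. Suppose that $\psi$ is an embedding. Let $\gamma : G \to F$ be a generically injective bundle map, let $\overline{G} \subseteq F$ be the vector subbundle generated by $\gamma(G)$, and let $x_1, \dots, x_t$ be the points where $G \ne \overline{G}$ (where the rank of $\gamma$ drops). Then at each $x_i$ there are a local coordinate $z$, a local frame of $F$ part of which is a frame of $\overline{G}$, a local frame of $E$, a filtration $0 \subseteq M^{(i)}_0 \subsetneq \dots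 \subsetneq M^{(i)}_{m_i} \subsetneq \overline{G}|_{x_i}$ and integers $0 \le k^{(i)}_0 < \dots < k^{(i)}_{m_i}$ such that a local section $g = g_0 + z g_1 + z^2 g_2 + \cdots$ of $\overline{G}$ (with coefficients $g_l \in \overline{G}|_{x_i}$, expanded in the frame) belongs to $G$ if and only if $g_l \in M^{(i)}_j$ for all $j$ and all $l \le k^{(i)}_j$. Fix any such choices, and put $N^{(i)}_j = \mathrm{Ker}\big(\mathrm{Hom}(F,E)|_{x_i} \to \mathrm{Hom}(M^{(i)}_j, E|_{x_i})\big)$ for $0 \le j \le m_i$. The frames make $\mathbb{P}V$ a product near $x_i$. For a point $\langle \phi \rangle \in \mathbb{P}N^{(i)}_j$, the linear forms on $H^0(\mathbb{P}V,\Upsilon)$ given by the differential operators at $\langle\phi\rangle$ of order at most $k$ and of type $(\star)$ with respect to $\mathbb{P}N^{(i)}_j$ are those in the linear span of $\partial^m/\partial z^m$ for $0 \le m \le k-1$ ($m=0$ being evaluation at $\langle \phi\rangle$) and of $D\,\partial^{m-1}/\partial z^{m-1}$ for $1 \le m \le k$ and $D$ a tangent vector to $\mathbb{P}N^{(i)}_j$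 at $\langle\phi\rangle$. Let $N(\gamma) \subseteq \mathbb{P}H^1(X,V) = \mathbb{P}\big(H^0(\mathbb{P}V,\Upsilon)^*\big)$ be the union of * the image by $\psi$ of the projective subbundle $\mathbb{P}K(\overline{\gamma})$, where $K(\overline{\gamma}) = \mathrm{Ker}\big(\mathrm{Hom}(F,E) \to \mathrm{Hom}(\overline{G},E)\big)$; * for all $i = 1,\dots,t$, all $j = 0, \dots, m_i$ and all $\langle\phi\rangle \in \mathbb{P}N^{(i)}_j$, the projective subspace of the osculating space $\mathrm{Osc}^{k^{(i)}_j+1}(\mathbb{P}V, \langle\phi\rangle)$ defined by the operators at $\langle\phi\rangle$ of order at most $k^{(i)}_j + 1$ and of type $(\star)$ with respect to $\mathbb{P}N^{(i)}_j$. Let $0 \to E \to W \to F \to 0$ be a nontrivial (non-split) extension. Then its class $\delta(W) \in H^1(X, \mathrm{Hom}(F,E))$ is nonzero, and $\gamma$ factorises through $W \to F$ if and only if the point $\langle \delta(W)\rangle$ belongs to the projective linear span of $N(\gamma)$. -/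

import Mathlib

open AlgebraicGeometry CategoryTheory

noncomputable section

namespace CurveLifting

/-! ## Local algebra on a curve

Throughout, `K` is the function field of the curve, seen as a `ℂ`-algebra, and `A ⊆ K` is the local
ring of the curve at a closed point. -/

section Local

variable {K : Type} [Field K] [Algebra ℂ K]

/-- `z` is a local coordinate (uniformizer) at the point with local ring `A`: it generates the
maximal ideal of `A`, which is the set of non-units of `A`. -/
def IsCoord (A : Subalgebra ℂ K) (z : K) : Prop :=
  z ∈ A ∧ z ≠ 0 ∧ ∀ f ∈ A, (¬ ∃ g ∈ A, f * g = 1) ↔ ∃ g ∈ A, f = z * g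

/-- `c` is the coefficient of `z ^ n` in the Laurent expansion of `f` in the coordinate `z`. -/
def HasCoeff (A : Subalgebra ℂ K) (z : K) (n : ℤ) (f : K) (c : ℂ) : Prop :=
  ∃ a : ℤ →₀ ℂ, (∀ i, n < i → a i = 0) ∧ a n = c ∧
    ∃ g ∈ A, f - a.sum (fun i t => algebraMap ℂ K t * z ^ i) = z ^ (n + 1) * g

/-- The coefficient of `z ^ n` in the Laurent expansion of `f` in the coordinate `z`. -/
def coeff (A : Subalgebra ℂ K) (z : K) (n : ℤ) (f : K) : ℂ :=
  Classical.epsilon (HasCoeff A z n f)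

/-- `c` is the coefficient of `z ^ n dz` in the Laurent expansion of the rational differential `ω`
in the coordinate `z`. -/
def HasDiffCoeff (A : Subalgebra ℂ K) (z : K) (n : ℤ) (ω : Ω[K⁄ℂ]) (c : ℂ) : Prop :=
  ∃ f : K, ω = f • KaehlerDifferential.D ℂ K z ∧ HasCoeff A z n f c

/-- The coefficient of `z ^ n dz` in the Laurent expansion of `ω` in the coordinate `z`. -/
def diffCoeff (A : Subalgebra ℂ K) (z : K) (n : ℤ) (ω : Ω[K⁄ℂ]) : ℂ :=
  Classical.epsilon (HasDiffCoeff A z n ω)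

/-- The residue of the rational differential `ω` at the point with local ring `A`. -/
def residue (A : Subalgebra ℂ K) (ω : Ω[K⁄ℂ]) : ℂ :=
  Classical.epsilon fun c => ∃ z, IsCoord A z ∧ HasDiffCoeff A z (-1) ω c

/-- The stalk of the canonical bundle: the rational differentials that are regular at the point
with local ring `A`. -/
def omegaStalk (A : Subalgebra ℂ K) : Submodule A (Ω[K⁄ℂ]) :=
  Submodule.span A {ω | ∃ f ∈ A, ω = KaehlerDifferential.D ℂ K f}

end Local

/-! ## Bundles through their rational sections and stalks

`P` is the set of closed points of the curve, `O x ⊆ K` the local ring at `x`, `V` the `K`-vector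
space of rational sections of a bundle, `L x ⊆ V` the `O x`-module of rational sections that are
regular at `x`. -/

section Global

variable {K : Type} [Field K] [Algebra ℂ K] {P : Type} {O : P → Subalgebra ℂ K}
variable {V : Type} [AddCommGroup V] [Module K V] [Module ℂ V] [IsScalarTower ℂ K V]
variable (L : ∀ x, Submodule (O x) V)

/-- The section `v`, regular at `x`, vanishes at `x`, i.e. it is zero in the fibre at `x`. -/
def VanishesAt (x : P) (v : V) : Prop :=
  ∃ z, IsCoord (O x) z ∧ ∃ u ∈ L x, v = z • u

theorem stalk_smul (x : P) (c : ℂ) {v : V} (hv : v ∈ L x) :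
    c • v ∈ L x := by
  have h := (L x).smul_mem (algebraMap ℂ (O x) c) hv
  have e : (algebraMap ℂ (O x) c) • v = c • v := by
    rw [Subalgebra.smul_def]
    exact algebraMap_smul K c v
  rwa [e] at h

/-- Families of rational sections, one for each closed point, almost all of them regular. Modulo
the everywhere regular families these are the principal parts `Prin(V) = ⨁ₓ V / Vₓ`. -/
def families : Submodule ℂ (P → V) where
  carrier := {p | {x | p x ∉ L x}.Finite}
  add_mem' {p q} hp hq := by
    refine (Set.Finite.union hp hq).subset fun x hx => ?_
    by_contra h
    simp only [Set.mem_union, Set.mem_ofPred_eq, not_or, not_not] at h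
    exact hx ((L x).add_mem h.1 h.2)
  zero_mem' := by simp
  smul_mem' c p hp := by
    refine Set.Finite.subset hp fun x hx => ?_
    intro h
    exact hx (stalk_smul L x c h)

/-- The families whose principal part is the principal part of a global rational section. -/
def principal : Submodule ℂ (families L) where
  carrier := {p | ∃ v : V, ∀ x, p.1 x - v ∈ L x}
  add_mem' := by
    rintro p q ⟨v, hv⟩ ⟨w, hw⟩
    refine ⟨v + w, fun x => ?_⟩
    have h := (L x).add_mem (hv x) (hw x)
    have e : (p + q).1 x - (v + w) = (p.1 x - v) + (q.1 x - w) := by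
      simp only [Submodule.coe_add, Pi.add_apply]; abel
    rwa [e]
  zero_mem' := ⟨0, fun x => by simp⟩
  smul_mem' := by
    rintro c p ⟨v, hv⟩
    refine ⟨c • v, fun x => ?_⟩
    have h := stalk_smul L x c (hv x)
    rwa [smul_sub] at h

/-- `H¹(X, V)`, as the cokernel of `Rat(V) → Prin(V)`. -/
abbrev H1 : Type := families L ⧸ principal L

/-- The class in `H¹(X, V)` of the principal part represented by a family. -/
def H1.mk (p : families L) : H1 L := (principal L).mkQ p

open Classical in
/-- The principal part `v / z` supported at `x`. -/
def poleFamily (x : P) (z : K) (v : V) : families L :=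
  ⟨Pi.single x (z⁻¹ • v), by
    refine (Set.finite_singleton x).subset fun y hy => ?_
    by_contra h
    have h' : y ≠ x := h
    exact hy (by simp [Pi.single_eq_of_ne h'])⟩

/-- The class of `v / z` in `H¹(X, V)`, for `v` regular at `x` and `z` a coordinate at `x`. It
depends only on the value of `v` in the fibre at `x`, up to the scalar coming from the choice of
`z`: it spans the line `ψ⟨v(x)⟩`. -/
def psi (x : P) (z : K) (v : V) : H1 L := H1.mk L (poleFamily L x z v)

/-- `H⁰(X, K_X ⊗ V*)`. A section `s` is also the section of `Υ = π* K_X ⊗ O(1)` over `ℙV` whose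
value at the point `⟨v⟩` over `x` is the linear form on the line `⟨v⟩` with values in the fibre of
`K_X` at `x` obtained by restricting `s(x)`. -/
def CoSection : Type :=
  {s : V →ₗ[K] Ω[K⁄ℂ] // ∀ x, ∀ v ∈ L x, s v ∈ omegaStalk (O x)}

/-- The linear form on `H⁰(X, K_X ⊗ V*)` attached to a principal part: contract with the section
and add up the residues. It depends only on the class in `H¹(X, V)`, and realises the duality
`H¹(X, V) = H⁰(X, K_X ⊗ V*)*`. -/
def serreForm (p : families L) : CoSection L → ℂ :=
  fun s => ∑ᶠ x, residue (O x) (s.1 (p.1 x))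

/-- `b` is a local frame of the bundle at `x`. -/
def IsFrame (x : P) {ι : Type} (b : Module.Basis ι K V) : Prop :=
  Submodule.span (O x) (Set.range b) = L x

section Operators

variable {L}
variable {ι : Type} [Fintype ι] (b : Module.Basis ι K V) (x : P) (z : K)

/-- The local section with constant coordinates `w` in the frame `b`. In this way a frame at `x`
identifies the fibre at `x` with `ℂ ^ ι`, and `ℙV` near `x` with a product. -/
def constSection (w : ι → ℂ) : V := ∑ i, w i • b i

/-- The operator `∂ᵐ/∂zᵐ` at the point `⟨w⟩` over `x`, in the product structure given by `b`,
applied to sections of `Υ` (trivialised by `dz` and by the vector `w` of `⟨w⟩`). -/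
def dzOp (m : ℕ) (w : ι → ℂ) : CoSection L → ℂ :=
  fun s => (m.factorial : ℂ) * diffCoeff (O x) z m (s.1 (constSection b w))

/-- The operator `D ∂ᵐ/∂zᵐ` at the point `⟨v⟩` over `x`, where `D` is the tangent vector at `⟨v⟩`
to the curve `t ↦ ⟨v + t d⟩` in the projectivised fibre. -/
def tangentDzOp (m : ℕ) (v d : ι → ℂ) : CoSection L → ℂ :=
  fun s => deriv (fun t : ℂ => dzOp b x z m (v + t • d) s) 0

/-- The linear forms on `H⁰(ℙV, Υ)` given by the operators at `⟨v⟩` of order at most `k` and of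
type `(⋆)` with respect to `ℙΛ`: they are spanned by `∂ᵐ/∂zᵐ`, `m < k` (where `m = 0` is the
evaluation at `⟨v⟩`) and `D ∂ᵐ⁻¹/∂zᵐ⁻¹`, `1 ≤ m ≤ k`, with `D` tangent to `ℙΛ` at `⟨v⟩`. -/
def starForms (Λ : Submodule ℂ (ι → ℂ)) (k : ℕ) (v : ι → ℂ) : Submodule ℂ (CoSection L → ℂ) :=
  Submodule.span ℂ ({f | ∃ m < k, f = dzOp b x z m v} ∪
    {f | ∃ m < k, ∃ d ∈ Λ, f = tangentDzOp b x z m v d})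

end Operators

/-- The map `ψ : ℙV → ℙH¹(X, V)`, `⟨v⟩ ↦ ⟨[v / z]⟩`, is an embedding. -/
structure PsiIsEmbedding : Prop where
  /-- `ψ` is defined everywhere. -/
  defined : ∀ x z v, IsCoord (O x) z → v ∈ L x → ¬ VanishesAt L x v → psi L x z v ≠ 0
  /-- `ψ` is injective. -/
  injective : ∀ x y z z' v w, IsCoord (O x) z → IsCoord (O y) z' →
    v ∈ L x → ¬ VanishesAt L x v → w ∈ L y → ¬ VanishesAt L y w →
    (∃ c : ℂ, psi L x z v = c • psi L y z' w) → x = y ∧ ∃ c : ℂ, VanishesAt L x (v - c • w)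
  /-- The differential of `ψ` is injective: a nonzero tangent vector `a ∂/∂z + D` at `⟨v⟩`, with
  `D` the direction of `t ↦ ⟨v + t d⟩`, is detected by a section of `Υ` vanishing at `⟨v⟩`. -/
  immersive : ∀ (x : P) (z : K) (r : ℕ) (b : Module.Basis (Fin r) K V) (v d : Fin r → ℂ) (a : ℂ),
    IsCoord (O x) z → IsFrame L x b → v ≠ 0 → ¬ (a = 0 ∧ ∃ c : ℂ, d = c • v) →
    ∃ s : CoSection L, dzOp b x z 0 v s = 0 ∧
      a * dzOp b x z 1 v s + tangentDzOp b x z 0 v d s ≠ 0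

end Global

/-! ## Homomorphism bundles and the locus of a sheaf injection -/

section Hom

variable {K : Type} [Field K] [Algebra ℂ K] {P : Type} {O : P → Subalgebra ℂ K}
variable {VF : Type} [AddCommGroup VF] [Module K VF] [Module ℂ VF] [IsScalarTower ℂ K VF]
variable {VE : Type} [AddCommGroup VE] [Module K VE] [Module ℂ VE] [IsScalarTower ℂ K VE]
variable (LF : ∀ x, Submodule (O x) VF) (LE : ∀ x, Submodule (O x) VE)

/-- The stalks of the bundle `Hom(F, E)`, whose rational sections are the `K`-linear maps from
the rational sections of `F` to those of `E`. -/
def homStalk (x : P) : Submodule (O x) (VF →ₗ[K] VE) where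
  carrier := {φ | ∀ v ∈ LF x, φ v ∈ LE x}
  add_mem' h h' v hv := (LE x).add_mem (h v hv) (h' v hv)
  zero_mem' _ _ := (LE x).zero_mem
  smul_mem' c _ h v hv := (LE x).smul_mem c (h v hv)

variable (RG : Submodule K VF) (LG : ∀ x, Submodule (O x) VF)

/-- `Ḡ` is the subbundle of `F` generated by the subsheaf `G`: if `RG` is the space of rational
sections of `G` inside those of `F`, its stalk at `x` consists of the rational sections of `G` that
are regular as sections of `F`. These are the points where `G ≠ Ḡ`, `LG` being the stalks of `G`. -/
def dropPoints : Set P := {x | ∃ v ∈ LF x, v ∈ RG ∧ v ∉ LG x}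

/-- The local description of `G` in `Ḡ` at a point `x`. One chooses a coordinate `z` at `x`, a frame
of `F` part of which is a frame of `Ḡ`, and a frame of `E`. Fibres are identified with `ℂʳ` through
the frames, and local sections are expanded in powers of `z` with coefficients in the fibre. -/
structure DropData (x : P) where
  z : K
  isCoord : IsCoord (O x) z
  rF : ℕ
  bF : Module.Basis (Fin rF) K VF
  frameF : IsFrame LF x bF
  S : Set (Fin rF)
  span_S : Submodule.span K (bF '' S) = RG
  rE : ℕ
  bE : Module.Basis (Fin rE) K VE
  frameE : IsFrame LE x bE
  /-- The filtration has `m + 1` steps, `M 0 ⊂ ⋯ ⊂ M m ⊂ Ḡ|ₓ`. -/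
  m : ℕ
  M : Fin (m + 1) → Submodule ℂ (Fin rF → ℂ)
  strictMono_M : StrictMono M
  M_lt : M (Fin.last m) < ⨅ i ∈ Sᶜ, LinearMap.ker (LinearMap.proj (R := ℂ) (φ := fun _ => ℂ) i)
  k : Fin (m + 1) → ℕ
  strictMono_k : StrictMono k
  /-- A section `g = g₀ + z g₁ + ⋯` of `Ḡ` is a section of `G` if and only if `gₗ ∈ M j` for all
  `l ≤ k j`, for all `j`. -/
  mem_iff : ∀ g ∈ LF x, g ∈ RG →
    (g ∈ LG x ↔ ∀ j, ∀ l ≤ k j, (fun i => coeff (O x) z l (bF.repr g i)) ∈ M j)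

variable {LF LE RG LG}

/-- The induced frame of `Hom(F, E)`; coordinates in it are the entries of the matrix of a map. -/
def DropData.frame {x : P} (D : DropData LF LE RG LG x) :
    Module.Basis (Fin D.rE × Fin D.rF) K (VF →ₗ[K] VE) :=
  D.bF.linearMap D.bE

/-- `N j = Ker (Hom(F, E)|ₓ → Hom(M j, E|ₓ))`. -/
def DropData.N {x : P} (D : DropData LF LE RG LG x) (j : Fin (D.m + 1)) :
    Submodule ℂ (Fin D.rE × Fin D.rF → ℂ) where
  carrier := {w | ∀ u ∈ D.M j, ∀ i, ∑ l, w (i, l) * u l = 0}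
  add_mem' h h' u hu i := by
    simp only [Pi.add_apply, add_mul, Finset.sum_add_distrib, h u hu i, h' u hu i, add_zero]
  zero_mem' u _ i := by simp
  smul_mem' c _ h u hu i := by
    simp only [Pi.smul_apply, smul_eq_mul, mul_assoc, ← Finset.mul_sum, h u hu i, mul_zero]

variable (LF LE RG LG)

/-- The image by `ψ` of the projective subbundle `ℙK(γ̄) ⊆ ℙHom(F, E)`: its points over `x` are the
`⟨φ(x)⟩`, `φ(x) ≠ 0`, such that `φ(x)` is zero on the fibre of `Ḡ` at `x`. -/
def kernelLocus : Set (Projectivization ℂ (H1 (homStalk LF LE))) :=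
  {Q | ∃ x, ∃ φ ∈ homStalk LF LE x, ¬ VanishesAt (homStalk LF LE) x φ ∧
    (∀ g ∈ LF x, g ∈ RG → VanishesAt LE x (φ g)) ∧
    ∃ z, IsCoord (O x) z ∧ ∃ h : psi (homStalk LF LE) x z φ ≠ 0,
      Q = Projectivization.mk ℂ (psi (homStalk LF LE) x z φ) h}

/-- The union, over the points `x` where `G ≠ Ḡ`, over all `j` and all `⟨φ⟩ ∈ ℙ(N j)`, of the
subspaces of `ℙH¹(X, Hom(F, E)) = ℙ(H⁰(ℙHom(F, E), Υ)*)` defined by the operators at `⟨φ⟩` of order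
at most `k j + 1` and of type `(⋆)` with respect to `ℙ(N j)`. -/
def starLocus (D : ∀ x ∈ dropPoints LF RG LG, DropData LF LE RG LG x) :
    Set (Projectivization ℂ (H1 (homStalk LF LE))) :=
  {Q | ∃ x, ∃ hx : x ∈ dropPoints LF RG LG, ∃ j, ∃ φ ∈ (D x hx).N j, φ ≠ 0 ∧
    ∃ p : families (homStalk LF LE),
      serreForm _ p ∈ starForms (D x hx).frame x (D x hx).z ((D x hx).N j) ((D x hx).k j + 1) φ ∧
      ∃ h : H1.mk _ p ≠ 0, Q = Projectivization.mk ℂ (H1.mk _ p) h}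

/-- The locus `N(γ)`. -/
def locus (D : ∀ x ∈ dropPoints LF RG LG, DropData LF LE RG LG x) :
    Set (Projectivization ℂ (H1 (homStalk LF LE))) :=
  kernelLocus LF LE RG ∪ starLocus LF LE RG LG D

end Hom

/-! ## Sheaves of modules on a complex curve -/

section Curve

variable (X : Scheme.{0}) [IsIntegral X]

/-- The function field. -/
abbrev Fun : Type := X.functionField

/-- The closed points. -/
abbrev Pt : Type := {x : X // IsClosed ({x} : Set X)}

variable [X.Over (Spec (.of ℂ))]

/-- The complex numbers as global functions. -/
def constants : CommRingCat.of ℂ ⟶ Γ(X, ⊤) :=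
  (Scheme.ΓSpecIso (.of ℂ)).inv ≫ (X ↘ Spec (.of ℂ)).appTop

instance : Algebra ℂ (Fun X) :=
  (constants X ≫ X.presheaf.germ ⊤ (genericPoint X) (TopologicalSpace.Opens.mem_top _)).hom.toAlgebra

/-- The local ring at a closed point, as a subring of the function field. -/
def localRing (x : Pt X) : Subalgebra ℂ (Fun X) where
  __ := (algebraMap (X.presheaf.stalk x.1) (Fun X)).range
  algebraMap_mem' c := by
    refine ⟨(constants X ≫ X.presheaf.germ ⊤ x.1 (TopologicalSpace.Opens.mem_top _)).hom c, ?_⟩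
    have e : (constants X ≫ X.presheaf.germ ⊤ x.1 (TopologicalSpace.Opens.mem_top _)) ≫ X.presheaf.stalkSpecializes
        ((genericPoint_spec X).specializes (Set.mem_univ x.1)) =
        constants X ≫ X.presheaf.germ ⊤ (genericPoint X) (TopologicalSpace.Opens.mem_top _) := by
      rw [Category.assoc, X.presheaf.germ_stalkSpecializes]
    exact congr($(e).hom c)

variable {X}

/-- The rational sections of a sheaf of modules: its stalk at the generic point. -/
def Rat (M : X.Modules) : Type := ↑(TopCat.Presheaf.stalk M.presheaf (genericPoint X))

instance (M : X.Modules) : AddCommGroup (Rat M) :=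
  inferInstanceAs (AddCommGroup ↑(TopCat.Presheaf.stalk M.presheaf (genericPoint X)))

instance (M : X.Modules) : Module (Fun X) (Rat M) :=
  PresheafOfModules.instModuleCarrierStalkCommRingCatCarrierAbPresheafOpensCarrier
    (R := X.presheaf) M.val (genericPoint X)

instance (M : X.Modules) : Module ℂ (Rat M) := Module.compHom _ (algebraMap ℂ (Fun X))

instance (M : X.Modules) : IsScalarTower ℂ (Fun X) (Rat M) :=
  IsScalarTower.of_algebraMap_smul fun _ _ => rfl

/-- The rational section defined by a section over a nonempty open set. -/
def toRat (M : X.Modules) {U : X.Opens} {x : X} (hx : x ∈ U) : Γ(M, U) →+ Rat M :=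
  (TopCat.Presheaf.germ M.presheaf U (genericPoint X)
    (((genericPoint_spec X).mem_open_set_iff U.isOpen).mpr (by simpa using ⟨x, hx⟩))).hom

/-- The stalk of a sheaf of modules at a closed point, seen in the space of rational sections: the
rational sections that come from a section over a neighbourhood of the point. -/
def stalkAt (M : X.Modules) (x : Pt X) : Submodule (localRing X x) (Rat M) :=
  Submodule.span _ {v | ∃ (U : X.Opens) (hx : x.1 ∈ U) (m : Γ(M, U)), toRat M hx m = v}

/-- The map induced on rational sections by a morphism of sheaves of modules. -/
def ratMap {M N : X.Modules} (f : M ⟶ N) : Rat M →+ Rat N :=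
  ((TopCat.Presheaf.stalkFunctor Ab (genericPoint X)).map f.mapPresheaf).hom

/-- A vector bundle: a sheaf of modules which is locally free of finite rank. -/
def IsVectorBundle (M : X.Modules) : Prop :=
  ∀ x : X, ∃ U : X.Opens, x ∈ U ∧ ∃ (n : ℕ) (s : Fin n → Γ(M, U)), ∀ (V : X.Opens) (i : V ⟶ U),
    Function.Bijective fun a : Fin n → Γ(X, V) => ∑ j, a j • M.presheaf.map i.op (s j)

section Maps

variable {E F G W : X.Modules}

/-- The rational sections of `G`, in those of `F`, for a morphism `γ : G ⟶ F`. -/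
def ratImage (γ : G ⟶ F) : Submodule (Fun X) (Rat F) :=
  Submodule.span _ (Set.range (ratMap γ))

/-- The stalks of the subsheaf `γ(G)` of `F`. -/
def imageStalk (γ : G ⟶ F) (x : Pt X) : Submodule (localRing X x) (Rat F) :=
  Submodule.span _ (ratMap γ '' stalkAt G x)

variable (E F) in
/-- The stalks of the bundle `Hom(F, E)`. -/
abbrev homBundle (x : Pt X) : Submodule (localRing X x) (Rat F →ₗ[Fun X] Rat E) :=
  homStalk (stalkAt F) (stalkAt E) x

/-- `c` is the class of the extension `0 ⟶ E ⟶ W ⟶ F ⟶ 0` with maps `i` and `q`, i.e. the image of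
the identity of `F` under the coboundary `H⁰(X, Hom(F, F)) → H¹(X, Hom(F, E))`: it is represented
by the differences between a rational splitting and splittings that are regular at `x`. -/
def IsExtClass (i : E ⟶ W) (q : W ⟶ F) (c : H1 (homBundle E F)) : Prop :=
  ∃ σ : Rat F →ₗ[Fun X] Rat W, (∀ v, ratMap q (σ v) = v) ∧
    ∃ p : families (homBundle E F), H1.mk _ p = c ∧
      ∀ x, ∃ τ : Rat F →ₗ[Fun X] Rat W, (∀ v, ratMap q (τ v) = v) ∧
        (∀ v ∈ stalkAt F x, τ v ∈ stalkAt W x) ∧ ∀ v, ratMap i (p.1 x v) = σ v - τ v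

/-- The class `δ(W)` of an extension. -/
def extClass (i : E ⟶ W) (q : W ⟶ F) : H1 (homBundle E F) :=
  Classical.epsilon (IsExtClass i q)

/-- The points where the rank of `γ` drops. -/
abbrev dropSet (γ : G ⟶ F) : Set (Pt X) := dropPoints (stalkAt F) (ratImage γ) (imageStalk γ)

variable (E) in
/-- The local descriptions of `G` in `Ḡ` at a point, for a morphism `γ : G ⟶ F`. -/
abbrev Drop (γ : G ⟶ F) (x : Pt X) : Type :=
  DropData (stalkAt F) (stalkAt E) (ratImage γ) (imageStalk γ) x

variable (E) in
/-- The locus `N(γ)` in `ℙH¹(X, Hom(F, E))`. -/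
abbrev lociN (γ : G ⟶ F) (D : ∀ x ∈ dropSet γ, Drop E γ x) :
    Set (Projectivization ℂ (H1 (homBundle E F))) :=
  locus (stalkAt F) (stalkAt E) (ratImage γ) (imageStalk γ) D

end Maps

end Curve

end CurveLifting

/-!
The lifting problem is first turned into linear algebra in `H¹(X, Hom(F, E))`. A lift of `γ` to the
middle term of an extension exists if and only if the class of the extension is represented by a
principal part sending the subsheaf `γ(G)` to regular sections of `E`
(`IsExtClass.exists_lift_iff`), that is, if and only if the class becomes trivial in
`H¹(X, Hom(G, E))`. Such classes form a subspace, `liftable`. The theorem then amounts to the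
equality of `liftable` with the span of the lines in the locus (`liftable_eq_span_locusVectors`).

The locus is contained in `liftable`: through residues, the operator `∂ᵐ/∂zᵐ` at `⟨w⟩` is the class
of the principal part `m! z ^ (-m - 1) w` (`polarPart`, `IsCurve.dzOp_eq`). As `dzOp` is linear in
the point, `D ∂ᵐ/∂zᵐ` is given by the same principal part with `w` replaced by the direction of
`D`. When `w` annihilates `M j` and `m ≤ k j`, this principal part sends sections of `G` to regular
sections (`DropData.zpow_smul_constSection_mem`), since their coefficients up to order `k j` lie in
`M j`.

Conversely, by Serre duality a linear form vanishing on the locus is the sum of the residues of the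
contraction with a section `s` of `K_X ⊗ Hom(F, E)*`. Orthogonality to the image of `ℙK(γ̄)` says
that `s(φ)` vanishes at infinitely many points, for each `φ` zero on the rational sections of `G`,
so `s` kills these maps (`apply_eq_zero_of_forall_mem_locusVectors`) and only the restriction of
`φ` to `Ḡ` matters. Let `φ` send `G` to regular sections. The residue of `s(φ)` is zero where
`G = Ḡ`. At the other points, `z ^ m u` is a section of `G` for all `u` in `M j`, if `j` is the least
index with `m ≤ k j`. So the coefficient of `z ^ (-m - 1)` in `φ` is in `N j`, and it vanishes if
there is no such `j` (`DropData.sum_coeff_mul_eq_zero`). The residue is then zero because `s` is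
orthogonal to the operators of type `(⋆)` (`residue_eq_zero_of_drop`). The choices describing `G` in `Ḡ` exist by the
theorem on elementary divisors (`exists_adaptedFrame`, `nonempty_dropData`).

Serre duality is proved in the language of repartitions, for a field `K` with a complete family of
discrete valuation rings (`IsCurve`). Following Tate, the residue of `f dg` is the trace of a
commutator of finite rank, and finiteness of `H¹(X, 𝒪)` (`IsCurve.finiteDimensional_H1`) gives the
residue theorem (`IsCurve.sum_symbol`). Counting dimensions, two linear forms on repartitions that
kill the rational functions and the repartitions with enough zeros are proportional over `K`
(`IsCurve.exists_relation`), so each is given by residues of a differential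
(`IsCurve.exists_eq_residueForm`). The case of bundles follows by taking coordinates in a rational
basis (`IsCurve.serre_duality`).

Finally, the local rings of `X` at its closed points satisfy `IsCurve` (`isCurve_localRing`): smooth
charts give discrete valuation rings, and the valuative criterion gives completeness. Sections and
morphisms of vector bundles are the rational ones that are regular at all closed points
(`IsVectorBundle.exists_section`, `IsVectorBundle.exists_hom`).
-/
namespace CurveLifting

/-! ### Traces of operators of finite rank -/

section FiniteRank

variable {k : Type*} [Field k]
variable {V : Type*} [AddCommGroup V] [Module k V] {W : Type*} [AddCommGroup W] [Module k W]
variable {U : Type*} [AddCommGroup U] [Module k U]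

/-- A linear map, between spaces of arbitrary dimension, whose range is finite-dimensional. -/
def FinRank (f : V →ₗ[k] W) : Prop := FiniteDimensional k (LinearMap.range f)

theorem FinRank.of_le {f : V →ₗ[k] W} (S : Submodule k W) [FiniteDimensional k S]
    (h : ∀ v, f v ∈ S) : FinRank f :=
  Submodule.finiteDimensional_of_le (S₂ := S) (by rintro _ ⟨v, rfl⟩; exact h v)

theorem FinRank.zero : FinRank (0 : V →ₗ[k] W) := FinRank.of_le ⊥ (by simp)

theorem FinRank.add {f g : V →ₗ[k] W} (hf : FinRank f) (hg : FinRank g) : FinRank (f + g) := by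
  have : FiniteDimensional k (LinearMap.range f) := hf
  have : FiniteDimensional k (LinearMap.range g) := hg
  exact FinRank.of_le (LinearMap.range f ⊔ LinearMap.range g) fun v =>
    Submodule.add_mem_sup ⟨v, rfl⟩ ⟨v, rfl⟩

theorem FinRank.smul {f : V →ₗ[k] W} (c : k) (hf : FinRank f) : FinRank (c • f) := by
  have : FiniteDimensional k (LinearMap.range f) := hf
  exact FinRank.of_le (LinearMap.range f) fun v => Submodule.smul_mem _ c ⟨v, rfl⟩

theorem FinRank.neg {f : V →ₗ[k] W} (hf : FinRank f) : FinRank (-f) := by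
  simpa using hf.smul (-1)

theorem FinRank.sub {f g : V →ₗ[k] W} (hf : FinRank f) (hg : FinRank g) : FinRank (f - g) := by
  simpa [sub_eq_add_neg] using hf.add hg.neg

theorem FinRank.comp_right {f : V →ₗ[k] W} (hf : FinRank f) (g : U →ₗ[k] V) :
    FinRank (f ∘ₗ g) := by
  have : FiniteDimensional k (LinearMap.range f) := hf
  exact FinRank.of_le (LinearMap.range f) fun v => ⟨g v, rfl⟩

theorem FinRank.comp_left {f : V →ₗ[k] W} (hf : FinRank f) (g : W →ₗ[k] U) :
    FinRank (g ∘ₗ f) := by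
  have : FiniteDimensional k (LinearMap.range f) := hf
  exact FinRank.of_le ((LinearMap.range f).map g) fun v => ⟨f v, ⟨v, rfl⟩, rfl⟩

theorem FinRank.sum {ι : Type*} (s : Finset ι) {f : ι → V →ₗ[k] W} (hf : ∀ i ∈ s, FinRank (f i)) :
    FinRank (∑ i ∈ s, f i) :=
  Finset.sum_induction f FinRank (fun _ _ => FinRank.add) FinRank.zero hf

/-- The trace of an operator of finite rank, computed on its range. -/
def finTrace (f : V →ₗ[k] V) : k :=
  LinearMap.trace k (LinearMap.range f) (f.restrict (p := LinearMap.range f) fun v _ => ⟨v, rfl⟩)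

theorem finTrace_eq (f : V →ₗ[k] V) (S : Submodule k V) [FiniteDimensional k S]
    (h : ∀ v, f v ∈ S) : finTrace f = LinearMap.trace k S (f.restrict fun v _ => h v) := by
  have hle : LinearMap.range f ≤ S := by rintro _ ⟨v, rfl⟩; exact h v
  have : FiniteDimensional k (LinearMap.range f) := Submodule.finiteDimensional_of_le hle
  let a : LinearMap.range f →ₗ[k] S := Submodule.inclusion hle
  let b : S →ₗ[k] LinearMap.range f := f.rangeRestrict ∘ₗ S.subtype
  have h1 : f.restrict (p := LinearMap.range f) (q := LinearMap.range f) (fun v _ => ⟨v, rfl⟩) =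
      b ∘ₗ a := by ext; rfl
  have h2 : f.restrict (fun v _ => h v) = a ∘ₗ b := by ext; rfl
  rw [finTrace, h1, h2, LinearMap.trace_comp_comm']

theorem finTrace_comm {f : V →ₗ[k] W} (g : W →ₗ[k] V) (hf : FinRank f) :
    finTrace (g ∘ₗ f) = finTrace (f ∘ₗ g) := by
  have : FiniteDimensional k (LinearMap.range f) := hf
  let S := (LinearMap.range f).map g
  let a : S →ₗ[k] LinearMap.range f := f.rangeRestrict ∘ₗ S.subtype
  let b : LinearMap.range f →ₗ[k] S :=
    g.restrict (p := LinearMap.range f) (q := S) fun v hv => ⟨v, hv, rfl⟩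
  have hb : ∀ v, (f ∘ₗ g) v ∈ LinearMap.range f := fun v => ⟨g v, rfl⟩
  have ha : ∀ v, (g ∘ₗ f) v ∈ S := fun v => Submodule.mem_map_of_mem ⟨v, rfl⟩
  rw [finTrace_eq _ _ ha, finTrace_eq _ _ hb]
  have h1 : (g ∘ₗ f).restrict (fun v _ => ha v) = b ∘ₗ a := by ext; rfl
  have h2 : (f ∘ₗ g).restrict (fun v _ => hb v) = a ∘ₗ b := by ext; rfl
  rw [h1, h2, LinearMap.trace_comp_comm']

theorem finTrace_add {f g : V →ₗ[k] V} (hf : FinRank f) (hg : FinRank g) :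
    finTrace (f + g) = finTrace f + finTrace g := by
  have : FiniteDimensional k (LinearMap.range f) := hf
  have : FiniteDimensional k (LinearMap.range g) := hg
  have h1 : ∀ v, f v ∈ LinearMap.range f ⊔ LinearMap.range g := fun v =>
    Submodule.mem_sup_left ⟨v, rfl⟩
  have h2 : ∀ v, g v ∈ LinearMap.range f ⊔ LinearMap.range g := fun v =>
    Submodule.mem_sup_right ⟨v, rfl⟩
  rw [finTrace_eq f _ h1, finTrace_eq g _ h2,
    finTrace_eq (f + g) (LinearMap.range f ⊔ LinearMap.range g)
      (fun v => Submodule.add_mem _ (h1 v) (h2 v)), ← map_add]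
  rfl

theorem finTrace_smul {f : V →ₗ[k] V} (c : k) (hf : FinRank f) :
    finTrace (c • f) = c * finTrace f := by
  have : FiniteDimensional k (LinearMap.range f) := hf
  rw [finTrace_eq f (LinearMap.range f) (fun v => ⟨v, rfl⟩),
    finTrace_eq (c • f) (LinearMap.range f) (fun v => Submodule.smul_mem _ c ⟨v, rfl⟩),
    ← smul_eq_mul, ← map_smul]
  rfl

theorem finTrace_zero : finTrace (0 : V →ₗ[k] V) = 0 := by
  simpa using finTrace_smul (0 : k) (FinRank.zero (k := k) (V := V) (W := V))

theorem finTrace_neg {f : V →ₗ[k] V} (hf : FinRank f) : finTrace (-f) = -finTrace f := by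
  simpa using finTrace_smul (-1 : k) hf

theorem finTrace_sub {f g : V →ₗ[k] V} (hf : FinRank f) (hg : FinRank g) :
    finTrace (f - g) = finTrace f - finTrace g := by
  rw [sub_eq_add_neg, finTrace_add hf hg.neg, finTrace_neg hg, sub_eq_add_neg]

theorem finTrace_sum {ι : Type*} (s : Finset ι) {f : ι → V →ₗ[k] V}
    (hf : ∀ i ∈ s, FinRank (f i)) : finTrace (∑ i ∈ s, f i) = ∑ i ∈ s, finTrace (f i) := by
  classical
  induction s using Finset.induction_on with
  | empty => simpa using finTrace_zero
  | insert a s ha ih =>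
    rw [Finset.sum_insert ha, Finset.sum_insert ha, finTrace_add (hf _ (by simp))
      (FinRank.sum s fun i hi => hf i (by simp [hi])), ih fun i hi => hf i (by simp [hi])]

/-- An operator of finite rank commutes with any operator up to trace zero. -/
theorem finTrace_commutator {f : V →ₗ[k] V} (g : V →ₗ[k] V) (hf : FinRank f) :
    FinRank (f * g - g * f) ∧ finTrace (f * g - g * f) = 0 := by
  refine ⟨(hf.comp_right g).sub (hf.comp_left g), ?_⟩
  have := finTrace_sub (hf.comp_right g) (hf.comp_left g)
  rw [finTrace_comm g hf, sub_self] at this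
  exact this

/-- The trace of a commutator of finite rank does not change when the operators are modified by
operators of finite rank. -/
theorem finTrace_commutator_congr {a b a' b' : V →ₗ[k] V} (ha : FinRank (a' - a))
    (hb : FinRank (b' - b)) (h : FinRank (a * b - b * a)) :
    FinRank (a' * b' - b' * a') ∧ finTrace (a' * b' - b' * a') = finTrace (a * b - b * a) := by
  have e : a' * b' - b' * a' = (a * b - b * a) + (((a' - a) * b' - b' * (a' - a)) -
      ((b' - b) * a - a * (b' - b))) := by noncomm_ring
  obtain ⟨h1, t1⟩ := finTrace_commutator b' ha
  obtain ⟨h2, t2⟩ := finTrace_commutator a hb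
  rw [e]
  exact ⟨h.add (h1.sub h2), by rw [finTrace_add h (h1.sub h2), finTrace_sub h1 h2, t1, t2]; simp⟩

/-- A linear map with finite-dimensional kernel and cokernel is invertible up to operators of finite
rank. -/
theorem exists_parametrix (j : V →ₗ[k] W) [FiniteDimensional k (LinearMap.ker j)]
    [FiniteDimensional k (W ⧸ LinearMap.range j)] :
    ∃ s : W →ₗ[k] V, FinRank (s ∘ₗ j - LinearMap.id) ∧ FinRank (j ∘ₗ s - LinearMap.id) := by
  obtain ⟨r, hr⟩ := j.rangeRestrict.exists_rightInverse_of_surjective j.range_rangeRestrict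
  obtain ⟨C, hC⟩ := (LinearMap.range j).exists_isCompl
  have hr' : ∀ y, j (r y) = y := fun y => congr($hr y)
  have : FiniteDimensional k C :=
    (Submodule.quotientEquivOfIsCompl _ _ hC).finiteDimensional
  refine ⟨r ∘ₗ Submodule.projectionOnto _ _ hC, FinRank.of_le (LinearMap.ker j) fun v => ?_,
    FinRank.of_le C fun w => ?_⟩
  · have := Submodule.projectionOnto_apply_left hC (j.rangeRestrict v)
    have e : Submodule.projectionOnto _ _ hC (j v) = j.rangeRestrict v := this
    have e' : j (r (j.rangeRestrict v)) = j v := hr' _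
    simp [e, e']
  · have : w - Submodule.projectionOnto _ _ hC w ∈ C := by
      rw [← Submodule.projectionOnto_apply_eq_zero_iff hC, map_sub,
        Submodule.projectionOnto_apply_left, sub_self]
    simpa [hr'] using C.neg_mem this

/-- If a map with finite-dimensional kernel and cokernel intertwines, up to finite rank, operators
`a`, `b` with commuting operators, then the commutator of `a` and `b` has trace zero. -/
theorem finTrace_commutator_eq_zero (j : V →ₗ[k] W) [FiniteDimensional k (LinearMap.ker j)]
    [FiniteDimensional k (W ⧸ LinearMap.range j)] {a b : V →ₗ[k] V} {f g : W →ₗ[k] W}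
    (hfg : f ∘ₗ g = g ∘ₗ f) (ha : FinRank (j ∘ₗ a - f ∘ₗ j)) (hb : FinRank (j ∘ₗ b - g ∘ₗ j)) :
    finTrace (a * b - b * a) = 0 := by
  obtain ⟨s, hs, hs'⟩ := exists_parametrix j
  have key : ∀ {a : V →ₗ[k] V} {f : W →ₗ[k] W}, FinRank (j ∘ₗ a - f ∘ₗ j) →
      FinRank (a - s ∘ₗ f ∘ₗ j) := by
    intro a f h
    have e : a - s ∘ₗ f ∘ₗ j = s ∘ₗ (j ∘ₗ a - f ∘ₗ j) - (s ∘ₗ j - LinearMap.id) ∘ₗ a := by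
      ext v; simp
    rw [e]
    exact (h.comp_left s).sub (hs.comp_right a)
  -- with `F = j s - 1`, the commutator of `s f j` and `s g j` is `s (f F g - g F f) j`
  set F := j ∘ₗ s - LinearMap.id with hF
  have hjs : ∀ w, j (s w) = w + F w := fun w => by simp [hF]
  have hfg' : ∀ w, f (g w) = g (f w) := fun w => congr($hfg w)
  have hN : FinRank (f ∘ₗ F ∘ₗ g - g ∘ₗ F ∘ₗ f) :=
    ((hs'.comp_right g).comp_left f).sub ((hs'.comp_right f).comp_left g)
  have e : (s ∘ₗ f ∘ₗ j) * (s ∘ₗ g ∘ₗ j) - (s ∘ₗ g ∘ₗ j) * (s ∘ₗ f ∘ₗ j) =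
      s ∘ₗ ((f ∘ₗ F ∘ₗ g - g ∘ₗ F ∘ₗ f) ∘ₗ j) := by
    ext v; simp [hjs, hfg']
  have h0 : FinRank ((s ∘ₗ f ∘ₗ j) * (s ∘ₗ g ∘ₗ j) - (s ∘ₗ g ∘ₗ j) * (s ∘ₗ f ∘ₗ j)) := by
    rw [e]; exact (hN.comp_right j).comp_left s
  rw [(finTrace_commutator_congr (key ha) (key hb) h0).2, e,
    finTrace_comm s (hN.comp_right j)]
  have e2 : ((f ∘ₗ F ∘ₗ g - g ∘ₗ F ∘ₗ f) ∘ₗ j) ∘ₗ s =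
      (f ∘ₗ (F ∘ₗ g) - g ∘ₗ (F ∘ₗ f)) + (f ∘ₗ (F ∘ₗ g ∘ₗ F) - g ∘ₗ (F ∘ₗ f ∘ₗ F)) := by
    ext w; simp [hjs]; abel
  have t1 : finTrace (f ∘ₗ (F ∘ₗ g)) = finTrace (F ∘ₗ (g ∘ₗ f)) :=
    finTrace_comm f (hs'.comp_right g)
  have t2 : finTrace (g ∘ₗ (F ∘ₗ f)) = finTrace (F ∘ₗ (f ∘ₗ g)) :=
    finTrace_comm g (hs'.comp_right f)
  have t3 : finTrace (f ∘ₗ (F ∘ₗ g ∘ₗ F)) = finTrace ((F ∘ₗ g ∘ₗ F) ∘ₗ f) :=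
    finTrace_comm f (hs'.comp_right (g ∘ₗ F))
  have t4 : finTrace ((F ∘ₗ g) ∘ₗ (F ∘ₗ f)) = finTrace ((F ∘ₗ f) ∘ₗ (F ∘ₗ g)) :=
    finTrace_comm (F ∘ₗ g) (hs'.comp_right f)
  have t5 : finTrace (g ∘ₗ (F ∘ₗ f ∘ₗ F)) = finTrace ((F ∘ₗ f ∘ₗ F) ∘ₗ g) :=
    finTrace_comm g (hs'.comp_right (f ∘ₗ F))
  have r1 : ∀ {x y : W →ₗ[k] W}, FinRank (x ∘ₗ (F ∘ₗ y)) := fun {x y} =>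
    (hs'.comp_right y).comp_left x
  rw [e2, finTrace_add (r1.sub r1) (r1.sub r1), finTrace_sub r1 r1, finTrace_sub r1 r1, t1, t2, t3,
    t5, hfg]
  change _ + (finTrace ((F ∘ₗ g) ∘ₗ (F ∘ₗ f)) - finTrace ((F ∘ₗ f) ∘ₗ (F ∘ₗ g))) = 0
  rw [t4]; simp

end FiniteRank

end CurveLifting

namespace CurveLifting

/-! ### Laurent expansions at a point -/

section Place

variable {K : Type} [Field K] [Algebra ℂ K] {A : Subalgebra ℂ K} {z : K}

/-- `A` is a discrete valuation ring with fraction field `K` and residue field `ℂ`. -/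
structure IsPlace (A : Subalgebra ℂ K) : Prop where
  exists_coord : ∃ z, IsCoord A z
  factor : ∀ z, IsCoord A z → ∀ f, f ≠ 0 → ∃ (n : ℤ) (u : K), u ∈ A ∧ u⁻¹ ∈ A ∧ f = z ^ n * u
  resid : ∀ f ∈ A, ∃ c : ℂ, ∀ g ∈ A, (f - algebraMap ℂ K c) * g ≠ 1

theorem IsCoord.mem (hz : IsCoord A z) : z ∈ A := hz.1

theorem IsCoord.ne_zero (hz : IsCoord A z) : z ≠ 0 := hz.2.1

theorem IsCoord.inv_notMem (hz : IsCoord A z) : z⁻¹ ∉ A := fun h =>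
  (hz.2.2 z hz.1).mpr ⟨1, A.one_mem, by simp⟩ ⟨z⁻¹, h, mul_inv_cancel₀ hz.2.1⟩

theorem IsCoord.zpow_mem (hz : IsCoord A z) {n : ℤ} (hn : 0 ≤ n) : z ^ n ∈ A := by
  lift n to ℕ using hn
  simpa using A.pow_mem hz.1 n

theorem IsCoord.zpow_mul_mem_mono (hz : IsCoord A z) {m n : ℤ} (hmn : m ≤ n) {f : K}
    (h : z ^ m * f ∈ A) : z ^ n * f ∈ A := by
  have : z ^ n * f = z ^ (n - m) * (z ^ m * f) := by
    rw [← mul_assoc, ← zpow_add₀ hz.ne_zero]; simp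
  rw [this]
  exact A.mul_mem (hz.zpow_mem (by omega)) h

theorem IsCoord.zpow_mul_unit_mem (hz : IsCoord A z) {n : ℤ} {u : K} (hu : u⁻¹ ∈ A) (hu0 : u ≠ 0)
    (h : z ^ n * u ∈ A) : 0 ≤ n := by
  by_contra hn
  refine hz.inv_notMem ?_
  have h1 : z ^ n * 1 ∈ A := by simpa [mul_assoc, hu0] using A.mul_mem h hu
  simpa using hz.zpow_mul_mem_mono (n := -1) (by omega) h1

theorem IsCoord.algebraMap_eq_zero (hz : IsCoord A z) {c : ℂ} {g : K} (hg : g ∈ A)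
    (h : algebraMap ℂ K c = z * g) : c = 0 := by
  by_contra hc
  refine hz.inv_notMem ?_
  have : z⁻¹ = g * algebraMap ℂ K c⁻¹ := by
    have h0 : algebraMap ℂ K c ≠ 0 := by simpa using hc
    have hz0 := hz.ne_zero
    rw [map_inv₀]
    field_simp
    rw [h]
  rw [this]
  exact A.mul_mem hg (A.algebraMap_mem _)

theorem IsCoord.nonunit_iff (hz : IsCoord A z) {f : K} (hf : f ∈ A) :
    f⁻¹ ∉ A ∨ f = 0 ↔ ∃ g ∈ A, f = z * g := by
  rw [← hz.2.2 f hf]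
  constructor
  · rintro h ⟨g, hg, hfg⟩
    have : f ≠ 0 := by rintro rfl; simp at hfg
    rw [← eq_inv_of_mul_eq_one_right hfg] at h
    tauto
  · intro h
    by_cases h0 : f = 0
    · exact Or.inr h0
    · exact Or.inl fun h' => h ⟨_, h', mul_inv_cancel₀ h0⟩

theorem IsPlace.exists_sub_eq (hA : IsPlace A) (hz : IsCoord A z) {f : K} (hf : f ∈ A) :
    ∃ c : ℂ, ∃ g ∈ A, f - algebraMap ℂ K c = z * g := by
  obtain ⟨c, hc⟩ := hA.resid f hf
  exact ⟨c, (hz.2.2 _ (A.sub_mem hf (A.algebraMap_mem c))).mp (by simpa using hc)⟩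

theorem IsPlace.inv_mem (hA : IsPlace A) {f : K} (hf : f ∉ A) : f⁻¹ ∈ A := by
  obtain ⟨z, hz⟩ := hA.exists_coord
  obtain ⟨n, u, hu, hu', rfl⟩ := hA.factor z hz f (by rintro rfl; exact hf A.zero_mem)
  have hn : n < 0 := by
    by_contra hn
    exact hf (A.mul_mem (hz.zpow_mem (by omega)) hu)
  rw [mul_inv, ← zpow_neg]
  exact A.mul_mem (hz.zpow_mem (by omega)) hu'

theorem IsPlace.exists_zpow_mul_mem (hA : IsPlace A) (hz : IsCoord A z) (f : K) :
    ∃ N : ℕ, z ^ (N : ℤ) * f ∈ A := by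
  by_cases h0 : f = 0
  · exact ⟨0, by simp [h0]⟩
  obtain ⟨n, u, hu, -, rfl⟩ := hA.factor z hz f h0
  refine ⟨(-n).toNat, ?_⟩
  rw [← mul_assoc, ← zpow_add₀ hz.ne_zero]
  exact A.mul_mem (hz.zpow_mem (by omega)) hu

/-- The principal part of a rational function with a pole of order at most `N`. -/
theorem IsPlace.exists_principalPart (hA : IsPlace A) (hz : IsCoord A z) (N : ℕ) {f : K}
    (hf : z ^ (N : ℤ) * f ∈ A) :
    ∃ a : ℕ → ℂ, f - ∑ i ∈ Finset.range N, algebraMap ℂ K (a i) * z ^ (-(i : ℤ) - 1) ∈ A := by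
  induction N generalizing f with
  | zero => exact ⟨0, by simpa using hf⟩
  | succ N ih =>
    obtain ⟨c, g, hg, hcg⟩ := hA.exists_sub_eq hz hf
    obtain ⟨a, ha⟩ := ih (f := f - algebraMap ℂ K c * z ^ (-(N : ℤ) - 1)) (by
      have e : z ^ (N : ℤ) * (f - algebraMap ℂ K c * z ^ (-(N : ℤ) - 1)) = g := by
        apply mul_left_cancel₀ hz.ne_zero
        rw [← hcg, Nat.cast_succ, zpow_add₀ hz.ne_zero, zpow_sub₀ hz.ne_zero, zpow_neg]
        have := hz.ne_zero
        field_simp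
      rwa [e])
    refine ⟨fun i => if i = N then c else a i, ?_⟩
    have e : ∑ i ∈ Finset.range N, algebraMap ℂ K (if i = N then c else a i) * z ^ (-(i : ℤ) - 1) =
        ∑ i ∈ Finset.range N, algebraMap ℂ K (a i) * z ^ (-(i : ℤ) - 1) :=
      Finset.sum_congr rfl fun i hi => by rw [if_neg (Finset.mem_range.mp hi).ne]
    simp only [Finset.sum_range_succ, e, if_true]
    convert! ha using 1
    ring

theorem laurent_sum_eq (a : ℤ →₀ ℂ) :
    a.sum (fun i t => algebraMap ℂ K t * z ^ i) =
      Finsupp.linearCombination ℂ (fun i : ℤ => z ^ i) a := by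
  simp [Finsupp.linearCombination_apply, Algebra.smul_def]

theorem HasCoeff.add {n : ℤ} {f g : K} {c d : ℂ} (hf : HasCoeff A z n f c)
    (hg : HasCoeff A z n g d) : HasCoeff A z n (f + g) (c + d) := by
  obtain ⟨a, ha, rfl, f', hf', e⟩ := hf
  obtain ⟨b, hb, rfl, g', hg', e'⟩ := hg
  refine ⟨a + b, fun i hi => by simp [ha i hi, hb i hi], rfl, f' + g', A.add_mem hf' hg', ?_⟩
  rw [laurent_sum_eq] at e e' ⊢
  rw [map_add, mul_add, ← e, ← e']
  ring

theorem HasCoeff.smul {n : ℤ} {f : K} {c : ℂ} (t : ℂ) (hf : HasCoeff A z n f c) :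
    HasCoeff A z n (t • f) (t * c) := by
  obtain ⟨a, ha, rfl, f', hf', e⟩ := hf
  refine ⟨t • a, fun i hi => by simp [ha i hi], rfl, t • f', A.smul_mem hf' t, ?_⟩
  rw [laurent_sum_eq] at e ⊢
  rw [map_smul, mul_smul_comm, ← e, smul_sub]

theorem HasCoeff.of_mem {n : ℤ} {f : K} (hz : IsCoord A z) (hf : z ^ (-(n + 1)) * f ∈ A) :
    HasCoeff A z n f 0 := by
  refine ⟨0, by simp, by simp, _, hf, ?_⟩
  rw [← mul_assoc, ← zpow_add₀ hz.ne_zero]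
  simp

theorem HasCoeff.zpow_mul {n : ℤ} {f : K} {c : ℂ} (hz : IsCoord A z) (m : ℤ)
    (hf : HasCoeff A z n f c) : HasCoeff A z (m + n) (z ^ m * f) c := by
  obtain ⟨a, ha, rfl, f', hf', e⟩ := hf
  have hinj : Function.Injective (fun i : ℤ => m + i) := fun i j h => by simpa using h
  refine ⟨a.mapDomain (fun i => m + i), fun i hi => ?_, Finsupp.mapDomain_apply hinj a n, f', hf',
    ?_⟩
  · have : i = m + (i - m) := by ring
    rw [this]
    exact (Finsupp.mapDomain_apply hinj a (i - m)).trans (ha _ (by omega))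
  · have : (a.mapDomain (fun i => m + i)).sum (fun i t => algebraMap ℂ K t * z ^ i) =
        z ^ m * a.sum (fun i t => algebraMap ℂ K t * z ^ i) := by
      rw [Finsupp.sum_mapDomain_index (by simp) (by simp [add_mul]), Finsupp.mul_sum]
      refine Finsupp.sum_congr fun i _ => ?_
      rw [zpow_add₀ hz.ne_zero]; ring
    rw [this, ← mul_sub, e, add_assoc, zpow_add₀ hz.ne_zero m, mul_assoc]

theorem HasCoeff.monomial (n : ℤ) (c : ℂ) : HasCoeff A z n (algebraMap ℂ K c * z ^ n) c := by
  refine ⟨Finsupp.single n c, fun i hi => by simp [hi.ne], by simp, 0,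
    A.zero_mem, ?_⟩
  rw [Finsupp.sum_single_index (by simp)]
  simp

theorem HasCoeff.eq_zero {n : ℤ} {c : ℂ} (hz : IsCoord A z) (h : HasCoeff A z n 0 c) : c = 0 := by
  obtain ⟨a, ha, rfl, g, hg, e⟩ := h
  have hz0 := hz.ne_zero
  -- the lowest nonzero coefficient would be divisible by `z`
  by_contra hn
  have hne : a.support.Nonempty := ⟨n, by simpa using hn⟩
  set k := a.support.min' hne
  have hk : k ∈ a.support := a.support.min'_mem hne
  have hkn : k ≤ n := a.support.min'_le n (by simpa using hn)
  have hmem : z ^ (-(k + 1)) * (algebraMap ℂ K (a k) * z ^ k) ∈ A := by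
    have h1 : algebraMap ℂ K (a k) * z ^ k =
        -(∑ i ∈ a.support.erase k, algebraMap ℂ K (a i) * z ^ i) - z ^ (n + 1) * g := by
      rw [← e, Finsupp.sum, ← Finset.add_sum_erase _ _ hk]; ring
    rw [h1, mul_sub, mul_neg, Finset.mul_sum]
    refine A.sub_mem (A.neg_mem (A.sum_mem fun i hi => ?_)) ?_
    · have hi' : k < i := lt_of_le_of_ne (a.support.min'_le i (Finset.mem_of_mem_erase hi))
        (Finset.ne_of_mem_erase hi).symm
      rw [mul_left_comm, ← zpow_add₀ hz0]
      exact A.mul_mem (A.algebraMap_mem _) (hz.zpow_mem (by omega))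
    · rw [← mul_assoc, ← zpow_add₀ hz0]
      exact A.mul_mem (hz.zpow_mem (by omega)) hg
  refine (Finsupp.mem_support_iff.mp hk) (hz.algebraMap_eq_zero hmem ?_)
  rw [zpow_neg, zpow_add₀ hz0]
  field_simp

theorem HasCoeff.unique {n : ℤ} {f : K} {c d : ℂ} (hz : IsCoord A z) (hc : HasCoeff A z n f c)
    (hd : HasCoeff A z n f d) : c = d := by
  have := hc.add (hd.smul (-1))
  simp only [neg_smul, one_smul, add_neg_cancel] at this
  linear_combination this.eq_zero hz

theorem IsPlace.hasCoeff (hA : IsPlace A) (hz : IsCoord A z) (n : ℤ) (f : K) :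
    HasCoeff A z n f (coeff A z n f) := by
  refine Classical.epsilon_spec (p := HasCoeff A z n f) ?_
  suffices ∃ c, HasCoeff A z (-1) (z ^ (-(n + 1)) * f) c by
    obtain ⟨c, hc⟩ := this
    refine ⟨c, ?_⟩
    have := hc.zpow_mul hz (n + 1)
    rwa [← mul_assoc, ← zpow_add₀ hz.ne_zero, add_neg_cancel, zpow_zero, one_mul,
      add_neg_cancel_right] at this
  generalize z ^ (-(n + 1)) * f = g
  obtain ⟨N, hN⟩ := hA.exists_zpow_mul_mem hz g
  obtain ⟨a, ha⟩ := hA.exists_principalPart hz N hN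
  refine ⟨_, ∑ i ∈ Finset.range N, Finsupp.single (-(i : ℤ) - 1) (a i), fun i hi => ?_, rfl, _, ha,
    ?_⟩
  · rw [Finsupp.finsetSum_apply]
    exact Finset.sum_eq_zero fun j _ => Finsupp.single_eq_of_ne (by omega)
  · rw [laurent_sum_eq, map_sum]
    simp [Algebra.smul_def]

theorem IsPlace.coeff_eq (hA : IsPlace A) (hz : IsCoord A z) {n : ℤ} {f : K} {c : ℂ}
    (h : HasCoeff A z n f c) : coeff A z n f = c :=
  (hA.hasCoeff hz n f).unique hz h

/-- The coefficient of `z ^ n`, as a linear form on the function field. -/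
def IsPlace.coeffHom (hA : IsPlace A) (hz : IsCoord A z) (n : ℤ) : K →ₗ[ℂ] ℂ where
  toFun := coeff A z n
  map_add' f g := hA.coeff_eq hz ((hA.hasCoeff hz n f).add (hA.hasCoeff hz n g))
  map_smul' t f := hA.coeff_eq hz ((hA.hasCoeff hz n f).smul t)

theorem IsPlace.coeff_zpow_mul (hA : IsPlace A) (hz : IsCoord A z) (m n : ℤ) (f : K) :
    coeff A z (m + n) (z ^ m * f) = coeff A z n f :=
  hA.coeff_eq hz ((hA.hasCoeff hz n f).zpow_mul hz m)

/-- The part of the expansion below degree `n` consists of the coefficients. -/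
theorem IsPlace.mem_of_coeff_eq_zero (hA : IsPlace A) (hz : IsCoord A z) {f : K} (hf : f ∈ A)
    {n : ℕ} (h : ∀ l < n, coeff A z l f = 0) : z ^ (-(n : ℤ)) * f ∈ A := by
  induction n with
  | zero => simpa using hf
  | succ n ih =>
    have h1 := ih fun l hl => h l (by omega)
    obtain ⟨c, g, hg, hcg⟩ := hA.exists_sub_eq hz h1
    have hc : HasCoeff A z 0 (z ^ (-(n : ℤ)) * f) c := by
      have h2 : HasCoeff A z 0 (z * g) 0 := HasCoeff.of_mem hz (by
        have : z ^ (-(0 + 1) : ℤ) * (z * g) = g := by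
          have := hz.ne_zero
          rw [zero_add, zpow_neg_one]
          field_simp
        rwa [this])
      have h3 := (HasCoeff.monomial (A := A) (z := z) 0 c).add h2
      rw [← hcg] at h3
      simpa using h3
    have hc0 : c = 0 := by
      rw [← hA.coeff_eq hz hc, ← h n (by omega), ← hA.coeff_zpow_mul hz (-(n : ℤ)) n f]
      simp
    have e : z ^ (-((n + 1 : ℕ) : ℤ)) * f = g := by
      apply mul_left_cancel₀ hz.ne_zero
      rw [← hcg, hc0, map_zero, sub_zero, ← mul_assoc]
      congr 1
      rw [← zpow_one_add₀ hz.ne_zero]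
      congr 1
      push_cast; ring
    rwa [e]

theorem IsPlace.coeff_of_mem (hA : IsPlace A) (hz : IsCoord A z) {f : K} {n : ℤ}
    (hf : z ^ (-(n + 1)) * f ∈ A) : coeff A z n f = 0 :=
  hA.coeff_eq hz (HasCoeff.of_mem hz hf)

end Place

end CurveLifting

namespace CurveLifting

/-! ### The residue as the trace of a commutator -/

section Residue

variable {K : Type} [Field K] [Algebra ℂ K] {A : Subalgebra ℂ K} {z : K}

theorem exists_regularPart (A : Subalgebra ℂ K) :
    ∃ π : K →ₗ[ℂ] A, π ∘ₗ A.val.toLinearMap = LinearMap.id :=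
  A.val.toLinearMap.exists_leftInverse_of_injective (LinearMap.ker_eq_bot.mpr Subtype.val_injective)

/-- A linear projection of the function field onto the local ring `A`. -/
def regularPart (A : Subalgebra ℂ K) : K →ₗ[ℂ] A := (exists_regularPart A).choose

theorem regularPart_coe (a : A) : regularPart A a = a :=
  congr($((exists_regularPart A).choose_spec) a)

theorem regularPart_of_mem {f : K} (hf : f ∈ A) : (regularPart A f : K) = f :=
  congr($(regularPart_coe ⟨f, hf⟩).1)

/-- The compression to `A` of the multiplication by a rational function. -/
def toeplitz (A : Subalgebra ℂ K) : K →ₗ[ℂ] A →ₗ[ℂ] A :=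
  LinearMap.mk₂ ℂ (fun f (a : A) => regularPart A (f * a)) (by simp [add_mul]) (by simp)
    (by simp [mul_add]) (by simp)

theorem toeplitz_apply (f : K) (a : A) : toeplitz A f a = regularPart A (f * a) := rfl

theorem toeplitz_coe (f a : A) : toeplitz A f a = f * a := regularPart_coe (f * a)

theorem toeplitz_one : toeplitz A 1 = LinearMap.id := by
  ext a; exact congr($(toeplitz_coe 1 a).1).trans (by simp)

theorem IsPlace.finRank_sub_regularPart (hA : IsPlace A) (f : K) :
    FinRank ((LinearMap.id - A.val.toLinearMap ∘ₗ regularPart A) ∘ₗ LinearMap.mulLeft ℂ f ∘ₗ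
      A.val.toLinearMap) := by
  obtain ⟨z, hz⟩ := hA.exists_coord
  obtain ⟨N, hN⟩ := hA.exists_zpow_mul_mem hz f
  set ρ := LinearMap.id - A.val.toLinearMap ∘ₗ regularPart A with hρ
  have hρA : ∀ h ∈ A, ρ h = 0 := fun h hh => by simp [hρ, regularPart_of_mem hh]
  let S : Submodule ℂ K :=
    Submodule.span ℂ ((fun i : ℕ => ρ (z ^ (-(i : ℤ) - 1))) '' (Finset.range N))
  have : FiniteDimensional ℂ S :=
    FiniteDimensional.span_of_finite ℂ ((Finset.finite_toSet _).image _)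
  refine FinRank.of_le S fun a => ?_
  obtain ⟨c, hc⟩ := hA.exists_principalPart hz N (f := f * a) (by
    rw [← mul_assoc]; exact A.mul_mem hN a.2)
  have e := hρA _ hc
  rw [map_sub, sub_eq_zero] at e
  change ρ (f * a) ∈ S
  rw [e, map_sum]
  refine S.sum_mem fun i hi => ?_
  rw [← Algebra.smul_def, map_smul]
  exact S.smul_mem _ (Submodule.subset_span ⟨i, by simpa using hi, rfl⟩)

theorem IsPlace.finRank_toeplitz_mul (hA : IsPlace A) (f g : K) :
    FinRank (toeplitz A f * toeplitz A g - toeplitz A (f * g)) := by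
  have := ((hA.finRank_sub_regularPart g).comp_left
    (regularPart A ∘ₗ LinearMap.mulLeft ℂ f)).neg
  convert! this using 1
  ext a
  simp only [LinearMap.sub_apply, Module.End.mul_apply, toeplitz_apply, LinearMap.neg_apply,
    LinearMap.comp_apply, LinearMap.mulLeft_apply, LinearMap.id_apply, map_sub, mul_assoc]
  simp

theorem IsPlace.finRank_commutator (hA : IsPlace A) (f g : K) :
    FinRank (toeplitz A f * toeplitz A g - toeplitz A g * toeplitz A f) := by
  have := (hA.finRank_toeplitz_mul f g).sub (hA.finRank_toeplitz_mul g f)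
  rw [mul_comm g f] at this
  convert! this using 1
  abel

/-- The trace of the commutator of the compressions of two rational functions. -/
def symbol (A : Subalgebra ℂ K) (f g : K) : ℂ :=
  finTrace (toeplitz A f * toeplitz A g - toeplitz A g * toeplitz A f)

theorem IsPlace.symbol_add_left (hA : IsPlace A) (f f' g : K) :
    symbol A (f + f') g = symbol A f g + symbol A f' g := by
  rw [symbol, symbol, symbol, ← finTrace_add (hA.finRank_commutator _ _)
    (hA.finRank_commutator _ _), map_add]
  congr 1
  noncomm_ring

theorem IsPlace.symbol_smul_left (hA : IsPlace A) (c : ℂ) (f g : K) :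
    symbol A (c • f) g = c * symbol A f g := by
  rw [symbol, symbol, ← finTrace_smul c (hA.finRank_commutator _ _), map_smul]
  congr 1
  rw [smul_sub, smul_mul_assoc, mul_smul_comm]

theorem IsPlace.symbol_swap (hA : IsPlace A) (f g : K) : symbol A g f = -symbol A f g := by
  rw [symbol, symbol, ← finTrace_neg (hA.finRank_commutator _ _), neg_sub]

theorem IsPlace.symbol_add_right (hA : IsPlace A) (f g g' : K) :
    symbol A f (g + g') = symbol A f g + symbol A f g' := by
  rw [hA.symbol_swap, hA.symbol_add_left, hA.symbol_swap f, hA.symbol_swap f]; ring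

theorem IsPlace.symbol_smul_right (hA : IsPlace A) (c : ℂ) (f g : K) :
    symbol A f (c • g) = c * symbol A f g := by
  rw [hA.symbol_swap, hA.symbol_smul_left, hA.symbol_swap f]; ring

/-- The symbol is a derivation in its second argument. This follows from the identity
`[a, bc] + [b, ca] + [c, ab] = 0`. -/
theorem IsPlace.symbol_mul (hA : IsPlace A) (f g h : K) :
    symbol A f (g * h) = symbol A (g * f) h + symbol A (h * f) g := by
  set a := toeplitz A f
  set b := toeplitz A g
  set c := toeplitz A h
  have key : ∀ f g h : K, FinRank (toeplitz A f * (toeplitz A g * toeplitz A h) -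
      (toeplitz A g * toeplitz A h) * toeplitz A f) ∧
      finTrace (toeplitz A f * (toeplitz A g * toeplitz A h) -
      (toeplitz A g * toeplitz A h) * toeplitz A f) = symbol A f (g * h) := fun f g h =>
    finTrace_commutator_congr (a := toeplitz A f) (b := toeplitz A (g * h))
      (by simpa using FinRank.zero) (hA.finRank_toeplitz_mul g h) (hA.finRank_commutator _ _)
  obtain ⟨h1, t1⟩ := key f g h
  obtain ⟨h2, t2⟩ := key g h f
  obtain ⟨h3, t3⟩ := key h f g
  have e : (a * (b * c) - (b * c) * a) + ((b * (c * a) - (c * a) * b) +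
      (c * (a * b) - (a * b) * c)) = 0 := by noncomm_ring
  have := finTrace_add h1 (h2.add h3)
  rw [finTrace_add h2 h3, t1, t2, t3, e, finTrace_zero] at this
  rw [hA.symbol_swap h (g * f), hA.symbol_swap g (h * f), mul_comm g f]
  linear_combination -this

theorem symbol_of_mem {f g : K} (hf : f ∈ A) (hg : g ∈ A) : symbol A f g = 0 := by
  have : toeplitz A f * toeplitz A g - toeplitz A g * toeplitz A f = 0 := by
    ext a
    have h1 := toeplitz_coe ⟨f, hf⟩ (⟨g, hg⟩ * a)
    have h2 := toeplitz_coe ⟨g, hg⟩ (⟨f, hf⟩ * a)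
    have h3 := toeplitz_coe ⟨f, hf⟩ a
    have h4 := toeplitz_coe ⟨g, hg⟩ a
    simp only at h1 h2 h3 h4
    simp [h1, h2, h3, h4, mul_left_comm]
  rw [symbol, this, finTrace_zero]

theorem symbol_one (g : K) : symbol A 1 g = 0 := by
  rw [symbol, toeplitz_one]
  have : LinearMap.id * toeplitz A g - toeplitz A g * LinearMap.id = 0 := by ext; simp
  rw [this, finTrace_zero]

theorem finTrace_smulRight {V : Type*} [AddCommGroup V] [Module ℂ V] (l : V →ₗ[ℂ] ℂ) (v : V) :
    finTrace (l.smulRight v) = l v := by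
  have h1 : l.smulRight v = LinearMap.toSpanSingleton ℂ V v ∘ₗ l := by ext; simp
  have h2 : l ∘ₗ LinearMap.toSpanSingleton ℂ V v = l v • LinearMap.id := by ext; simp
  have h3 : FinRank (LinearMap.id : ℂ →ₗ[ℂ] ℂ) := FinRank.of_le ⊤ (by simp)
  rw [h1, finTrace_comm _ (FinRank.of_le ⊤ (by simp)), h2, finTrace_smul _ h3,
    finTrace_eq _ ⊤ (by simp)]
  have : (LinearMap.id : ℂ →ₗ[ℂ] ℂ).restrict (p := ⊤) (q := ⊤) (by simp) = LinearMap.id := by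
    ext; simp
  rw [this, LinearMap.trace_id]
  simp

theorem IsPlace.symbol_inv_coord (hA : IsPlace A) (hz : IsCoord A z) : symbol A z⁻¹ z = 1 := by
  have hz0 := hz.ne_zero
  -- the commutator is `a ↦ a(x) e` with `e = 1 - z π(1/z)`
  let e : A := 1 - ⟨z, hz.mem⟩ * regularPart A z⁻¹
  have hc : toeplitz A z⁻¹ * toeplitz A z - toeplitz A z * toeplitz A z⁻¹ =
      ((hA.coeffHom hz 0) ∘ₗ A.val.toLinearMap).smulRight e := by
    ext a
    obtain ⟨c, g, hg, h⟩ := hA.exists_sub_eq hz a.2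
    have hc : coeff A z 0 a = c := by
      have h1 := (HasCoeff.monomial (A := A) (z := z) 0 c)
      have h2 : HasCoeff A z 0 (z * g) 0 := HasCoeff.of_mem hz (by
        rw [zero_add, zpow_neg_one, inv_mul_cancel_left₀ hz0]; exact hg)
      have h3 := h1.add h2
      rw [← h] at h3
      exact hA.coeff_eq hz (by simpa using h3)
    have h4 := toeplitz_coe ⟨z, hz.mem⟩ a
    have h5 := fun b => toeplitz_coe ⟨z, hz.mem⟩ b
    simp only at h4 h5
    have h6 : toeplitz A z⁻¹ (⟨z, hz.mem⟩ * a) = a := by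
      rw [toeplitz_apply]
      simp [hz0, regularPart_coe]
    have h7 : toeplitz A z⁻¹ a = c • regularPart A z⁻¹ + ⟨g, hg⟩ := by
      rw [toeplitz_apply, sub_eq_iff_eq_add.mp h, mul_add, inv_mul_cancel_left₀ hz0, mul_comm z⁻¹,
        ← Algebra.smul_def, add_comm, map_add, map_smul, regularPart_coe ⟨g, hg⟩]
    simp only [LinearMap.sub_apply, Module.End.mul_apply, h4, h5, h6, h7]
    change (a : K) - z * ((c • regularPart A z⁻¹ + ⟨g, hg⟩ : A) : K) =
      ((coeff A z 0 a • (1 - ⟨z, hz.mem⟩ * regularPart A z⁻¹) : A) : K)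
    rw [hc, eq_add_of_sub_eq h]
    simp only [Subalgebra.coe_add, Subalgebra.coe_smul, Subalgebra.coe_sub, Subalgebra.coe_mul,
      Subalgebra.coe_one, Algebra.smul_def c (_ : K)]
    ring
  rw [symbol, hc, finTrace_smulRight]
  change coeff A z 0 (e : K) = 1
  have h1 := (HasCoeff.monomial (A := A) (z := z) 0 1)
  have h2 : HasCoeff A z 0 (z * (-(regularPart A z⁻¹ : K))) 0 := HasCoeff.of_mem hz (by
    rw [zero_add, zpow_neg_one, inv_mul_cancel_left₀ hz0]; exact A.neg_mem (Subtype.property _))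
  have h3 := h1.add h2
  refine hA.coeff_eq hz ?_
  convert! h3 using 1
  · simp [e, sub_eq_add_neg]
  · simp

variable (K) in
/-- The `ℂ`-linear forms on `K`, on which `K` acts by multiplication of the argument. -/
def FunctionForms : Type := K →ₗ[ℂ] ℂ

/-- The underlying linear form. -/
def FunctionForms.form (l : FunctionForms K) : K →ₗ[ℂ] ℂ := l

theorem FunctionForms.ext {l l' : FunctionForms K} (h : ∀ f, l.form f = l'.form f) : l = l' :=
  LinearMap.ext h

instance : AddCommGroup (FunctionForms K) := inferInstanceAs (AddCommGroup (K →ₗ[ℂ] ℂ))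

theorem FunctionForms.add_form (l l' : FunctionForms K) (f : K) :
    (l + l').form f = l.form f + l'.form f := rfl

instance : SMul K (FunctionForms K) := ⟨fun h l => l.form ∘ₗ LinearMap.mulLeft ℂ h⟩

theorem FunctionForms.smul_form (h : K) (l : FunctionForms K) (f : K) :
    (h • l).form f = l.form (h * f) := rfl

instance : Module K (FunctionForms K) where
  one_smul l := FunctionForms.ext fun f => by rw [FunctionForms.smul_form, one_mul]
  mul_smul h h' l := FunctionForms.ext fun f => by
    simp only [FunctionForms.smul_form]
    congr 1
    ring
  smul_zero h := rfl
  zero_smul l := FunctionForms.ext fun f => by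
    rw [FunctionForms.smul_form, zero_mul, map_zero]; rfl
  smul_add h l l' := rfl
  add_smul h h' l := FunctionForms.ext fun f => by
    simp only [FunctionForms.smul_form, FunctionForms.add_form, add_mul, map_add]

instance : Module ℂ (FunctionForms K) := Module.compHom _ (algebraMap ℂ K)

instance : IsScalarTower ℂ K (FunctionForms K) := IsScalarTower.of_algebraMap_smul fun _ _ => rfl

theorem FunctionForms.complex_smul_form (c : ℂ) (l : FunctionForms K) (f : K) :
    (c • l).form f = c * l.form f := by
  rw [← algebraMap_smul K, FunctionForms.smul_form, ← Algebra.smul_def, map_smul, smul_eq_mul]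

/-- The linear form `f ↦ symbol f g`. -/
def IsPlace.symbolForm (hA : IsPlace A) (g : K) : FunctionForms K :=
  LinearMap.mk ⟨fun f => symbol A f g, fun f f' => hA.symbol_add_left f f' g⟩
    fun c f => hA.symbol_smul_left c f g

theorem IsPlace.symbolForm_form (hA : IsPlace A) (f g : K) :
    (hA.symbolForm g).form f = symbol A f g := rfl

/-- The derivation `g ↦ (f ↦ symbol f g)`. -/
def IsPlace.symbolDerivation (hA : IsPlace A) : Derivation ℂ K (FunctionForms K) :=
  Derivation.mk'
    { toFun := hA.symbolForm
      map_add' := fun g g' => FunctionForms.ext fun f => by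
        simp only [FunctionForms.add_form, hA.symbolForm_form, hA.symbol_add_right]
      map_smul' := fun c g => FunctionForms.ext fun f => by
        rw [RingHom.id_apply, FunctionForms.complex_smul_form, hA.symbolForm_form,
          hA.symbolForm_form, hA.symbol_smul_right] }
    fun g h => FunctionForms.ext fun f => by
      change (hA.symbolForm (g * h)).form f =
        (g • hA.symbolForm h + h • hA.symbolForm g).form f
      simp only [FunctionForms.add_form, FunctionForms.smul_form, hA.symbolForm_form,
        hA.symbol_mul]

/-- The residue of a rational differential as a linear form: `f dg` is sent to the symbol
of `f` and `g`. -/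
def IsPlace.res (hA : IsPlace A) : Ω[K⁄ℂ] →ₗ[ℂ] ℂ where
  toFun ω := (hA.symbolDerivation.liftKaehlerDifferential ω).form 1
  map_add' ω η := by rw [map_add, FunctionForms.add_form]
  map_smul' c ω := by
    rw [← algebraMap_smul K, map_smul, algebraMap_smul, FunctionForms.complex_smul_form]
    rfl

theorem IsPlace.res_smul_D (hA : IsPlace A) (f g : K) :
    hA.res (f • KaehlerDifferential.D ℂ K g) = symbol A f g := by
  have e : hA.res (f • KaehlerDifferential.D ℂ K g) =
    (hA.symbolDerivation.liftKaehlerDifferential (f • KaehlerDifferential.D ℂ K g)).form 1 := rfl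
  rw [e, map_smul, Derivation.liftKaehlerDifferential_comp_D, FunctionForms.smul_form, mul_one]
  rfl

theorem IsPlace.D_coord_ne_zero (hA : IsPlace A) (hz : IsCoord A z) :
    KaehlerDifferential.D ℂ K z ≠ 0 := fun h => by
  have := hA.res_smul_D z⁻¹ z
  rw [h, smul_zero, map_zero, hA.symbol_inv_coord hz] at this
  exact zero_ne_one this

theorem IsPlace.res_smul_D_coord (hA : IsPlace A) (hz : IsCoord A z) (f : K) :
    hA.res (f • KaehlerDifferential.D ℂ K z) = coeff A z (-1) f := by
  have hz0 := hz.ne_zero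
  obtain ⟨N, hN⟩ := hA.exists_zpow_mul_mem hz f
  obtain ⟨a, ha⟩ := hA.exists_principalPart hz N hN
  have hmon : ∀ i : ℕ, symbol A (z ^ (-(i : ℤ) - 1)) z = coeff A z (-1) (z ^ (-(i : ℤ) - 1)) := by
    intro i
    obtain rfl | hi := Nat.eq_zero_or_pos i
    · have := hA.symbol_inv_coord hz
      rw [Nat.cast_zero, neg_zero, zero_sub, zpow_neg_one, this]
      have := HasCoeff.monomial (A := A) (z := z) (-1) 1
      rw [map_one, one_mul, zpow_neg_one] at this
      exact (hA.coeff_eq hz this).symm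
    · -- `z ^ (-i - 1) dz` is a multiple of `d (z ^ (-i))`
      have h1 : KaehlerDifferential.D ℂ K (z ^ (-(i : ℤ))) =
          (-(i : ℤ)) • z ^ (-(i : ℤ) - 1) • KaehlerDifferential.D ℂ K z :=
        Derivation.leibniz_zpow _ _ _
      have h2 : (-(i : ℂ)) * symbol A (z ^ (-(i : ℤ) - 1)) z = 0 := by
        rw [← hA.res_smul_D, ← smul_eq_mul, ← map_smul]
        have : (-(i : ℂ)) • z ^ (-(i : ℤ) - 1) • KaehlerDifferential.D ℂ K z =
          KaehlerDifferential.D ℂ K (z ^ (-(i : ℤ))) := by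
          rw [h1]; simp [← Nat.cast_smul_eq_nsmul ℂ]
        rw [this, ← one_smul K (KaehlerDifferential.D ℂ K _), hA.res_smul_D, symbol_one]
      have h3 : symbol A (z ^ (-(i : ℤ) - 1)) z = 0 := by
        rcases mul_eq_zero.mp h2 with h | h
        · exfalso; simp at h; omega
        · exact h
      have h4 : HasCoeff A z (-1) (z ^ (-(i : ℤ) - 1)) 0 := by
        refine ⟨Finsupp.single (-(i : ℤ) - 1) 1, fun j hj => ?_, ?_, 0, A.zero_mem, ?_⟩
        · exact Finsupp.single_eq_of_ne (by omega)
        · exact Finsupp.single_eq_of_ne (by omega)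
        · rw [Finsupp.sum_single_index (by simp)]; simp
      rw [h3, hA.coeff_eq hz h4]
  have hreg : ∀ g ∈ A, symbol A g z = coeff A z (-1) g := fun g hg => by
    rw [symbol_of_mem hg hz.mem, hA.coeff_of_mem hz (by simpa using hg)]
  rw [hA.res_smul_D]
  have e : f = (f - ∑ i ∈ Finset.range N, algebraMap ℂ K (a i) * z ^ (-(i : ℤ) - 1)) +
      ∑ i ∈ Finset.range N, a i • z ^ (-(i : ℤ) - 1) := by
    simp [Algebra.smul_def]
  let l : K →ₗ[ℂ] ℂ := ⟨⟨fun f => symbol A f z, fun f f' => hA.symbol_add_left f f' z⟩,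
    fun c f => hA.symbol_smul_left c f z⟩
  change l f = hA.coeffHom hz (-1) f
  rw [e, map_add, map_add, map_sum, map_sum]
  refine congrArg₂ _ (hreg _ ha) (Finset.sum_congr rfl fun i _ => ?_)
  rw [map_smul, map_smul]
  exact congrArg _ (hmon i)

variable (K) in
/-- The space of rational differentials is at most one-dimensional. -/
def DifferentialsLine : Prop := ∀ ω η : Ω[K⁄ℂ], η ≠ 0 → ∃ f : K, ω = f • η

theorem IsPlace.residue_eq (hA : IsPlace A) (hΩ : DifferentialsLine K) (ω : Ω[K⁄ℂ]) :
    residue A ω = hA.res ω := by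
  have h : ∃ c, ∃ z, IsCoord A z ∧ HasDiffCoeff A z (-1) ω c := by
    obtain ⟨z, hz⟩ := hA.exists_coord
    obtain ⟨f, hf⟩ := hΩ ω _ (hA.D_coord_ne_zero hz)
    exact ⟨_, z, hz, f, hf, hA.hasCoeff hz _ _⟩
  obtain ⟨z, hz, f, hf, hc⟩ := Classical.epsilon_spec h
  rw [hf, hA.res_smul_D_coord hz, hA.coeff_eq hz hc, ← hf]
  rfl

theorem IsPlace.diffCoeff_eq (hA : IsPlace A) (hΩ : DifferentialsLine K) (hz : IsCoord A z)
    (m : ℕ) (ω : Ω[K⁄ℂ]) : diffCoeff A z m ω = hA.res (z ^ (-(m : ℤ) - 1) • ω) := by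
  obtain ⟨f, hf⟩ := hΩ ω _ (hA.D_coord_ne_zero hz)
  have h : ∃ c, HasDiffCoeff A z m ω c := ⟨_, f, hf, hA.hasCoeff hz _ _⟩
  obtain ⟨g, hg, hc⟩ := Classical.epsilon_spec h
  change diffCoeff A z m ω = _
  rw [hg, smul_smul, hA.res_smul_D_coord hz, ← hg]
  have := hA.coeff_zpow_mul hz (-(m : ℤ) - 1) m g
  rw [show (-(m : ℤ) - 1) + m = -1 by ring] at this
  rw [this, hA.coeff_eq hz hc]
  rfl

/-- The regular differentials are those whose multiples by regular functions have no residue. -/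
theorem IsPlace.mem_omegaStalk_iff (hA : IsPlace A) (hΩ : DifferentialsLine K) (ω : Ω[K⁄ℂ]) :
    ω ∈ omegaStalk A ↔ ∀ f ∈ A, hA.res (f • ω) = 0 := by
  constructor
  · intro h
    refine Submodule.span_induction (p := fun ω _ => ∀ f ∈ A, hA.res (f • ω) = 0) ?_ (by simp)
      (fun x y _ _ hx hy f hf => by rw [smul_add, map_add, hx f hf, hy f hf, add_zero])
      (fun a x _ hx f hf => ?_) h
    · rintro _ ⟨g, hg, rfl⟩ f hf
      rw [hA.res_smul_D, symbol_of_mem hf hg]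
    · rw [Subalgebra.smul_def, smul_smul]
      exact hx _ (A.mul_mem hf a.2)
  · intro h
    obtain ⟨z, hz⟩ := hA.exists_coord
    obtain ⟨g, rfl⟩ := hΩ ω _ (hA.D_coord_ne_zero hz)
    have hg : g ∈ A := by
      by_contra hg
      have hg0 : g ≠ 0 := by rintro rfl; exact hg A.zero_mem
      have h1 : z⁻¹ * g⁻¹ ∈ A := by
        obtain ⟨k, hk, e⟩ := (hz.nonunit_iff (hA.inv_mem hg)).mp (Or.inl (by simpa using hg))
        rw [e, inv_mul_cancel_left₀ hz.ne_zero]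
        exact hk
      have h2 := h _ h1
      rw [smul_smul, mul_assoc, inv_mul_cancel₀ hg0, mul_one, hA.res_smul_D,
        hA.symbol_inv_coord hz] at h2
      exact one_ne_zero h2
    exact (omegaStalk A).smul_mem ⟨g, hg⟩ (Submodule.subset_span ⟨z, hz.mem, rfl⟩)

end Residue

end CurveLifting

namespace CurveLifting

/-! ### The function field of a complete curve -/

section Curve

open scoped IntermediateField
open scoped IntermediateField.algebraAdjoinAdjoin

variable {K : Type} [Field K] [Algebra ℂ K] {P : Type} {O : P → Subalgebra ℂ K}

/-- `O` is the family of the local rings of a complete regular curve with function field `K`. The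
valuative criterion of properness says that all valuation rings of `K` over `ℂ` occur. -/
structure IsCurve (O : P → Subalgebra ℂ K) : Prop where
  place : ∀ x, IsPlace (O x)
  injective : Function.Injective O
  complete : ∀ V : ValuationSubring K, (∀ c, algebraMap ℂ K c ∈ V) → V ≠ ⊤ →
    ∃ x, ∀ f, f ∈ O x ↔ f ∈ V
  regular : ∀ f : K, {x | f ∉ O x}.Finite
  differentials : DifferentialsLine K
  generator : ∃ t : K, Transcendental ℂ t ∧ FiniteDimensional ℂ⟮t⟯ K

/-- The valuation ring of a place. -/
def IsPlace.valuationSubring {A : Subalgebra ℂ K} (hA : IsPlace A) : ValuationSubring K where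
  __ := A.toSubring
  mem_or_inv_mem' _ := or_iff_not_imp_left.mpr hA.inv_mem

theorem IsPlace.mem_of_isIntegral {A : Subalgebra ℂ K} (hA : IsPlace A) {R : Subalgebra ℂ K}
    (hR : R ≤ A) {f : K} (hf : IsIntegral R f) : f ∈ A := by
  have : IsIntegrallyClosedIn hA.valuationSubring K := inferInstance
  have h2 : IsIntegral hA.valuationSubring f := by
    obtain ⟨p, hp, hpf⟩ := hf
    let i : R →+* hA.valuationSubring := Subring.inclusion (S := R.toSubring)
      (T := hA.valuationSubring.toSubring) hR
    refine ⟨p.map i, hp.map i, ?_⟩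
    rw [Polynomial.eval₂_map]
    exact hpf
  obtain ⟨y, hy⟩ := (IsIntegrallyClosedIn.isIntegral_iff (A := K)).mp h2
  rw [← hy]
  exact y.2

theorem isIntegral_of_valuationSubring {R : Subalgebra ℂ K} {f : K}
    (h : ∀ V : ValuationSubring K, (∀ r ∈ R, r ∈ V) → f ∈ V) : IsIntegral R f := by
  have h1 : f ∈ ⨅ V : {V : ValuationSubring K // (R : Set K) ⊆ V.toSubring}, V.1.toSubring := by
    rw [Subring.mem_iInf]
    exact fun V => h V.1 V.2
  rw [iInf_valuationSubring_superset] at h1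
  have h2 : IsIntegral (Subring.closure (R : Set K)) f := h1
  obtain ⟨p, hp, hpf⟩ := h2
  let i : Subring.closure (R : Set K) →+* R :=
    Subring.inclusion (T := R.toSubring) (Subring.closure_le.mpr fun _ h => h)
  refine ⟨p.map i, hp.map i, ?_⟩
  rw [Polynomial.eval₂_map]
  exact hpf

theorem IsCurve.isIntegral_iff (hC : IsCurve O) (R : Subalgebra ℂ K) (f : K) :
    IsIntegral R f ↔ ∀ x, R ≤ O x → f ∈ O x := by
  refine ⟨fun h x hx => (hC.place x).mem_of_isIntegral hx h, fun h => ?_⟩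
  refine isIntegral_of_valuationSubring fun V hV => ?_
  by_cases hT : V = ⊤
  · rw [hT]; exact ValuationSubring.mem_top f
  obtain ⟨x, hx⟩ := hC.complete V (fun c => hV _ (R.algebraMap_mem c)) hT
  exact (hx f).mp (h x fun r hr => (hx r).mpr (hV r hr))

theorem adjoin_le_iff_mem {t : K} {A : Subalgebra ℂ K} : Algebra.adjoin ℂ {t} ≤ A ↔ t ∈ A := by
  simp [Algebra.adjoin_le_iff]

theorem eq_algebraMap_of_isIntegral {f : K} (hf : IsIntegral ℂ f) : ∃ c, f = algebraMap ℂ K c := by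
  have := minpoly.mem_range_of_degree_eq_one ℂ f
    (IsAlgClosed.degree_eq_one_of_irreducible ℂ (minpoly.irreducible hf))
  obtain ⟨c, hc⟩ := this
  exact ⟨c, hc.symm⟩

/-- A rational function without poles is constant. -/
theorem IsCurve.eq_algebraMap (hC : IsCurve O) {f : K} (hf : ∀ x, f ∈ O x) :
    ∃ c, f = algebraMap ℂ K c := by
  have h : IsIntegral (⊥ : Subalgebra ℂ K) f := (hC.isIntegral_iff _ _).mpr fun x _ => hf x
  refine eq_algebraMap_of_isIntegral ?_
  have : Algebra.IsIntegral ℂ (⊥ : Subalgebra ℂ K) :=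
    ⟨fun ⟨y, hy⟩ => by
      obtain ⟨c, rfl⟩ := Algebra.mem_bot.mp hy
      exact isIntegral_algebraMap (x := c)⟩
  exact isIntegral_trans (R := ℂ) f h

theorem isPrincipalIdealRing_adjoin (t : K) : IsPrincipalIdealRing (Algebra.adjoin ℂ {t}) := by
  have e := Algebra.adjoin_singleton_eq_range_aeval ℂ t
  rw [e]
  exact IsPrincipalIdealRing.of_surjective (Polynomial.aeval (R := ℂ) t).rangeRestrict
    (AlgHom.rangeRestrict_surjective _)

theorem IsPlace.nonunit_mul {A : Subalgebra ℂ K} (hA : IsPlace A) {f : K} (hf : f ∉ A) {z : K}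
    (hz : IsCoord A z) : ∃ g ∈ A, f⁻¹ = z * g :=
  (hz.nonunit_iff (hA.inv_mem hf)).mp (Or.inl (by simpa using hf))

theorem isDedekindDomain_integralClosure (t : K) [FiniteDimensional ℂ⟮t⟯ K] :
    IsDedekindDomain (integralClosure (Algebra.adjoin ℂ {t}) K) := by
  have := isPrincipalIdealRing_adjoin t
  exact integralClosure.isDedekindDomain (Algebra.adjoin ℂ {t}) ℂ⟮t⟯ K

theorem isFractionRing_integralClosure (t : K) [FiniteDimensional ℂ⟮t⟯ K] :
    IsFractionRing (integralClosure (Algebra.adjoin ℂ {t}) K) K :=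
  integralClosure.isFractionRing_of_finite_extension (A := Algebra.adjoin ℂ {t}) ℂ⟮t⟯ K

theorem exists_generators_integralClosure (t : K) [FiniteDimensional ℂ⟮t⟯ K] :
    ∃ (n : ℕ) (b : Fin n → K), (∀ i, IsIntegral (Algebra.adjoin ℂ {t}) (b i)) ∧
      ∀ f, IsIntegral (Algebra.adjoin ℂ {t}) f →
        f ∈ Submodule.span (Algebra.adjoin ℂ {t}) (Set.range b) := by
  have := isPrincipalIdealRing_adjoin t
  have : Module.Finite (Algebra.adjoin ℂ {t}) (integralClosure (Algebra.adjoin ℂ {t}) K) :=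
    IsIntegralClosure.finite (Algebra.adjoin ℂ {t}) ℂ⟮t⟯ K _
  obtain ⟨n, b, hb⟩ := Module.Finite.exists_fin (R := Algebra.adjoin ℂ {t})
    (M := integralClosure (Algebra.adjoin ℂ {t}) K)
  refine ⟨n, fun i => b i, fun i => (b i).2, fun f hf => ?_⟩
  have h : (⟨f, hf⟩ : integralClosure (Algebra.adjoin ℂ {t}) K) ∈
    Submodule.span (Algebra.adjoin ℂ {t}) (Set.range b) := hb ▸ Submodule.mem_top
  have h2 := Submodule.mem_map_of_mem (f := (integralClosure (Algebra.adjoin ℂ {t}) K).val.toLinearMap) h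
  rw [Submodule.map_span, ← Set.range_comp] at h2
  exact h2

/-- The localization of a Dedekind domain at a nonzero prime is a valuation ring, in terms of
fractions. -/
theorem exists_mul_eq_of_isDedekindDomain {B : Type*} [CommRing B] [IsDedekindDomain B]
    (I : Ideal B) [I.IsPrime] (hI : I ≠ ⊥) (a b : B) :
    ∃ c, ∃ s ∉ I, a * c = b * s ∨ b * c = a * s := by
  have : IsDiscreteValuationRing (Localization.AtPrime I) :=
    IsLocalization.AtPrime.isDiscreteValuationRing_of_dedekind_domain B hI _
  have hinj : Function.Injective (algebraMap B (Localization.AtPrime I)) :=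
    IsLocalization.injective (Localization.AtPrime I) I.primeCompl_le_nonZeroDivisors
  have e : ∀ (p q b' : B) (s' : I.primeCompl), algebraMap B (Localization.AtPrime I) p *
      IsLocalization.mk' (Localization.AtPrime I) b' s' = algebraMap B _ q →
      p * b' = q * s'.1 := by
    intro p q b' s' h
    rw [← IsLocalization.mk'_one (M := I.primeCompl), ← IsLocalization.mk'_mul, one_mul,
      IsLocalization.mk'_eq_iff_eq_mul, ← map_mul] at h
    exact hinj h
  obtain ⟨c, hc⟩ := ValuationRing.cond (algebraMap B (Localization.AtPrime I) a)
    (algebraMap B (Localization.AtPrime I) b)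
  obtain ⟨b', s', rfl⟩ := IsLocalization.exists_mk'_eq I.primeCompl c
  exact ⟨b', s'.1, s'.2, hc.imp (e _ _ _ _) (e _ _ _ _)⟩

/-- At a point where `t` is regular, the regular functions are fractions of functions which are
integral over `ℂ[t]`. -/
theorem IsPlace.exists_eq_div {A : Subalgebra ℂ K} (hA : IsPlace A) {t : K}
    (ht : Transcendental ℂ t) [FiniteDimensional ℂ⟮t⟯ K] (htA : t ∈ A) {f : K} (hf : f ∈ A) :
    ∃ b s : K, IsIntegral (Algebra.adjoin ℂ {t}) b ∧ IsIntegral (Algebra.adjoin ℂ {t}) s ∧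
      s ≠ 0 ∧ s⁻¹ ∈ A ∧ f = b / s := by
  obtain ⟨z, hz⟩ := hA.exists_coord
  let B := integralClosure (Algebra.adjoin ℂ {t}) K
  have : IsDedekindDomain B := isDedekindDomain_integralClosure t
  have : IsFractionRing B K := isFractionRing_integralClosure t
  have hBA : ∀ b : B, (b : K) ∈ A := fun b =>
    hA.mem_of_isIntegral (adjoin_le_iff_mem.mpr htA) b.2
  let i : B →+* hA.valuationSubring :=
    B.val.toRingHom.codRestrict hA.valuationSubring hBA
  let I : Ideal B := (IsLocalRing.maximalIdeal hA.valuationSubring).comap i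
  have hI : ∀ b : B, b ∉ I → b ≠ 0 ∧ (b : K)⁻¹ ∈ A := fun b hb => by
    have h1 : IsUnit (i b) := by
      by_contra h
      exact hb h
    obtain ⟨u, hu⟩ := h1.exists_right_inv
    have hu' : (b : K) * u = 1 := congr($(hu).1)
    refine ⟨by rintro rfl; simp at hu', ?_⟩
    rw [← eq_inv_of_mul_eq_one_right hu']
    exact u.2
  have hI0 : I ≠ ⊥ := by
    -- `t - t(x)` is not zero and vanishes at the point
    obtain ⟨c, g, hg, hc⟩ := hA.exists_sub_eq hz htA
    let b : B := ⟨t - algebraMap ℂ K c, by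
      have : t - algebraMap ℂ K c ∈ Algebra.adjoin ℂ {t} :=
        Subalgebra.sub_mem _ (Algebra.self_mem_adjoin_singleton ℂ t) (Subalgebra.algebraMap_mem _ c)
      exact isIntegral_algebraMap (x := (⟨_, this⟩ : Algebra.adjoin ℂ {t}))⟩
    intro h0
    have hb : b ∈ I := by
      by_contra hb
      obtain ⟨hb0, hb⟩ := hI b hb
      have := (hz.nonunit_iff (hBA b)).mpr ⟨g, hg, hc⟩
      rcases this with h | h
      · exact h hb
      · exact hb0 (Subtype.ext h)
    rw [h0, Ideal.mem_bot] at hb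
    have : t = algebraMap ℂ K c := sub_eq_zero.mp congr($(hb).1)
    exact ht (this ▸ isAlgebraic_algebraMap c)
  obtain ⟨a, b, hb, rfl⟩ := IsFractionRing.div_surjective (A := B) f
  by_cases hf0 : algebraMap B K a / algebraMap B K b = 0
  · exact ⟨0, 1, isIntegral_zero, isIntegral_one, one_ne_zero, by simp, hf0.trans (by simp)⟩
  have hb0 : b ≠ 0 := nonZeroDivisors.ne_zero hb
  have ha0 : a ≠ 0 := by rintro rfl; simp at hf0
  have hb0' : (b : K) ≠ 0 := by simpa using hb0
  have ha0' : (a : K) ≠ 0 := by simpa using ha0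
  obtain ⟨b', s', hs', hc⟩ := exists_mul_eq_of_isDedekindDomain I hI0 a b
  obtain ⟨hs0, hs⟩ := hI s' hs'
  have hs0' : (s' : K) ≠ 0 := by simpa using hs0
  rcases hc with hc | hc
  · have h1 : (_ : K) = _ := congr($(hc).1)
    simp only [MulMemClass.coe_mul] at h1
    have hb'0 : (b' : K) ≠ 0 := by
      intro h
      rw [h, mul_zero] at h1
      exact mul_ne_zero hb0' hs0' h1.symm
    refine ⟨s', b', s'.2, b'.2, hb'0, ?_, ?_⟩
    · have : (b' : K)⁻¹ = (a / b : K) * (s' : K)⁻¹ := by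
        field_simp
        linear_combination -h1
      rw [this]
      exact A.mul_mem hf hs
    · change (a / b : K) = s' / b'
      field_simp
      linear_combination h1
  · have h1 : (_ : K) = _ := congr($(hc).1)
    simp only [MulMemClass.coe_mul] at h1
    refine ⟨b', s', b'.2, s'.2, hs0', hs, ?_⟩
    change (a / b : K) = b' / s'
    field_simp
    linear_combination -h1

theorem IsPlace.eq_of_le {A A' : Subalgebra ℂ K} (hA : IsPlace A) (hA' : IsPlace A') (h : A ≤ A') :
    A = A' := by
  refine le_antisymm h fun f hf => ?_
  by_contra hfA
  obtain ⟨z, hz⟩ := hA.exists_coord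
  obtain ⟨z', hz'⟩ := hA'.exists_coord
  have h1 : ∀ m : K, m ∈ A' := by
    obtain ⟨g, hg, hfg⟩ := hA.nonunit_mul hfA hz
    have hzi : z⁻¹ ∈ A' := by
      have hf0 : f ≠ 0 := by rintro rfl; exact hfA A.zero_mem
      have : z⁻¹ = f * g := by
        have := hz.ne_zero
        rw [eq_comm, ← mul_right_inj' this, mul_left_comm, ← hfg, mul_inv_cancel₀ hf0,
          mul_inv_cancel₀ this]
      rw [this]
      exact A'.mul_mem hf (h hg)
    intro m
    obtain ⟨N, hN⟩ := hA.exists_zpow_mul_mem hz m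
    have : m = z⁻¹ ^ N * (z ^ (N : ℤ) * m) := by
      have := hz.ne_zero
      rw [zpow_natCast, inv_pow]
      field_simp
    rw [this]
    exact A'.mul_mem (A'.pow_mem hzi N) (h hN)
  exact hz'.inv_notMem (h1 _)

/-- On the affine curve where `t` is regular, there is a rational function whose only pole is a
simple pole at a given point. -/
theorem IsCurve.exists_simple_pole (hC : IsCurve O) {t : K} (ht : Transcendental ℂ t)
    [FiniteDimensional ℂ⟮t⟯ K] {x : P} (hx : t ∈ O x) {z : K} (hz : IsCoord (O x) z) :
    ∃ f : K, z * f ∈ O x ∧ f ∉ O x ∧ ∀ y, t ∈ O y → y ≠ x → f ∈ O y := by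
  let B := integralClosure (Algebra.adjoin ℂ {t}) K
  have : IsDedekindDomain B := isDedekindDomain_integralClosure t
  have : IsFractionRing B K := isFractionRing_integralClosure t
  have hBA : ∀ y, t ∈ O y → ∀ b : B, (b : K) ∈ O y := fun y hy b =>
    (hC.place y).mem_of_isIntegral (adjoin_le_iff_mem.mpr hy) b.2
  let I : Ideal B :=
    { carrier := {b | ∃ g ∈ O x, (b : K) = z * g}
      add_mem' := by
        rintro a b ⟨g, hg, h⟩ ⟨g', hg', h'⟩
        exact ⟨g + g', add_mem hg hg', by rw [Subalgebra.coe_add, h, h', mul_add]⟩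
      zero_mem' := ⟨0, zero_mem _, by simp⟩
      smul_mem' := by
        rintro c b ⟨g, hg, h⟩
        exact ⟨c * g, mul_mem (hBA x hx c) hg, by
          rw [smul_eq_mul, Subalgebra.coe_mul, h]; ring⟩ }
  have hmemI : ∀ b : B, b ∈ I ↔ ∃ g ∈ O x, (b : K) = z * g := fun b => Iff.rfl
  -- a function of order one at the point and integral over `ℂ[t]`
  obtain ⟨b, s, hb, hs, hs0, hsx, hzb⟩ := (hC.place x).exists_eq_div ht hx hz.mem
  have hbI : (⟨b, hb⟩ : B) ∈ I := by
    refine ⟨s, hBA x hx ⟨s, hs⟩, ?_⟩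
    rw [hzb]; field_simp
  have hI0 : I ≠ ⊥ := fun h => by
    rw [h, Ideal.mem_bot] at hbI
    have : b = 0 := congr($(hbI).1)
    exact hz.ne_zero (by simp [hzb, this])
  have hI1 : I ≠ ⊤ := fun h => by
    have : (1 : B) ∈ I := h ▸ Submodule.mem_top
    obtain ⟨g, hg, e⟩ := this
    refine hz.inv_notMem ?_
    have : z⁻¹ = g := by rw [← eq_inv_of_mul_eq_one_right e.symm]
    rwa [this]
  obtain ⟨f, hf, hf1⟩ := FractionalIdeal.exists_notMem_one_of_ne_bot (K := K) hI0 hI1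
  rw [FractionalIdeal.mem_inv_iff (by simpa using hI0)] at hf
  have hmul : ∀ b ∈ I, ∃ c : B, f * (b : K) = c := fun b hb => by
    obtain ⟨c, hc⟩ := (FractionalIdeal.mem_one_iff _).mp
      (hf _ (FractionalIdeal.mem_coeIdeal_of_mem _ hb))
    exact ⟨c, hc.symm⟩
  have hreg : ∀ y, t ∈ O y → y ≠ x → f ∈ O y := by
    intro y hy hyx
    by_contra hfy
    refine hyx (hC.injective ((hC.place y).eq_of_le (hC.place x) fun h hh => ?_))
    obtain ⟨b, s, hb, hs, hs0, hsy, rfl⟩ := (hC.place y).exists_eq_div ht hy hh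
    -- if `s` vanished at `x` then `f s` would be integral, although `s` is a unit at `y`
    have hsx : s⁻¹ ∈ O x := by
      by_contra hsx
      have hsI : (⟨s, hs⟩ : B) ∈ I :=
        (hz.nonunit_iff (hBA x hx ⟨s, hs⟩)).mp (Or.inl hsx)
      obtain ⟨c, hc⟩ := hmul _ hsI
      refine hfy ?_
      have : f = c * s⁻¹ := by rw [← hc]; simp [hs0]
      rw [this]
      exact mul_mem (hBA y hy c) hsy
    exact div_eq_mul_inv b s ▸ mul_mem (hBA x hx ⟨b, hb⟩) hsx
  refine ⟨f, ?_, fun hfx => hf1 ?_, hreg⟩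
  · obtain ⟨c, hc⟩ := hmul _ hbI
    have : z * f = c * s⁻¹ := by rw [← hc, hzb]; simp only; field_simp
    rw [this]
    exact mul_mem (hBA x hx c) hsx
  · have : IsIntegral (Algebra.adjoin ℂ {t}) f := (hC.isIntegral_iff _ _).mpr fun y hy => by
      by_cases hyx : y = x
      · rwa [hyx]
      · exact hreg y (adjoin_le_iff_mem.mp hy) hyx
    exact (FractionalIdeal.mem_one_iff _).mpr ⟨⟨f, this⟩, rfl⟩

theorem IsCurve.exists_pole_at (hC : IsCurve O) {t : K} (ht : Transcendental ℂ t)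
    [FiniteDimensional ℂ⟮t⟯ K] {x : P} (hx : t ∈ O x) (h : K) :
    ∃ f : K, h - f ∈ O x ∧ ∀ y, t ∈ O y → y ≠ x → f ∈ O y := by
  obtain ⟨z, hz⟩ := (hC.place x).exists_coord
  obtain ⟨N, hN⟩ := (hC.place x).exists_zpow_mul_mem hz h
  obtain ⟨g, hzg, hg, hreg⟩ := hC.exists_simple_pole ht hx hz
  have hz0 := hz.ne_zero
  have hg0 : g ≠ 0 := by rintro rfl; exact hg (zero_mem _)
  -- `z g` is a unit at `x`
  obtain ⟨u, hu, hgu⟩ := (hC.place x).nonunit_mul hg hz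
  have hzgu : u * (z * g) = 1 := by
    rw [← mul_assoc, mul_comm u, ← hgu, inv_mul_cancel₀ hg0]
  induction N generalizing h with
  | zero => exact ⟨0, by simpa using hN, fun y _ _ => zero_mem _⟩
  | succ N ih =>
    obtain ⟨c, k, hk, hck⟩ := (hC.place x).exists_sub_eq hz
      (mul_mem (pow_mem hu (N + 1)) hN)
    obtain ⟨f, hf, hfreg⟩ := ih (h - algebraMap ℂ K c * g ^ (N + 1)) (by
      have : z ^ (N : ℤ) * (h - algebraMap ℂ K c * g ^ (N + 1)) = (z * g) ^ (N + 1) * k := by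
        apply mul_left_cancel₀ hz0
        have e : z * ((z * g) ^ (N + 1) * k) = (z * g) ^ (N + 1) * (z * k) := by ring
        have e' : (z * g) ^ (N + 1) * u ^ (N + 1) = 1 := by
          rw [← mul_pow, mul_comm (z * g), hzgu, one_pow]
        rw [e, ← hck, mul_sub ((z * g) ^ (N + 1)), ← mul_assoc ((z * g) ^ (N + 1)), e']
        simp only [zpow_natCast]
        ring
      rw [this]
      exact mul_mem (pow_mem hzg _) hk)
    refine ⟨f + algebraMap ℂ K c * g ^ (N + 1), ?_, fun y hy hyx => ?_⟩
    · convert! hf using 1; ring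
    · exact add_mem (hfreg y hy hyx)
        (mul_mem (Subalgebra.algebraMap_mem _ c) (pow_mem (hreg y hy hyx) _))

/-- On the affine curve where `t` is regular, any principal part is that of a rational function. -/
theorem IsCurve.exists_approx (hC : IsCurve O) {t : K} (ht : Transcendental ℂ t)
    [FiniteDimensional ℂ⟮t⟯ K] (p : P → K) (hp : {x | p x ∉ O x}.Finite) :
    ∃ f : K, ∀ x, t ∈ O x → p x - f ∈ O x := by
  suffices ∀ S : Finset P, ∀ p : P → K, (∀ x, t ∈ O x → p x ∉ O x → x ∈ S) →
      ∃ f : K, ∀ x, t ∈ O x → p x - f ∈ O x from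
    this hp.toFinset p fun x _ h => by simpa using h
  classical
  intro S
  induction S using Finset.induction_on with
  | empty => exact fun p hp => ⟨0, fun x hx => by
      by_contra h
      exact absurd (hp x hx (by simpa using h)) (Finset.notMem_empty x)⟩
  | insert a S ha ih =>
    intro p hp
    by_cases hta : t ∈ O a
    · obtain ⟨f, hf, hfreg⟩ := hC.exists_pole_at ht hta (p a)
      obtain ⟨g, hg⟩ := ih (fun x => p x - f) fun x hx hpx => by
        by_cases hxa : x = a
        · subst hxa; exact absurd hf hpx
        · refine (Finset.mem_insert.mp (hp x hx fun h => hpx ?_)).resolve_left hxa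
          exact sub_mem h (hfreg x hx hxa)
      exact ⟨f + g, fun x hx => by rw [← sub_sub]; exact hg x hx⟩
    · exact ih p fun x hx hpx => (Finset.mem_insert.mp (hp x hx hpx)).resolve_left
        (by rintro rfl; exact hta hx)

end Curve

end CurveLifting

namespace CurveLifting

/-! ### Finiteness of the cohomology of the structure sheaf -/

section Cohomology

open scoped IntermediateField
open scoped IntermediateField.algebraAdjoinAdjoin

variable {K : Type} [Field K] [Algebra ℂ K] {P : Type} {O : P → Subalgebra ℂ K}

variable (O) in
/-- The stalks of the structure sheaf, as submodules of the function field. -/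
def functionStalk (x : P) : Submodule (O x) K := LinearMap.range (Algebra.linearMap (O x) K)

theorem mem_functionStalk {x : P} {f : K} : f ∈ functionStalk O x ↔ f ∈ O x :=
  ⟨by rintro ⟨g, rfl⟩; exact g.2, fun h => ⟨⟨f, h⟩, rfl⟩⟩

theorem finite_notMem (p : families (functionStalk O)) : {x | p.1 x ∉ O x}.Finite := by
  have := p.2
  simp only [families, mem_functionStalk] at this
  exact this

theorem H1.mk_eq_zero_iff {V : Type} [AddCommGroup V] [Module K V] [Module ℂ V]
    [IsScalarTower ℂ K V] {L : ∀ x, Submodule (O x) V} (p : families L) :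
    H1.mk L p = 0 ↔ ∃ v : V, ∀ x, p.1 x - v ∈ L x :=
  Submodule.Quotient.mk_eq_zero _

theorem IsCurve.inv_mem_or (hC : IsCurve O) {t : K} {x : P} (h : t ∉ O x) : t⁻¹ ∈ O x :=
  (hC.place x).inv_mem h

/-- A function vanishing at finitely many points has a power that cancels the poles of a given
function there. -/
theorem IsCurve.exists_pow_mul_mem (hC : IsCurve O) (s f : K) {S : Set P} (hS : S.Finite)
    (h : ∀ x ∈ S, s⁻¹ ∉ O x) : ∃ M : ℕ, ∀ m ≥ M, ∀ x ∈ S, s ^ m * f ∈ O x := by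
  have h1 : ∀ x ∈ S, ∃ M : ℕ, ∀ m ≥ M, s ^ m * f ∈ O x := by
    intro x hx
    obtain ⟨z, hz⟩ := (hC.place x).exists_coord
    obtain ⟨g, hg, e⟩ := (hC.place x).nonunit_mul (h x hx) hz
    rw [inv_inv] at e
    obtain ⟨N, hN⟩ := (hC.place x).exists_zpow_mul_mem hz f
    refine ⟨N, fun m hm => ?_⟩
    have hN' := hz.zpow_mul_mem_mono (n := (m : ℤ)) (by exact_mod_cast hm) hN
    rw [e, mul_pow, mul_right_comm]
    rw [zpow_natCast] at hN'
    exact mul_mem hN' (pow_mem hg m)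
  choose! M hM using h1
  refine ⟨hS.toFinset.sup M, fun m hm x hx => hM x hx m (le_trans ?_ hm)⟩
  exact Finset.le_sup (f := M) (by simpa using hx)

variable (O) in
/-- The principal part of `f` along the poles of `t`. -/
def polePart (t f : K) : P → K := Set.indicator {x | t ∉ O x} fun _ => f

theorem polePart_of_mem {t f : K} {x : P} (h : t ∈ O x) : polePart O t f x = 0 :=
  Set.indicator_of_notMem (by simpa using h) _

theorem polePart_of_notMem {t f : K} {x : P} (h : t ∉ O x) : polePart O t f x = f :=
  Set.indicator_of_mem (s := {x | t ∉ O x}) h _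

/-- The class of the principal part of `f` along the poles of `t`. -/
def IsCurve.poleClass (hC : IsCurve O) (t : K) : K →ₗ[ℂ] H1 (functionStalk O) :=
  (principal (functionStalk O)).mkQ ∘ₗ
    { toFun := fun f => ⟨polePart O t f, by
        refine (hC.regular f).subset fun x hx => ?_
        simp only [Set.mem_ofPred_eq, mem_functionStalk] at hx ⊢
        intro h
        by_cases h' : t ∈ O x
        · exact hx (polePart_of_mem (f := f) h' ▸ zero_mem _)
        · exact hx (by rwa [polePart_of_notMem h'])⟩
      map_add' := fun _ _ => Subtype.ext (Set.indicator_add _ _ _)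
      map_smul' := fun c f => Subtype.ext (Set.indicator_const_smul _ c fun _ => f) }

theorem IsCurve.poleClass_eq_zero_of_integral (hC : IsCurve O) {t f : K}
    (h : ∀ x, t ∈ O x → f ∈ O x) : hC.poleClass t f = 0 := by
  refine (H1.mk_eq_zero_iff _).mpr ⟨f, fun x => mem_functionStalk.mpr ?_⟩
  change polePart O t f x - f ∈ O x
  by_cases h' : t ∈ O x
  · rw [polePart_of_mem h', zero_sub]; exact neg_mem (h x h')
  · rw [polePart_of_notMem h', sub_self]; exact zero_mem _

theorem IsCurve.poleClass_eq_zero_of_regular (hC : IsCurve O) {t f : K}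
    (h : ∀ x, t⁻¹ ∈ O x → f ∈ O x) : hC.poleClass t f = 0 := by
  refine (H1.mk_eq_zero_iff _).mpr ⟨0, fun x => mem_functionStalk.mpr ?_⟩
  change polePart O t f x - 0 ∈ O x
  rw [sub_zero]
  by_cases h' : t ∈ O x
  · rw [polePart_of_mem h']; exact zero_mem _
  · rw [polePart_of_notMem h']; exact h x (hC.inv_mem_or h')

theorem finiteDimensional_adjoin_inv (t : K) [h : FiniteDimensional ℂ⟮t⟯ K] :
    FiniteDimensional ℂ⟮t⁻¹⟯ K := by
  have e : ℂ⟮t⁻¹⟯ = ℂ⟮t⟯ := by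
    refine le_antisymm ?_ ?_ <;> rw [IntermediateField.adjoin_simple_le_iff]
    · exact inv_mem (IntermediateField.mem_adjoin_simple_self ℂ t)
    · have := inv_mem (IntermediateField.mem_adjoin_simple_self ℂ t⁻¹)
      rwa [inv_inv] at this
  rw [e]
  exact h

/-- The two affine curves where `t` and `1 / t` are regular compute the cohomology. -/
theorem IsCurve.exists_poleClass_eq (hC : IsCurve O) {t : K} (ht : Transcendental ℂ t)
    [FiniteDimensional ℂ⟮t⟯ K] (c : H1 (functionStalk O)) :
    ∃ f : K, (∀ x, t ∈ O x → t⁻¹ ∈ O x → f ∈ O x) ∧ hC.poleClass t f = c := by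
  obtain ⟨p, rfl⟩ := (principal (functionStalk O)).mkQ_surjective c
  have ht' : Transcendental ℂ t⁻¹ := by
    intro h
    have := h.inv
    rw [inv_inv] at this
    exact ht this
  have := finiteDimensional_adjoin_inv t
  obtain ⟨f₀, hf₀⟩ := hC.exists_approx ht p.1 (finite_notMem p)
  obtain ⟨f, hf⟩ := hC.exists_approx ht' (fun x => p.1 x - f₀)
    (((finite_notMem p).union (hC.regular f₀)).subset fun x hx => by
      by_contra h
      simp only [Set.mem_union, Set.mem_ofPred_eq, not_or, not_not] at h
      exact hx (sub_mem h.1 h.2))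
  refine ⟨f, fun x h h' => by simpa using sub_mem (hf₀ x h) (hf x h'), ?_⟩
  refine (Submodule.Quotient.eq _).mpr ⟨-f₀, fun x => mem_functionStalk.mpr ?_⟩
  change polePart O t f x - p.1 x - -f₀ ∈ O x
  by_cases h : t ∈ O x
  · rw [polePart_of_mem h]
    convert! neg_mem (hf₀ x h) using 1; ring
  · rw [polePart_of_notMem h]
    convert! neg_mem (hf x (hC.inv_mem_or h)) using 1; ring

/-- The first cohomology of the structure sheaf of a complete curve is finite-dimensional. -/
theorem IsCurve.finiteDimensional_H1 (hC : IsCurve O) :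
    FiniteDimensional ℂ (H1 (functionStalk O)) := by
  obtain ⟨t, ht, hfin⟩ := hC.generator
  have ht0 : t ≠ 0 := by rintro rfl; exact ht isAlgebraic_zero
  obtain ⟨n, b, hb, hspan⟩ := exists_generators_integralClosure t
  have hbmem : ∀ i x, t ∈ O x → b i ∈ O x := fun i x hx =>
    (hC.isIntegral_iff _ _).mp (hb i) x (adjoin_le_iff_mem.mpr hx)
  have h1 : ∀ i, ∃ M : ℕ, ∀ m ≥ M, ∀ x ∈ {x | t ∉ O x}, t⁻¹ ^ m * b i ∈ O x := fun i =>
    hC.exists_pow_mul_mem t⁻¹ (b i) (hC.regular t) fun x hx => by rwa [inv_inv]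
  choose M hM using h1
  let F : Submodule ℂ (H1 (functionStalk O)) := Submodule.span ℂ
    (Set.range fun q : Σ i : Fin n, Fin (M i) => hC.poleClass t (t ^ (-(q.2 : ℤ)) * b q.1))
  have hF1 : ∀ i (m : ℤ), hC.poleClass t (t ^ m * b i) ∈ F := by
    intro i m
    by_cases hm : 0 ≤ m
    · rw [hC.poleClass_eq_zero_of_integral]
      · exact F.zero_mem
      · intro x hx
        lift m to ℕ using hm
        rw [zpow_natCast]
        exact mul_mem (pow_mem hx m) (hbmem i x hx)
    obtain ⟨k, rfl⟩ : ∃ k : ℕ, m = -(k : ℤ) := ⟨m.natAbs, by omega⟩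
    by_cases hk : k < M i
    · exact Submodule.subset_span ⟨⟨i, ⟨k, hk⟩⟩, rfl⟩
    rw [hC.poleClass_eq_zero_of_regular]
    · exact F.zero_mem
    · intro x hx
      rw [zpow_neg, zpow_natCast, ← inv_pow]
      by_cases hx' : t ∈ O x
      · exact mul_mem (pow_mem hx k) (hbmem i x hx')
      · exact hM i k (by omega) x hx'
  have hF2 : ∀ y ∈ Submodule.span (Algebra.adjoin ℂ {t}) (Set.range b), ∀ m : ℤ,
      hC.poleClass t (t ^ m * y) ∈ F := by
    intro y hy
    induction hy using Submodule.span_induction with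
    | mem y h => obtain ⟨i, rfl⟩ := h; exact hF1 i
    | zero => intro m; simp
    | add y y' _ _ h h' => intro m; rw [mul_add, map_add]; exact F.add_mem (h m) (h' m)
    | smul a y _ h =>
      obtain ⟨a, ha⟩ := a
      change ∀ m : ℤ, hC.poleClass t (t ^ m * (a * y)) ∈ F
      induction ha using Algebra.adjoin_induction generalizing y with
      | mem a h' =>
        rw [Set.mem_singleton_iff] at h'
        subst h'
        intro m
        have := h (m + 1)
        rwa [zpow_add_one₀ ht0, mul_assoc] at this
      | algebraMap r =>
        intro m
        rw [mul_left_comm, ← Algebra.smul_def, map_smul]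
        exact F.smul_mem _ (h m)
      | add a a' ha ha' h1 h2 =>
        intro m
        rw [add_mul, mul_add, map_add]
        exact F.add_mem (h1 y ‹_› h m) (h2 y ‹_› h m)
      | mul a a' ha ha' h1 h2 =>
        intro m
        rw [mul_assoc]
        exact h1 (a' * y) (Submodule.smul_mem _ (⟨a', ha'⟩ : Algebra.adjoin ℂ {t}) ‹_›)
          (h2 y ‹_› h) m
  have hF : F = ⊤ := by
    rw [eq_top_iff]
    rintro c -
    obtain ⟨f, hf, rfl⟩ := hC.exists_poleClass_eq ht c
    obtain ⟨m, hm⟩ := hC.exists_pow_mul_mem t f (hC.regular t⁻¹) fun x hx => hx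
    have h2 : IsIntegral (Algebra.adjoin ℂ {t}) (t ^ m * f) :=
      (hC.isIntegral_iff _ _).mpr fun x hx => by
        rw [adjoin_le_iff_mem] at hx
        by_cases hx' : t⁻¹ ∈ O x
        · exact mul_mem (pow_mem hx m) (hf x hx hx')
        · exact hm m le_rfl x hx'
    have h3 := hF2 _ (hspan _ h2) (-(m : ℤ))
    rwa [← mul_assoc, zpow_neg, zpow_natCast, inv_mul_cancel₀ (pow_ne_zero m ht0), one_mul] at h3
  have : FiniteDimensional ℂ F := FiniteDimensional.span_of_finite ℂ (Set.finite_range _)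
  rw [hF] at this
  exact Module.Finite.equiv (Submodule.topEquiv (R := ℂ) (M := H1 (functionStalk O)))

theorem IsCurve.infinite_points (hC : IsCurve O) : Infinite P := by
  obtain ⟨t, ht, -⟩ := hC.generator
  have h : ∀ c : ℂ, ∃ x, (t - algebraMap ℂ K c)⁻¹ ∉ O x := by
    intro c
    by_contra! h
    obtain ⟨d, hd⟩ := hC.eq_algebraMap h
    refine ht ?_
    have : t = algebraMap ℂ K (d⁻¹ + c) := by
      rw [map_add, map_inv₀, ← hd, inv_inv]; ring
    rw [this]
    exact isAlgebraic_algebraMap _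
  choose x hx using h
  refine Infinite.of_injective x fun c c' hcc => ?_
  by_contra hne
  obtain ⟨z, hz⟩ := (hC.place (x c)).exists_coord
  obtain ⟨g, hg, e⟩ := (hC.place _).nonunit_mul (hx c) hz
  obtain ⟨g', hg', e'⟩ := (hC.place (x c)).nonunit_mul (hcc ▸ hx c') hz
  rw [inv_inv] at e e'
  refine hne (sub_eq_zero.mp (hz.algebraMap_eq_zero (sub_mem hg' hg) ?_))
  rw [mul_sub, ← e, ← e', map_sub]
  ring

/-! ### The residue theorem -/

/-- The principal parts at a finite set of points of the functions regular elsewhere. -/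
def regularOff (O : P → Subalgebra ℂ K) (S : Finset P) : Submodule ℂ (S → K) where
  carrier := {v | ∃ f : K, (∀ x ∉ S, f ∈ O x) ∧ v = fun _ => f}
  add_mem' := by
    rintro _ _ ⟨f, hf, rfl⟩ ⟨g, hg, rfl⟩
    exact ⟨f + g, fun x hx => add_mem (hf x hx) (hg x hx), rfl⟩
  zero_mem' := ⟨0, fun x _ => zero_mem _, rfl⟩
  smul_mem' := by
    rintro c _ ⟨f, hf, rfl⟩
    exact ⟨c • f, fun x hx => (O x).smul_mem (hf x hx) c, rfl⟩

/-- Multiplication by a function regular outside `S`, on principal parts at `S`. -/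
def regularOffMul (O : P → Subalgebra ℂ K) (S : Finset P) {f : K} (hf : ∀ x ∉ S, f ∈ O x) :
    ((S → K) ⧸ regularOff O S) →ₗ[ℂ] ((S → K) ⧸ regularOff O S) :=
  (regularOff O S).mapQ _ (LinearMap.pi fun x => LinearMap.mulLeft ℂ f ∘ₗ LinearMap.proj x) (by
    rintro _ ⟨g, hg, rfl⟩
    exact ⟨f * g, fun x hx => mul_mem (hf x hx) (hg x hx), rfl⟩)

variable (O) in
/-- The principal parts at `S` of the families of functions regular at the points of `S`. -/
def localToQuotient (S : Finset P) : (∀ x : S, O x.1) →ₗ[ℂ] (S → K) ⧸ regularOff O S :=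
  (regularOff O S).mkQ ∘ₗ LinearMap.pi fun x => (O x.1).val.toLinearMap ∘ₗ LinearMap.proj x

theorem IsCurve.finiteDimensional_ker_localToQuotient (hC : IsCurve O) (S : Finset P) :
    FiniteDimensional ℂ (LinearMap.ker (localToQuotient O S)) := by
  refine Submodule.finiteDimensional_of_le (S₂ := Submodule.span ℂ {fun _ => 1}) fun v hv => ?_
  obtain ⟨f, hf, e⟩ := (Submodule.Quotient.mk_eq_zero _).mp (LinearMap.mem_ker.mp hv)
  have e' : ∀ x : S, (v x : K) = f := fun x => congrFun e x
  obtain ⟨c, rfl⟩ := hC.eq_algebraMap (f := f) fun x => by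
    by_cases hx : x ∈ S
    · rw [← e' ⟨x, hx⟩]; exact (v ⟨x, hx⟩).2
    · exact hf x hx
  refine Submodule.mem_span_singleton.mpr ⟨c, funext fun x => Subtype.ext ?_⟩
  rw [e' x, Pi.smul_apply, Subalgebra.coe_smul, Algebra.smul_def, Subalgebra.coe_one, mul_one]

open Classical in
/-- Extension by zero of principal parts at a finite set of points. -/
def extendFamily (O : P → Subalgebra ℂ K) (S : Finset P) :
    (S → K) →ₗ[ℂ] families (functionStalk O) where
  toFun v := ⟨fun x => if h : x ∈ S then v ⟨x, h⟩ else 0, by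
    refine S.finite_toSet.subset fun x hx => ?_
    by_contra h
    refine hx ?_
    have h' : x ∉ S := by simpa using h
    simp only [dif_neg h']
    exact zero_mem _⟩
  map_add' v w := Subtype.ext (funext fun x => by
    by_cases h : x ∈ S <;> simp [h])
  map_smul' c v := Subtype.ext (funext fun x => by
    by_cases h : x ∈ S <;> simp [h])

theorem extendFamily_of_mem {S : Finset P} (v : S → K) {x : P} (h : x ∈ S) :
    (extendFamily O S v).1 x = v ⟨x, h⟩ := dif_pos h

theorem extendFamily_of_notMem {S : Finset P} (v : S → K) {x : P} (h : x ∉ S) :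
    (extendFamily O S v).1 x = 0 := dif_neg h

theorem IsCurve.finiteDimensional_coker_localToQuotient (hC : IsCurve O) (S : Finset P) :
    FiniteDimensional ℂ
      (((S → K) ⧸ regularOff O S) ⧸ LinearMap.range (localToQuotient O S)) := by
  have := hC.finiteDimensional_H1
  let T : (S → K) →ₗ[ℂ] H1 (functionStalk O) := (principal (functionStalk O)).mkQ ∘ₗ extendFamily O S
  let U : (S → K) →ₗ[ℂ] ((S → K) ⧸ regularOff O S) ⧸ LinearMap.range (localToQuotient O S) :=
    (LinearMap.range (localToQuotient O S)).mkQ ∘ₗ (regularOff O S).mkQ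
  have hU : Function.Surjective U :=
    (Submodule.mkQ_surjective _).comp (Submodule.mkQ_surjective _)
  have hTU : LinearMap.ker T ≤ LinearMap.ker U := by
    intro v hv
    obtain ⟨f, hf⟩ := (H1.mk_eq_zero_iff (extendFamily O S v)).mp (LinearMap.mem_ker.mp hv)
    simp only [mem_functionStalk] at hf
    have hoff : ∀ x ∉ S, f ∈ O x := fun x hx => by
      have := hf x
      rw [extendFamily_of_notMem v hx, zero_sub] at this
      simpa using this
    have hon : ∀ x : S, v x - f ∈ O x.1 := fun x => by
      have := hf x
      rwa [extendFamily_of_mem v x.2] at this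
    rw [LinearMap.mem_ker]
    refine (Submodule.Quotient.mk_eq_zero _).mpr ⟨fun x => ⟨v x - f, hon x⟩, ?_⟩
    refine (Submodule.Quotient.eq _).mpr ⟨-f, fun x hx => neg_mem (hoff x hx), ?_⟩
    ext x
    simp
  have h1 : FiniteDimensional ℂ ((S → K) ⧸ LinearMap.ker T) :=
    Module.Finite.equiv T.quotKerEquivRange.symm
  refine Module.Finite.of_surjective ((LinearMap.ker T).liftQ U hTU) fun y => ?_
  obtain ⟨v, rfl⟩ := hU y
  exact ⟨Submodule.Quotient.mk v, rfl⟩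

theorem IsCurve.sum_symbol (hC : IsCurve O) (f g : K) (S : Finset P) (hf : ∀ x ∉ S, f ∈ O x)
    (hg : ∀ x ∉ S, g ∈ O x) : ∑ x ∈ S, symbol (O x) f g = 0 := by
  classical
  let T : K → (∀ x : S, O x.1) →ₗ[ℂ] (∀ x : S, O x.1) := fun f =>
    LinearMap.pi fun x => toeplitz (O x.1) f ∘ₗ LinearMap.proj x
  have hdefect : ∀ {f : K} (hf : ∀ x ∉ S, f ∈ O x),
      FinRank (localToQuotient O S ∘ₗ T f - regularOffMul O S hf ∘ₗ localToQuotient O S) := by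
    intro f hf
    have e : localToQuotient O S ∘ₗ T f - regularOffMul O S hf ∘ₗ localToQuotient O S =
        ∑ x : S, ((regularOff O S).mkQ ∘ₗ LinearMap.single ℂ (fun _ : S => K) x) ∘ₗ
          ((-((LinearMap.id - (O x.1).val.toLinearMap ∘ₗ regularPart (O x.1)) ∘ₗ
            LinearMap.mulLeft ℂ f ∘ₗ (O x.1).val.toLinearMap)) ∘ₗ LinearMap.proj x) := by
      refine LinearMap.ext fun v => ?_
      rw [LinearMap.sum_apply]
      simp only [LinearMap.comp_apply, ← map_sum]
      change Submodule.Quotient.mk (p := regularOff O S) _ -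
        Submodule.Quotient.mk (p := regularOff O S) _ = Submodule.Quotient.mk (p := regularOff O S) _
      rw [← Submodule.Quotient.mk_sub]
      congr 1
      ext x
      rw [Finset.sum_apply]
      simp only [LinearMap.single_apply]
      rw [Finset.sum_eq_single x (fun y _ hy => Pi.single_eq_of_ne hy.symm _) (by simp),
        Pi.single_eq_same]
      simp [T, toeplitz_apply]
    rw [e]
    exact FinRank.sum _ fun x _ =>
      (((hC.place x.1).finRank_sub_regularPart f).neg.comp_right _).comp_left _
  have := hC.finiteDimensional_ker_localToQuotient S
  have := hC.finiteDimensional_coker_localToQuotient S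
  have hcomm : regularOffMul O S hf ∘ₗ regularOffMul O S hg =
      regularOffMul O S hg ∘ₗ regularOffMul O S hf := by
    refine LinearMap.ext fun v => ?_
    obtain ⟨v, rfl⟩ := (regularOff O S).mkQ_surjective v
    change Submodule.Quotient.mk (p := regularOff O S) _ =
      Submodule.Quotient.mk (p := regularOff O S) _
    congr 1
    ext x
    simp [mul_left_comm]
  have key := finTrace_commutator_eq_zero (localToQuotient O S) hcomm (hdefect hf) (hdefect hg)
  have e : T f * T g - T g * T f = ∑ x : S, LinearMap.single ℂ (fun x : S => O x.1) x ∘ₗ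
      ((toeplitz (O x.1) f * toeplitz (O x.1) g - toeplitz (O x.1) g * toeplitz (O x.1) f) ∘ₗ
        LinearMap.proj x) := by
    refine LinearMap.ext fun v => funext fun x => ?_
    rw [LinearMap.sum_apply, Finset.sum_apply]
    simp only [LinearMap.comp_apply, LinearMap.single_apply]
    rw [Finset.sum_eq_single x (fun y _ hy => Pi.single_eq_of_ne hy.symm _) (by simp),
      Pi.single_eq_same]
    rfl
  rw [e, finTrace_sum _ fun x _ =>
    (((hC.place x.1).finRank_commutator f g).comp_right _).comp_left _] at key
  rw [← Finset.sum_coe_sort, ← key]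
  refine Finset.sum_congr rfl fun x _ => ?_
  rw [finTrace_comm _ (((hC.place x.1).finRank_commutator f g).comp_right _), LinearMap.comp_assoc]
  have : (LinearMap.proj x : (∀ x : S, O x.1) →ₗ[ℂ] O x.1) ∘ₗ
      LinearMap.single ℂ (fun x : S => O x.1) x = LinearMap.id := by
    ext; simp
  rw [this, LinearMap.comp_id]
  rfl

end Cohomology

end CurveLifting

namespace CurveLifting

/-! ### Linear forms on the principal parts -/

section Duality

variable {K : Type} [Field K] [Algebra ℂ K] {P : Type} {O : P → Subalgebra ℂ K}

/-- A chosen local coordinate at each point. -/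
def IsCurve.coord (hC : IsCurve O) (x : P) : K := (hC.place x).exists_coord.choose

theorem IsCurve.isCoord (hC : IsCurve O) (x : P) : IsCoord (O x) (hC.coord x) :=
  (hC.place x).exists_coord.choose_spec

section Single

variable {V : Type} [AddCommGroup V] [Module K V] [Module ℂ V] [IsScalarTower ℂ K V]

open Classical in
/-- The family with a single possibly nonzero term. -/
def singleFamily (L : ∀ x, Submodule (O x) V) (x : P) : V →ₗ[ℂ] families L where
  toFun v := ⟨Pi.single x v, by
    refine (Set.finite_singleton x).subset fun y hy => ?_
    by_contra h
    have h' : y ≠ x := h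
    exact hy (by simp [Pi.single_eq_of_ne h'])⟩
  map_add' v w := Subtype.ext (Pi.single_add (f := fun _ : P => V) x v w)
  map_smul' c v := Subtype.ext (Pi.single_smul (f := fun _ : P => V) x c v)

theorem singleFamily_same (L : ∀ x, Submodule (O x) V) (x : P) (v : V) :
    (singleFamily L x v).1 x = v := by
  classical exact Pi.single_eq_same (M := fun _ => V) x v

theorem singleFamily_of_ne (L : ∀ x, Submodule (O x) V) {x y : P} (h : y ≠ x) (v : V) :
    (singleFamily L x v).1 y = 0 := by
  classical exact Pi.single_eq_of_ne (M := fun _ => V) h v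

theorem poleFamily_eq (L : ∀ x, Submodule (O x) V) (x : P) (z : K) (v : V) :
    poleFamily L x z v = singleFamily L x (z⁻¹ • v) := rfl

end Single

/-- The family all of whose terms are a given rational function. -/
def IsCurve.constFamily (hC : IsCurve O) (f : K) : families (functionStalk O) :=
  ⟨fun _ => f, (hC.regular f).subset fun _ hx h => hx (mem_functionStalk.mpr h)⟩

/-- Multiplication of families by a rational function. -/
def IsCurve.mulFamily (hC : IsCurve O) (f : K) :
    families (functionStalk O) →ₗ[ℂ] families (functionStalk O) where
  toFun p := ⟨fun x => f * p.1 x, by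
    refine ((hC.regular f).union (finite_notMem p)).subset fun x hx => ?_
    simp only [Set.mem_ofPred_eq, mem_functionStalk] at hx
    by_contra h
    simp only [Set.mem_union, Set.mem_ofPred_eq, not_or, not_not] at h
    exact hx (mul_mem h.1 h.2)⟩
  map_add' p q := Subtype.ext (funext fun x => mul_add _ _ _)
  map_smul' c p := Subtype.ext (funext fun x => mul_smul_comm _ _ _)

/-- The linear forms on families which kill the rational functions and the families vanishing to
order at least `D x` at each point `x`. -/
def IsCurve.formsKilling (hC : IsCurve O) (D : P →₀ ℕ) :
    Submodule ℂ (Module.Dual ℂ (families (functionStalk O))) where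
  carrier := {l | (∀ f, l (hC.constFamily f) = 0) ∧
    ∀ p : families (functionStalk O), (∀ x, hC.coord x ^ (-(D x : ℤ)) * p.1 x ∈ O x) → l p = 0}
  add_mem' := by
    rintro l l' ⟨h1, h2⟩ ⟨h1', h2'⟩
    exact ⟨fun f => by rw [LinearMap.add_apply, h1, h1', add_zero],
      fun p hp => by rw [LinearMap.add_apply, h2 p hp, h2' p hp, add_zero]⟩
  zero_mem' := by simp
  smul_mem' := by
    rintro c l ⟨h1, h2⟩
    exact ⟨fun f => by rw [LinearMap.smul_apply, h1, smul_zero],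
      fun p hp => by rw [LinearMap.smul_apply, h2 p hp, smul_zero]⟩

theorem IsCurve.formsKilling_mono (hC : IsCurve O) {D D' : P →₀ ℕ} (h : ∀ x, D x ≤ D' x) :
    hC.formsKilling D ≤ hC.formsKilling D' := fun l hl =>
  ⟨hl.1, fun p hp => hl.2 p fun x =>
    (hC.isCoord x).zpow_mul_mem_mono (by have := h x; omega) (hp x)⟩

theorem IsCurve.formsKilling_zero (hC : IsCurve O) :
    FiniteDimensional ℂ (hC.formsKilling 0) ∧
      Module.finrank ℂ (hC.formsKilling 0) ≤ Module.finrank ℂ (H1 (functionStalk O)) := by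
  have := hC.finiteDimensional_H1
  let T : Module.Dual ℂ (H1 (functionStalk O)) →ₗ[ℂ] Module.Dual ℂ (families (functionStalk O)) :=
    Module.Dual.transpose (principal (functionStalk O)).mkQ
  have hle : hC.formsKilling 0 ≤ LinearMap.range T := by
    intro l hl
    refine ⟨(principal (functionStalk O)).liftQ l fun p hp => ?_, LinearMap.ext fun p => rfl⟩
    obtain ⟨f, hf⟩ := hp
    rw [LinearMap.mem_ker, ← sub_add_cancel p (hC.constFamily f), map_add, hl.1, add_zero]
    exact hl.2 _ fun x => by
      rw [Finsupp.zero_apply, Nat.cast_zero, neg_zero, zpow_zero, one_mul]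
      exact mem_functionStalk.mp (hf x)
  refine ⟨Submodule.finiteDimensional_of_le hle, (Submodule.finrank_mono hle).trans ?_⟩
  exact (LinearMap.finrank_range_le T).trans Subspace.dual_finrank_eq.le

theorem IsCurve.formsKilling_add_single (hC : IsCurve O) (D : P →₀ ℕ) (y : P)
    [FiniteDimensional ℂ (hC.formsKilling D)] :
    FiniteDimensional ℂ (hC.formsKilling (D + Finsupp.single y 1)) ∧
      Module.finrank ℂ (hC.formsKilling (D + Finsupp.single y 1)) ≤
        Module.finrank ℂ (hC.formsKilling D) + 1 := by
  classical
  set Λ := hC.formsKilling (D + Finsupp.single y 1)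
  set z := hC.coord y
  have hz : IsCoord (O y) z := hC.isCoord y
  let q : families (functionStalk O) := singleFamily _ y (z ^ (D y : ℤ))
  let e : Λ →ₗ[ℂ] ℂ := (LinearMap.applyₗ q) ∘ₗ Λ.subtype
  have hker : ∀ l : Λ, l ∈ LinearMap.ker e → l.1 ∈ hC.formsKilling D := by
    intro l hl
    refine ⟨l.2.1, fun p hp => ?_⟩
    obtain ⟨c, g, hg, hcg⟩ := (hC.place y).exists_sub_eq hz (hp y)
    have h1 : l.1 (p - c • q) = 0 := l.2.2 _ fun x => by
      change _ * (p.1 x - c • q.1 x) ∈ _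
      by_cases hxy : x = y
      · subst hxy
        have : hC.coord x ^ (-((D + Finsupp.single x 1 : P →₀ ℕ) x : ℤ)) * (p.1 x - c • q.1 x) = g := by
          rw [singleFamily_same]
          apply mul_left_cancel₀ hz.ne_zero
          rw [← hcg, Algebra.smul_def]
          have hz0 : hC.coord x ≠ 0 := hz.ne_zero
          simp only [Finsupp.add_apply, Finsupp.single_eq_same, Nat.cast_add, Nat.cast_one, neg_add,
            zpow_add₀ hz0, zpow_neg, z]
          field_simp
        rw [this]
        exact hg
      · rw [singleFamily_of_ne _ hxy, smul_zero, sub_zero, Finsupp.add_apply,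
          Finsupp.single_eq_of_ne hxy, add_zero]
        exact hp x
    have h2 : l.1 q = 0 := hl
    rw [map_sub, map_smul, h2, smul_zero, sub_zero] at h1
    exact h1
  let i : LinearMap.ker e →ₗ[ℂ] hC.formsKilling D :=
    { toFun := fun l => ⟨l.1.1, hker l.1 l.2⟩
      map_add' := fun _ _ => rfl
      map_smul' := fun _ _ => rfl }
  have hi : Function.Injective i := fun l l' h => Subtype.ext (Subtype.ext congr($(h).1))
  have h1 : FiniteDimensional ℂ (LinearMap.ker e) := Module.Finite.of_injective i hi
  have h2 : FiniteDimensional ℂ (Λ ⧸ LinearMap.ker e) :=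
    Module.Finite.equiv e.quotKerEquivRange.symm
  have h3 : FiniteDimensional ℂ Λ := Module.Finite.of_submodule_quotient (LinearMap.ker e)
  refine ⟨h3, ?_⟩
  have h4 := e.finrank_range_add_finrank_ker
  have h5 := LinearMap.finrank_le_finrank_of_injective hi
  have h6 : Module.finrank ℂ (LinearMap.range e) ≤ 1 := by
    simpa using Submodule.finrank_le (LinearMap.range e)
  omega

theorem IsCurve.formsKilling_finrank (hC : IsCurve O) (D : P →₀ ℕ) :
    FiniteDimensional ℂ (hC.formsKilling D) ∧
      Module.finrank ℂ (hC.formsKilling D) ≤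
        Module.finrank ℂ (H1 (functionStalk O)) + D.degree := by
  classical
  obtain ⟨n, hn⟩ : ∃ n, D.degree = n := ⟨_, rfl⟩
  induction n generalizing D with
  | zero =>
    obtain rfl : D = 0 := (Finsupp.degree_eq_zero_iff D).mp hn
    simpa using hC.formsKilling_zero
  | succ n ih =>
    obtain ⟨y, hy⟩ : ∃ y, D y ≠ 0 := by
      by_contra! h
      obtain rfl : D = 0 := Finsupp.ext h
      simp at hn
    have hD : D = (D - Finsupp.single y 1) + Finsupp.single y 1 := by
      ext x
      by_cases hxy : x = y
      · subst hxy; simp; omega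
      · simp [Finsupp.single_eq_of_ne hxy]
    generalize D - Finsupp.single y 1 = D' at hD
    subst hD
    have hdeg : (D' + Finsupp.single y 1).degree = D'.degree + 1 := by
      rw [map_add, Finsupp.degree_single]
    obtain ⟨h1, h2⟩ := ih D' (by omega)
    obtain ⟨h3, h4⟩ := hC.formsKilling_add_single D' y
    exact ⟨h3, by omega⟩

/-- The Riemann inequality for a reduced effective divisor `S`: there are many functions with at
most simple poles at `S`. -/
theorem IsCurve.exists_functions (hC : IsCurve O) (S : Finset P) :
    ∃ (N : Submodule ℂ (S → ℂ)) (s : N →ₗ[ℂ] K), Function.Injective s ∧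
      (∀ a, ∀ x ∈ S, hC.coord x * s a ∈ O x) ∧ (∀ a, ∀ x ∉ S, s a ∈ O x) ∧
      S.card ≤ Module.finrank ℂ N + Module.finrank ℂ (H1 (functionStalk O)) := by
  have := hC.finiteDimensional_H1
  let τ : (S → ℂ) →ₗ[ℂ] (S → K) :=
    LinearMap.pi fun x => (LinearMap.toSpanSingleton ℂ K (hC.coord x.1)⁻¹) ∘ₗ LinearMap.proj x
  let T : (S → ℂ) →ₗ[ℂ] H1 (functionStalk O) :=
    (principal (functionStalk O)).mkQ ∘ₗ extendFamily O S ∘ₗ τ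
  let R : Submodule ℂ K :=
    { carrier := {f | (∀ x ∈ S, hC.coord x * f ∈ O x) ∧ ∀ x ∉ S, f ∈ O x}
      add_mem' := by
        rintro f g ⟨h1, h2⟩ ⟨h1', h2'⟩
        exact ⟨fun x hx => by rw [mul_add]; exact add_mem (h1 x hx) (h1' x hx),
          fun x hx => add_mem (h2 x hx) (h2' x hx)⟩
      zero_mem' := ⟨fun x _ => by simp, fun x _ => zero_mem _⟩
      smul_mem' := by
        rintro c f ⟨h1, h2⟩
        exact ⟨fun x hx => by rw [mul_smul_comm]; exact (O x).smul_mem (h1 x hx) c,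
          fun x hx => (O x).smul_mem (h2 x hx) c⟩ }
  -- the polar coefficients
  let g : R →ₗ[ℂ] (S → ℂ) :=
    LinearMap.pi fun x => (hC.place x.1).coeffHom (hC.isCoord x.1) (-1) ∘ₗ R.subtype
  have hker : LinearMap.ker T ≤ LinearMap.range g := by
    intro a ha
    obtain ⟨f, hf⟩ := (H1.mk_eq_zero_iff (extendFamily O S (τ a))).mp (LinearMap.mem_ker.mp ha)
    simp only [mem_functionStalk] at hf
    have hoff : ∀ x ∉ S, f ∈ O x := fun x hx => by
      have := hf x
      rw [extendFamily_of_notMem _ hx, zero_sub] at this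
      simpa using this
    have hon : ∀ x : S, a x • (hC.coord x.1)⁻¹ - f ∈ O x.1 := fun x => by
      have := hf x
      rwa [extendFamily_of_mem _ x.2] at this
    refine ⟨⟨f, fun x hx => ?_, hoff⟩, funext fun x => ?_⟩
    · have h1 := mul_mem (hC.isCoord x).mem (hon ⟨x, hx⟩)
      rw [mul_sub, mul_smul_comm, mul_inv_cancel₀ (hC.isCoord x).ne_zero] at h1
      have h2 := sub_mem ((O x).smul_mem (one_mem _) (a ⟨x, hx⟩)) h1
      simpa using h2
    · refine (hC.place x.1).coeff_eq (hC.isCoord x.1) ?_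
      have h1 := HasCoeff.monomial (A := O x.1) (z := hC.coord x.1) (-1) (a x)
      have h2 : HasCoeff (O x.1) (hC.coord x.1) (-1) (a x • (hC.coord x.1)⁻¹ - f) 0 :=
        HasCoeff.of_mem (hC.isCoord x.1) (by simpa using hon x)
      have h3 := h1.add (h2.smul (-1))
      convert! h3 using 1
      · change f = _
        rw [neg_smul, one_smul, Algebra.smul_def, zpow_neg_one]; ring
      · simp
  obtain ⟨s, hs⟩ := Module.projective_lifting_property g.rangeRestrict
    (Submodule.inclusion hker) g.surjective_rangeRestrict
  have hs' : ∀ a, g (s a) = a.1 := fun a => congr(($hs a).1)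
  refine ⟨LinearMap.ker T, R.subtype ∘ₗ s, fun a b hab => ?_, fun a => (s a).2.1,
    fun a => (s a).2.2, ?_⟩
  · have : s a = s b := Subtype.ext hab
    exact Subtype.ext (by rw [← hs', ← hs', this])
  · have h1 := T.finrank_range_add_finrank_ker
    have h2 := Submodule.finrank_le (LinearMap.range T)
    rw [Module.finrank_fintype_fun_eq_card, Fintype.card_coe] at h1
    omega

theorem IsCurve.comp_mulFamily_mem (hC : IsCurve O) {D : P →₀ ℕ} {S : Finset P}
    {l : Module.Dual ℂ (families (functionStalk O))} (hl : l ∈ hC.formsKilling D) {f : K}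
    (h1 : ∀ x ∈ S, hC.coord x * f ∈ O x) (h2 : ∀ x ∉ S, f ∈ O x) :
    l ∘ₗ hC.mulFamily f ∈ hC.formsKilling (D + Finsupp.indicator S fun _ _ => 1) := by
  classical
  refine ⟨fun g => hl.1 (f * g), fun p hp => hl.2 _ fun x => ?_⟩
  have hx := hp x
  change _ * (f * p.1 x) ∈ _
  by_cases hxS : x ∈ S
  · have hz0 := (hC.isCoord x).ne_zero
    have : hC.coord x ^ (-(D x : ℤ)) * (f * p.1 x) = (hC.coord x * f) *
        (hC.coord x ^ (-((D + Finsupp.indicator S fun _ _ => 1 : P →₀ ℕ) x : ℤ)) * p.1 x) := by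
      simp only [Finsupp.add_apply, Finsupp.indicator_of_mem hxS, Nat.cast_add, Nat.cast_one,
        neg_add, zpow_add₀ hz0, zpow_neg]
      field_simp
    rw [this]
    exact mul_mem (h1 x hxS) hx
  · rw [Finsupp.add_apply, Finsupp.indicator_of_notMem hxS, add_zero] at hx
    rw [mul_left_comm]
    exact mul_mem (h2 x hxS) hx

theorem degree_indicator (S : Finset P) : (Finsupp.indicator S fun _ _ => 1).degree = S.card := by
  classical
  have h : (Finsupp.indicator S fun _ _ => 1 : P →₀ ℕ).support = S := by
    ext x
    by_cases hx : x ∈ S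
    · simp [Finsupp.indicator_of_mem hx, hx]
    · simp [Finsupp.indicator_of_notMem hx, hx]
  rw [Finsupp.degree_apply, h, Finset.card_eq_sum_ones]
  exact Finset.sum_congr rfl fun x hx => Finsupp.indicator_of_mem hx _

/-- Two linear forms killing the rational functions and the sufficiently small families are
proportional over the function field. -/
theorem IsCurve.exists_relation (hC : IsCurve O) {D : P →₀ ℕ}
    {l l' : Module.Dual ℂ (families (functionStalk O))} (hl : l ∈ hC.formsKilling D)
    (hl' : l' ∈ hC.formsKilling D) :
    ∃ f g : K, (f ≠ 0 ∨ g ≠ 0) ∧ ∀ p, l (hC.mulFamily f p) + l' (hC.mulFamily g p) = 0 := by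
  classical
  by_contra! hcon
  have := hC.infinite_points
  -- otherwise the forms `f l + g l'`, with simple poles of `f` and `g` at `S`, would be too many
  obtain ⟨S, hS⟩ := Infinite.exists_subset_card_eq P
    (3 * Module.finrank ℂ (H1 (functionStalk O)) + D.degree + 1)
  obtain ⟨N, s, hs, h1, h2, hN⟩ := hC.exists_functions S
  obtain ⟨hfin, hrank⟩ := hC.formsKilling_finrank (D + Finsupp.indicator S fun _ _ => 1)
  let T : (N × N) →ₗ[ℂ] hC.formsKilling (D + Finsupp.indicator S fun _ _ => 1) :=
    { toFun := fun a => ⟨l ∘ₗ hC.mulFamily (s a.1) + l' ∘ₗ hC.mulFamily (s a.2),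
        add_mem (hC.comp_mulFamily_mem hl (h1 _) (h2 _)) (hC.comp_mulFamily_mem hl' (h1 _) (h2 _))⟩
      map_add' := fun a b => by
        refine Subtype.ext (LinearMap.ext fun p => ?_)
        have e : ∀ f g : K, hC.mulFamily (f + g) p = hC.mulFamily f p + hC.mulFamily g p :=
          fun f g => Subtype.ext (funext fun x => add_mul _ _ _)
        simp only [Prod.fst_add, Prod.snd_add, map_add, LinearMap.add_apply, LinearMap.comp_apply,
          Submodule.coe_add, e]
        abel
      map_smul' := fun c a => by
        refine Subtype.ext (LinearMap.ext fun p => ?_)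
        have e : ∀ f : K, hC.mulFamily (c • f) p = c • hC.mulFamily f p :=
          fun f => Subtype.ext (funext fun x => smul_mul_assoc _ _ _)
        simp only [Prod.smul_fst, Prod.smul_snd, map_smul, LinearMap.add_apply,
          LinearMap.comp_apply, Submodule.coe_smul, LinearMap.smul_apply, e, RingHom.id_apply,
          smul_add] }
  have hT : Function.Injective T := by
    rw [injective_iff_map_eq_zero]
    intro a ha
    by_contra hne
    have hsne : s a.1 ≠ 0 ∨ s a.2 ≠ 0 := by
      by_contra! h
      refine hne (Prod.ext (hs ?_) (hs ?_)) <;> simp [h]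
    obtain ⟨p, hp⟩ := hcon _ _ hsne
    exact hp congr($(congrArg Subtype.val ha) p)
  have h3 := LinearMap.finrank_le_finrank_of_injective hT
  rw [Module.finrank_prod] at h3
  rw [map_add, degree_indicator] at hrank
  omega

/-! ### Serre duality -/

theorem IsPlace.exists_zpow_smul_mem_omegaStalk {A : Subalgebra ℂ K} (hA : IsPlace A)
    (hΩ : DifferentialsLine K) {z : K} (hz : IsCoord A z) (ω : Ω[K⁄ℂ]) :
    ∃ N : ℕ, z ^ (N : ℤ) • ω ∈ omegaStalk A := by
  obtain ⟨g, rfl⟩ := hΩ ω _ (hA.D_coord_ne_zero hz)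
  obtain ⟨N, hN⟩ := hA.exists_zpow_mul_mem hz g
  refine ⟨N, ?_⟩
  rw [smul_smul]
  exact (omegaStalk A).smul_mem ⟨_, hN⟩ (Submodule.subset_span ⟨z, hz.mem, rfl⟩)

theorem IsCurve.finite_notMem_omegaStalk (hC : IsCurve O) (ω : Ω[K⁄ℂ]) :
    {x | ω ∉ omegaStalk (O x)}.Finite := by
  have := hC.infinite_points
  obtain ⟨x₀⟩ : Nonempty P := inferInstance
  obtain ⟨g, rfl⟩ := hC.differentials ω _ ((hC.place x₀).D_coord_ne_zero (hC.isCoord x₀))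
  refine ((hC.regular g).union (hC.regular (hC.coord x₀))).subset fun x hx => ?_
  by_contra h
  simp only [Set.mem_union, Set.mem_ofPred_eq, not_or, not_not] at h
  exact hx ((omegaStalk (O x)).smul_mem ⟨g, h.1⟩ (Submodule.subset_span ⟨_, h.2, rfl⟩))

theorem IsCurve.hasFiniteSupport_res (hC : IsCurve O) (ω : Ω[K⁄ℂ])
    (p : families (functionStalk O)) :
    Function.HasFiniteSupport fun x => (hC.place x).res (p.1 x • ω) := by
  refine ((hC.finite_notMem_omegaStalk ω).union (finite_notMem p)).subset fun x hx => ?_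
  by_contra h
  simp only [Set.mem_union, Set.mem_ofPred_eq, not_or, not_not] at h
  exact hx (((hC.place x).mem_omegaStalk_iff hC.differentials ω).mp h.1 _ h.2)

/-- The sum of the residues of the products with a rational differential. -/
def IsCurve.residueForm (hC : IsCurve O) (ω : Ω[K⁄ℂ]) :
    Module.Dual ℂ (families (functionStalk O)) where
  toFun p := ∑ᶠ x, (hC.place x).res (p.1 x • ω)
  map_add' p q := by
    rw [← finsum_add_distrib (hC.hasFiniteSupport_res ω p) (hC.hasFiniteSupport_res ω q)]
    refine finsum_congr fun x => ?_
    rw [← map_add, ← add_smul]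
    rfl
  map_smul' c p := by
    rw [RingHom.id_apply, smul_finsum]
    refine finsum_congr fun x => ?_
    rw [← map_smul, ← smul_assoc]
    rfl

theorem IsCurve.residueForm_apply (hC : IsCurve O) (ω : Ω[K⁄ℂ]) (p : families (functionStalk O)) :
    hC.residueForm ω p = ∑ᶠ x, (hC.place x).res (p.1 x • ω) := rfl

theorem IsCurve.residueForm_single (hC : IsCurve O) (ω : Ω[K⁄ℂ]) (x : P) (f : K) :
    hC.residueForm ω (singleFamily _ x f) = (hC.place x).res (f • ω) := by
  rw [residueForm_apply, finsum_eq_single _ x fun y hy => by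
    rw [singleFamily_of_ne _ hy, zero_smul, map_zero], singleFamily_same]

theorem IsCurve.residueForm_mulFamily (hC : IsCurve O) (ω : Ω[K⁄ℂ]) (f : K)
    (p : families (functionStalk O)) :
    hC.residueForm ω (hC.mulFamily f p) = hC.residueForm (f • ω) p := by
  rw [residueForm_apply, residueForm_apply]
  refine finsum_congr fun x => ?_
  rw [smul_smul, mul_comm]
  rfl

/-- The residue theorem: the sum of the residues of a rational differential vanishes. -/
theorem IsCurve.residueForm_const (hC : IsCurve O) (ω : Ω[K⁄ℂ]) (f : K) :
    hC.residueForm ω (hC.constFamily f) = 0 := by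
  have := hC.infinite_points
  obtain ⟨x₀⟩ : Nonempty P := inferInstance
  obtain ⟨g, hg⟩ := hC.differentials (f • ω) _ ((hC.place x₀).D_coord_ne_zero (hC.isCoord x₀))
  rw [residueForm_apply]
  change ∑ᶠ x, (hC.place x).res (f • ω) = 0
  rw [hg]
  simp only [IsPlace.res_smul_D]
  have hfin := (hC.regular g).union (hC.regular (hC.coord x₀))
  have h1 : ∀ x ∉ hfin.toFinset, g ∈ O x ∧ hC.coord x₀ ∈ O x := fun x hx => by
    simpa using hx
  rw [finsum_eq_sum_of_support_subset (s := hfin.toFinset) _ fun x hx => ?_]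
  · exact hC.sum_symbol g _ _ (fun x hx => (h1 x hx).1) fun x hx => (h1 x hx).2
  · by_contra hx'
    exact hx (symbol_of_mem (h1 x hx').1 (h1 x hx').2)

theorem IsCurve.exists_residueForm_mem (hC : IsCurve O) (ω : Ω[K⁄ℂ]) :
    ∃ D, hC.residueForm ω ∈ hC.formsKilling D := by
  classical
  have h := fun x => (hC.place x).exists_zpow_smul_mem_omegaStalk hC.differentials (hC.isCoord x) ω
  choose N hN using h
  have hfin := hC.finite_notMem_omegaStalk ω
  refine ⟨Finsupp.indicator hfin.toFinset fun x _ => N x, hC.residueForm_const ω, fun p hp => ?_⟩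
  rw [residueForm_apply]
  refine finsum_eq_zero_of_forall_eq_zero fun x => ?_
  have hx := hp x
  by_cases hω : ω ∈ omegaStalk (O x)
  · rw [Finsupp.indicator_of_notMem (by simpa using hω)] at hx
    exact ((hC.place x).mem_omegaStalk_iff hC.differentials ω).mp hω _ (by simpa using hx)
  · rw [Finsupp.indicator_of_mem (by simpa using hω)] at hx
    have := ((hC.place x).mem_omegaStalk_iff hC.differentials _).mp (hN x) _ hx
    rwa [smul_smul, mul_right_comm, ← zpow_add₀ (hC.isCoord x).ne_zero, neg_add_cancel, zpow_zero,
      one_mul] at this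

theorem IsCurve.exists_residueForm_ne_zero (hC : IsCurve O) {ω : Ω[K⁄ℂ]} (hω : ω ≠ 0) :
    ∃ p, hC.residueForm ω p ≠ 0 := by
  have := hC.infinite_points
  obtain ⟨x⟩ : Nonempty P := inferInstance
  obtain ⟨g, rfl⟩ := hC.differentials ω _ ((hC.place x).D_coord_ne_zero (hC.isCoord x))
  have hg : g ≠ 0 := by rintro rfl; simp at hω
  refine ⟨singleFamily _ x ((hC.coord x)⁻¹ * g⁻¹), ?_⟩
  rw [residueForm_single, smul_smul, mul_assoc, inv_mul_cancel₀ hg, mul_one,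
    IsPlace.res_smul_D, (hC.place x).symbol_inv_coord (hC.isCoord x)]
  exact one_ne_zero

/-- Serre duality for the structure sheaf, without bounds on the poles. -/
theorem IsCurve.exists_eq_residueForm (hC : IsCurve O) {D : P →₀ ℕ}
    {l : Module.Dual ℂ (families (functionStalk O))} (hl : l ∈ hC.formsKilling D) :
    ∃ ω, l = hC.residueForm ω := by
  have := hC.infinite_points
  obtain ⟨x⟩ : Nonempty P := inferInstance
  set ω := KaehlerDifferential.D ℂ K (hC.coord x)
  have hω : ω ≠ 0 := (hC.place x).D_coord_ne_zero (hC.isCoord x)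
  obtain ⟨D', hD'⟩ := hC.exists_residueForm_mem ω
  obtain ⟨f, g, hfg, hrel⟩ := hC.exists_relation
    (hC.formsKilling_mono (D' := D + D') (by simp) hl)
    (hC.formsKilling_mono (D' := D + D') (by simp) hD')
  by_cases hf : f = 0
  · exfalso
    have hg : g ≠ 0 := by simpa [hf] using hfg
    obtain ⟨p, hp⟩ := hC.exists_residueForm_ne_zero (smul_ne_zero hg hω)
    have h0 : hC.mulFamily f p = 0 := by
      rw [hf]; exact Subtype.ext (funext fun x => zero_mul _)
    have := hrel p
    rw [h0, map_zero, zero_add, residueForm_mulFamily] at this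
    exact hp this
  · refine ⟨(-(g * f⁻¹)) • ω, LinearMap.ext fun p => ?_⟩
    have := hrel (hC.mulFamily f⁻¹ p)
    have e : hC.mulFamily f (hC.mulFamily f⁻¹ p) = p :=
      Subtype.ext (funext fun x => mul_inv_cancel_left₀ hf _)
    have e' : hC.mulFamily g (hC.mulFamily f⁻¹ p) = - hC.mulFamily (-(g * f⁻¹)) p :=
      Subtype.ext (funext fun x => by
        change g * (f⁻¹ * p.1 x) = -(-(g * f⁻¹) * p.1 x)
        ring)
    rw [e, e', map_neg, residueForm_mulFamily] at this
    exact sub_eq_zero.mp (by rwa [sub_eq_add_neg])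

/-- A nonzero rational differential vanishes at finitely many points only. -/
theorem IsCurve.finite_zeros (hC : IsCurve O) {ω : Ω[K⁄ℂ]} (hω : ω ≠ 0) :
    {x | ∀ f, hC.coord x * f ∈ O x → (hC.place x).res (f • ω) = 0}.Finite := by
  classical
  by_contra hinf
  obtain ⟨D, hD⟩ := hC.exists_residueForm_mem ω
  obtain ⟨S, hSsub, hS⟩ := Set.Infinite.exists_subset_card_eq hinf
    (2 * Module.finrank ℂ (H1 (functionStalk O)) + D.degree + 1)
  obtain ⟨N, s, hs, h1, h2, hN⟩ := hC.exists_functions S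
  obtain ⟨hfin, hrank⟩ := hC.formsKilling_finrank D
  have hmem : ∀ a, hC.residueForm (s a • ω) ∈ hC.formsKilling D := fun a => by
    refine ⟨hC.residueForm_const _, fun p hp => ?_⟩
    -- at the points of `S` the pole of `s a` is absorbed by the zero of `ω`
    have hterm : ∀ x, (hC.place x).res (p.1 x • s a • ω) =
        hC.residueForm ω (singleFamily _ x (s a * p.1 x)) := fun x => by
      rw [residueForm_single, smul_smul, mul_comm]
    rw [residueForm_apply]
    refine finsum_eq_zero_of_forall_eq_zero fun x => ?_
    by_cases hxS : x ∈ S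
    · have hpx : p.1 x ∈ O x := by
        have := (hC.isCoord x).zpow_mul_mem_mono (n := 0) (by omega) (hp x)
        simpa using this
      rw [smul_smul, mul_comm]
      refine hSsub hxS _ ?_
      rw [← mul_assoc]
      exact mul_mem (h1 a x hxS) hpx
    · rw [hterm]
      refine hD.2 _ fun y => ?_
      by_cases hyx : y = x
      · subst hyx
        rw [singleFamily_same, mul_left_comm]
        exact mul_mem (h2 a y hxS) (hp y)
      · rw [singleFamily_of_ne _ hyx, mul_zero]
        exact zero_mem _
  let T : N →ₗ[ℂ] hC.formsKilling D :=
    { toFun := fun a => ⟨hC.residueForm (s a • ω), hmem a⟩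
      map_add' := fun a b => Subtype.ext (LinearMap.ext fun p => by
        change _ = hC.residueForm _ p + hC.residueForm _ p
        simp only [← residueForm_mulFamily, ← map_add]
        congr 1
        exact Subtype.ext (funext fun x => by
          change s (a + b) * p.1 x = s a * p.1 x + s b * p.1 x
          rw [map_add, add_mul]))
      map_smul' := fun c a => Subtype.ext (LinearMap.ext fun p => by
        change _ = c • hC.residueForm _ p
        rw [← residueForm_mulFamily, ← residueForm_mulFamily, ← map_smul]
        congr 1
        exact Subtype.ext (funext fun x => by
          change s (c • a) * p.1 x = c • (s a * p.1 x)
          rw [map_smul, smul_mul_assoc])) }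
  have hT : Function.Injective T := by
    rw [injective_iff_map_eq_zero]
    intro a ha
    by_contra hne
    have hsa : s a ≠ 0 := fun h => hne (hs (by rw [h, map_zero]))
    obtain ⟨p, hp⟩ := hC.exists_residueForm_ne_zero (smul_ne_zero hsa hω)
    exact hp congr($(congrArg Subtype.val ha) p)
  have h3 := LinearMap.finrank_le_finrank_of_injective hT
  omega

end Duality

end CurveLifting

set_option linter.unusedSectionVars false
namespace CurveLifting

/-! ### Local frames and Serre duality for bundles -/

section Bundles

variable {K : Type} [Field K] [Algebra ℂ K] {P : Type} {O : P → Subalgebra ℂ K}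
variable {V : Type} [AddCommGroup V] [Module K V] [Module ℂ V] [IsScalarTower ℂ K V]
variable {L : ∀ x, Submodule (O x) V}

theorem IsFrame.mem_iff {x : P} {ι : Type} [Fintype ι] {b : Module.Basis ι K V}
    (hb : IsFrame L x b) (v : V) : v ∈ L x ↔ ∀ i, b.repr v i ∈ O x := by
  rw [← hb, Submodule.mem_span_range_iff_exists_fun]
  constructor
  · rintro ⟨c, rfl⟩ i
    have : b.repr (∑ i, c i • b i) i = c i := by
      have := b.repr_sum_self (fun i => (c i : K))
      exact congrFun this i
    rw [this]
    exact (c i).2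
  · intro h
    exact ⟨fun i => ⟨_, h i⟩, b.sum_repr v⟩

theorem isFrame_of_mem_iff {x : P} {ι : Type} [Fintype ι] {b : Module.Basis ι K V}
    (h : ∀ v, v ∈ L x ↔ ∀ i, b.repr v i ∈ O x) : IsFrame L x b := by
  classical
  ext v
  rw [h, Submodule.mem_span_range_iff_exists_fun]
  constructor
  · rintro ⟨c, rfl⟩ i
    have : b.repr (∑ i, c i • b i) i = c i := by
      have := b.repr_sum_self (fun i => (c i : K))
      exact congrFun this i
    rw [this]
    exact (c i).2
  · intro h
    exact ⟨fun i => ⟨_, h i⟩, b.sum_repr v⟩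

theorem smul_mem_stalk {x : P} {f : K} (hf : f ∈ O x) {v : V} (hv : v ∈ L x) : f • v ∈ L x :=
  (L x).smul_mem ⟨f, hf⟩ hv

theorem IsFrame.basis_mem {x : P} {ι : Type} {b : Module.Basis ι K V}
    (hb : IsFrame L x b) (i : ι) : b i ∈ L x := by
  rw [← hb]
  exact Submodule.subset_span ⟨i, rfl⟩

/-- The stalks `L` form a vector bundle: there is a frame at each point, and one basis is a frame
at almost all points. -/
structure IsBundle (L : ∀ x, Submodule (O x) V) : Prop where
  frame : ∀ x, ∃ (ι : Type) (_ : Fintype ι) (b : Module.Basis ι K V), IsFrame L x b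
  generic : ∃ (ι : Type) (_ : Fintype ι) (b : Module.Basis ι K V), {x | ¬ IsFrame L x b}.Finite

theorem IsBundle.exists_zpow_smul_mem (hL : IsBundle L) {x : P} (hA : IsPlace (O x)) {z : K}
    (hz : IsCoord (O x) z) (v : V) : ∃ N : ℕ, z ^ (N : ℤ) • v ∈ L x := by
  obtain ⟨ι, _, b, hb⟩ := hL.frame x
  choose N hN using fun i => hA.exists_zpow_mul_mem hz (b.repr v i)
  refine ⟨Finset.univ.sup N, (hb.mem_iff _).mpr fun i => ?_⟩
  rw [map_smul]
  exact hz.zpow_mul_mem_mono (by exact_mod_cast Finset.le_sup (f := N) (Finset.mem_univ i)) (hN i)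

theorem IsBundle.finite_notMem (hL : IsBundle L) (hC : IsCurve O) (v : V) :
    {x | v ∉ L x}.Finite := by
  obtain ⟨ι, _, b, hb⟩ := hL.generic
  refine (hb.union (Set.finite_iUnion fun i => hC.regular (b.repr v i))).subset fun x hx => ?_
  by_contra h
  simp only [Set.mem_union, Set.mem_iUnion, Set.mem_ofPred_eq, not_or, not_exists, not_not] at h
  exact hx ((h.1.mem_iff _).mpr h.2)

theorem IsCurve.hasFiniteSupport_residue (hC : IsCurve O) (s : CoSection L) (p : families L) :
    Function.HasFiniteSupport fun x => residue (O x) (s.1 (p.1 x)) := by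
  refine Set.Finite.subset p.2 fun x hx => ?_
  intro h
  refine hx ?_
  change residue (O x) (s.1 (p.1 x)) = 0
  rw [(hC.place x).residue_eq hC.differentials]
  simpa using ((hC.place x).mem_omegaStalk_iff hC.differentials _).mp (s.2 x _ h) 1 (one_mem _)

/-- The sum of residues as a linear form on families. -/
def IsCurve.serreHom (hC : IsCurve O) (s : CoSection L) : families L →ₗ[ℂ] ℂ where
  toFun p := serreForm L p s
  map_add' p q := by
    rw [serreForm, serreForm, serreForm, ← finsum_add_distrib (hC.hasFiniteSupport_residue s p)
      (hC.hasFiniteSupport_residue s q)]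
    refine finsum_congr fun x => ?_
    simp only [(hC.place x).residue_eq hC.differentials]
    rw [← map_add, ← map_add]
    rfl
  map_smul' c p := by
    rw [RingHom.id_apply, serreForm, serreForm, smul_finsum]
    refine finsum_congr fun x => ?_
    simp only [(hC.place x).residue_eq hC.differentials]
    rw [← map_smul, ← algebraMap_smul K c (s.1 (p.1 x)), ← map_smul, algebraMap_smul]
    rfl

theorem IsCurve.serreHom_apply (hC : IsCurve O) (s : CoSection L) (p : families L) :
    hC.serreHom s p = serreForm L p s := rfl

theorem IsCurve.serreForm_single (hC : IsCurve O) (s : CoSection L) (x : P) (v : V) :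
    serreForm L (singleFamily L x v) s = (hC.place x).res (s.1 v) := by
  rw [serreForm, finsum_eq_single _ x fun y hy => by
    rw [singleFamily_of_ne L hy, map_zero, (hC.place y).residue_eq hC.differentials, map_zero],
    singleFamily_same, (hC.place x).residue_eq hC.differentials]

theorem IsCurve.res_eq_zero_of_mem (hC : IsCurve O) (s : CoSection L) {x : P} {v : V}
    (hv : v ∈ L x) : (hC.place x).res (s.1 v) = 0 := by
  simpa using ((hC.place x).mem_omegaStalk_iff hC.differentials _).mp (s.2 x _ hv) 1 (one_mem _)

/-- Serre duality: any linear form on the first cohomology of a bundle is the sum of the residues of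
the contraction with a global section of the dual bundle twisted by the canonical bundle. -/
theorem IsCurve.serre_duality (hC : IsCurve O) (hL : IsBundle L) (l : H1 L →ₗ[ℂ] ℂ) :
    ∃ s : CoSection L, ∀ p, l (H1.mk L p) = serreForm L p s := by
  classical
  obtain ⟨ι, _, b, hb⟩ := hL.generic
  have hmk0 : ∀ p : families L, (∀ x, p.1 x ∈ L x) → H1.mk L p = 0 := fun p hp =>
    (H1.mk_eq_zero_iff p).mpr ⟨0, fun x => by simpa using hp x⟩
  -- the family `x ↦ p x • b i`
  let T : ι → families (functionStalk O) →ₗ[ℂ] families L := fun i =>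
    { toFun := fun p => ⟨fun x => p.1 x • b i, by
        refine ((finite_notMem p).union (hL.finite_notMem hC (b i))).subset fun x hx => ?_
        by_contra h
        simp only [Set.mem_union, Set.mem_ofPred_eq, not_or, not_not] at h
        exact hx (smul_mem_stalk h.1 h.2)⟩
      map_add' := fun p q => Subtype.ext (funext fun x => add_smul _ _ _)
      map_smul' := fun c p => Subtype.ext (funext fun x => smul_assoc _ _ _) }
  let m : ι → Module.Dual ℂ (families (functionStalk O)) := fun i =>
    l ∘ₗ (principal L).mkQ ∘ₗ T i
  have hm : ∀ i, ∃ ω, m i = hC.residueForm ω := by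
    intro i
    choose N hN using fun x => hL.exists_zpow_smul_mem (hC.place x) (hC.isCoord x) (b i)
    refine hC.exists_eq_residueForm (D := Finsupp.indicator (hL.finite_notMem hC (b i)).toFinset
      fun x _ => N x) ⟨fun f => ?_, fun p hp => ?_⟩
    · change l (H1.mk L (T i (hC.constFamily f))) = 0
      rw [(H1.mk_eq_zero_iff _).mpr ⟨f • b i, fun x => ?_⟩, map_zero]
      change f • b i - f • b i ∈ L x
      rw [sub_self]
      exact zero_mem _
    · change l (H1.mk L (T i p)) = 0
      rw [hmk0 _ fun x => ?_, map_zero]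
      have hx := hp x
      change p.1 x • b i ∈ L x
      by_cases hbx : b i ∈ L x
      · rw [Finsupp.indicator_of_notMem (by simpa using hbx)] at hx
        exact smul_mem_stalk (by simpa using hx) hbx
      · rw [Finsupp.indicator_of_mem (by simpa using hbx)] at hx
        have := smul_mem_stalk hx (hN x)
        rwa [smul_smul, mul_right_comm, ← zpow_add₀ (hC.isCoord x).ne_zero, neg_add_cancel,
          zpow_zero, one_mul] at this
  choose ω hω using hm
  let s : V →ₗ[K] Ω[K⁄ℂ] := b.constr K ω
  have hs : ∀ v, s v = ∑ i, b.repr v i • ω i := fun v => by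
    simp [s, Module.Basis.constr_apply_fintype]
  have key : ∀ p : families L, l (H1.mk L p) = ∑ᶠ x, residue (O x) (s (p.1 x)) := by
    intro p
    let c : ι → families (functionStalk O) := fun i => ⟨fun x => b.repr (p.1 x) i, by
      refine (hb.union p.2).subset fun x hx => ?_
      by_contra h
      simp only [Set.mem_union, Set.mem_ofPred_eq, not_or, not_not] at h
      exact hx (mem_functionStalk.mpr ((h.1.mem_iff _).mp h.2 i))⟩
    have hp : p = ∑ i, T i (c i) := by
      refine Subtype.ext (funext fun x => ?_)
      rw [AddSubmonoidClass.coe_finsetSum, Finset.sum_apply]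
      exact (b.sum_repr (p.1 x)).symm
    have h1 : l (H1.mk L p) = ∑ i, m i (c i) := by
      conv_lhs => rw [hp]
      simp only [H1.mk, map_sum]
      rfl
    rw [h1]
    simp only [hω, hC.residueForm_apply]
    rw [← finsum_sum_comm _ _ fun i _ => hC.hasFiniteSupport_res (ω i) (c i)]
    refine finsum_congr fun x => ?_
    rw [(hC.place x).residue_eq hC.differentials, hs, map_sum]
  refine ⟨⟨s, fun x v hv => ((hC.place x).mem_omegaStalk_iff hC.differentials _).mpr
    fun f hf => ?_⟩, key⟩
  have h1 := key (singleFamily L x (f • v))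
  rw [hmk0 _ fun y => ?_, map_zero, finsum_eq_single _ x fun y hy => by
    rw [singleFamily_of_ne L hy, map_zero, (hC.place y).residue_eq hC.differentials, map_zero],
    singleFamily_same, (hC.place x).residue_eq hC.differentials, map_smul] at h1
  · exact h1.symm
  · by_cases hyx : y = x
    · subst hyx
      rw [singleFamily_same]
      exact smul_mem_stalk hf hv
    · rw [singleFamily_of_ne L hyx]
      exact zero_mem _

end Bundles

section HomBundle

variable {K : Type} [Field K] [Algebra ℂ K] {P : Type} {O : P → Subalgebra ℂ K}
variable {VF : Type} [AddCommGroup VF] [Module K VF] [Module ℂ VF] [IsScalarTower ℂ K VF]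
variable {VE : Type} [AddCommGroup VE] [Module K VE] [Module ℂ VE] [IsScalarTower ℂ K VE]
variable {LF : ∀ x, Submodule (O x) VF} {LE : ∀ x, Submodule (O x) VE}

theorem linearMap_repr {ι κ : Type} [Fintype ι] [Fintype κ] [DecidableEq ι]
    (b : Module.Basis ι K VF) (c : Module.Basis κ K VE) (φ : VF →ₗ[K] VE) (i : κ) (j : ι) :
    (b.linearMap c).repr φ (i, j) = c.repr (φ (b j)) i := by
  simp [Module.Basis.linearMap, LinearMap.toMatrix_apply, Matrix.stdBasis]

theorem mem_homStalk_iff {x : P} {ι : Type} [Fintype ι] {b : Module.Basis ι K VF}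
    (hb : IsFrame LF x b) {φ : VF →ₗ[K] VE} :
    φ ∈ homStalk LF LE x ↔ ∀ j, φ (b j) ∈ LE x := by
  refine ⟨fun h j => h _ (hb.basis_mem j), fun h v hv => ?_⟩
  rw [← b.sum_repr v, map_sum]
  refine sum_mem fun i _ => ?_
  rw [map_smul]
  exact smul_mem_stalk ((hb.mem_iff v).mp hv i) (h i)

theorem IsFrame.hom {x : P} {ι κ : Type} [Fintype ι] [Fintype κ] [DecidableEq ι]
    {b : Module.Basis ι K VF} {c : Module.Basis κ K VE}
    (hb : IsFrame LF x b) (hc : IsFrame LE x c) :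
    IsFrame (homStalk LF LE) x (b.linearMap c) := by
  refine isFrame_of_mem_iff fun φ => ?_
  rw [mem_homStalk_iff hb]
  simp only [hc.mem_iff, Prod.forall, linearMap_repr]
  exact forall_comm

theorem IsBundle.hom (hF : IsBundle LF) (hE : IsBundle LE) : IsBundle (homStalk LF LE) := by
  classical
  constructor
  · intro x
    obtain ⟨ι, _, b, hb⟩ := hF.frame x
    obtain ⟨κ, _, c, hc⟩ := hE.frame x
    exact ⟨κ × ι, inferInstance, b.linearMap c, hb.hom hc⟩
  · obtain ⟨ι, _, b, hb⟩ := hF.generic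
    obtain ⟨κ, _, c, hc⟩ := hE.generic
    refine ⟨κ × ι, inferInstance, b.linearMap c, (hb.union hc).subset fun x hx => ?_⟩
    by_contra h
    simp only [Set.mem_union, Set.mem_ofPred_eq, not_or, not_not] at h
    exact hx (h.1.hom h.2)

end HomBundle

end CurveLifting

set_option linter.unusedSectionVars false
namespace CurveLifting

/-! ### Frames adapted to a subsheaf -/

section Adapted

variable {K : Type} [Field K] [Algebra ℂ K]

theorem IsPlace.isPrincipalIdealRing {A : Subalgebra ℂ K} (hA : IsPlace A) :
    IsPrincipalIdealRing A := by
  obtain ⟨z, hz⟩ := hA.exists_coord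
  have hdvr : IsDiscreteValuationRing A := by
    refine IsDiscreteValuationRing.ofHasUnitMulPowIrreducibleFactorization
      ⟨⟨z, hz.mem⟩, ⟨?_, ?_⟩, ?_⟩
    · intro hu
      obtain ⟨g, hg⟩ := hu.exists_right_inv
      have hg' : z * g.1 = 1 := congrArg Subtype.val hg
      exact hz.inv_notMem (eq_inv_of_mul_eq_one_right hg' ▸ g.2)
    · intro a b hab
      by_contra! h
      have key : ∀ c : A, ¬ IsUnit c → ∃ g ∈ A, c.1 = z * g := fun c hc =>
        (hz.2.2 c.1 c.2).mp fun ⟨g, hg, hcg⟩ =>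
          hc (IsUnit.of_mul_eq_one (⟨g, hg⟩ : A) (Subtype.ext hcg))
      obtain ⟨a', ha', ea⟩ := key a h.1
      obtain ⟨b', hb', eb⟩ := key b h.2
      have hab' : z = a.1 * b.1 := congrArg Subtype.val hab
      have hz0 := hz.ne_zero
      have h1 : z * (a' * b') = 1 := by
        refine mul_left_cancel₀ hz0 ?_
        rw [mul_one]
        nth_rw 3 [hab']
        rw [ea, eb]
        ring
      exact hz.inv_notMem (eq_inv_of_mul_eq_one_right h1 ▸ A.mul_mem ha' hb')
    · intro f hf
      obtain ⟨n, u, hu, hu', e⟩ := hA.factor z hz f.1 (by simpa using hf)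
      have hu0 : u ≠ 0 := by
        rintro rfl
        exact hf (Subtype.ext (by simpa using e))
      have hn : 0 ≤ n := hz.zpow_mul_unit_mem hu' hu0 (e ▸ f.2)
      lift n to ℕ using hn
      refine ⟨n, ⟨⟨u, hu⟩, ⟨u⁻¹, hu'⟩, Subtype.ext (mul_inv_cancel₀ hu0),
        Subtype.ext (inv_mul_cancel₀ hu0)⟩, Subtype.ext ?_⟩
      simpa using e.symm
  infer_instance

variable {P : Type} {O : P → Subalgebra ℂ K}
variable {VF : Type} [AddCommGroup VF] [Module K VF] [Module ℂ VF] [IsScalarTower ℂ K VF]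
variable {LF : ∀ x, Submodule (O x) VF} {RG : Submodule K VF} {LG : ∀ x, Submodule (O x) VF}

theorem mem_iff_repr_eq_zero {ι : Type} {b : Module.Basis ι K VF} {S : Set ι}
    (hS : Submodule.span K (b '' S) = RG) {v : VF} : v ∈ RG ↔ ∀ i ∉ S, b.repr v i = 0 := by
  rw [← hS, Module.Basis.mem_span_image]
  simp only [Set.subset_def, Finset.mem_coe, Finsupp.mem_support_iff]
  exact forall_congr' fun i => not_imp_comm

/-- Smith normal form of the stalk of a subsheaf in the stalk of a bundle. -/
theorem exists_smithFrame {x : P} (hA : IsPlace (O x))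
    (hF : ∃ (ι : Type) (_ : Fintype ι) (b : Module.Basis ι K VF), IsFrame LF x b)
    (hle : LG x ≤ LF x) :
    ∃ (r n : ℕ) (b : Module.Basis (Fin r) K VF) (f : Fin n ↪ Fin r) (a : Fin n → K),
      IsFrame LF x b ∧ (∀ i, a i ∈ O x ∧ a i ≠ 0) ∧
      LG x = Submodule.span (O x) (Set.range fun i => a i • b (f i)) := by
  classical
  obtain ⟨ι, _, b₀, hb₀⟩ := hF
  have := hA.isPrincipalIdealRing
  let B₀ : Module.Basis ι (O x) (LF x) :=
    (b₀.restrictScalars (O x)).map (LinearEquiv.ofEq _ _ hb₀)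
  let B₁ := B₀.reindex (Fintype.equivFin ι)
  obtain ⟨n, sn⟩ := Submodule.smithNormalForm B₁ ((LG x).comap (LF x).subtype)
  let v : Fin (Fintype.card ι) → VF := fun i => (sn.bM i : VF)
  have hspanv : Submodule.span (O x) (Set.range v) = LF x := by
    have h := congrArg (Submodule.map (LF x).subtype) sn.bM.span_eq
    rw [Submodule.map_span, Submodule.map_subtype_top, ← Set.range_comp] at h
    exact h
  have htop : ⊤ ≤ Submodule.span K (Set.range v) := by
    rw [← b₀.span_eq, Submodule.span_le]
    rintro _ ⟨i, rfl⟩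
    have h1 : b₀ i ∈ Submodule.span (O x) (Set.range v) := hspanv ▸ hb₀.basis_mem i
    exact Submodule.span_subset_span (O x) K _ h1
  let b : Module.Basis (Fin (Fintype.card ι)) K VF := basisOfTopLeSpanOfCardEqFinrank v htop (by
    rw [Fintype.card_fin, Module.finrank_eq_card_basis b₀])
  have hb : ⇑b = v := coe_basisOfTopLeSpanOfCardEqFinrank v htop _
  refine ⟨_, n, b, sn.f, fun i => (sn.a i).1, by rw [IsFrame, hb, hspanv],
    fun i => ⟨(sn.a i).2, fun h => ?_⟩, ?_⟩
  · refine sn.bN.ne_zero i (Subtype.ext ?_)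
    rw [sn.snf i, (Subtype.ext h : sn.a i = 0), zero_smul]
    rfl
  · have h := congrArg (fun N => Submodule.map (LF x).subtype (Submodule.map
      ((LG x).comap (LF x).subtype).subtype N)) sn.bN.span_eq
    simp only [Submodule.map_span, Submodule.map_subtype_top, ← Set.range_comp,
      Submodule.map_comap_subtype] at h
    rw [inf_eq_right.mpr hle] at h
    refine h.symm.trans ?_
    congr 2
    funext i
    change ((sn.bN i : LF x) : VF) = _
    rw [sn.snf i, hb]
    rfl

/-- Elementary divisors: at each point there is a frame of the ambient bundle, part of which spans
the subsheaf after rescaling by powers of the coordinate. -/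
theorem exists_adaptedFrame {x : P} (hA : IsPlace (O x)) {z : K} (hz : IsCoord (O x) z)
    (hF : ∃ (ι : Type) (_ : Fintype ι) (b : Module.Basis ι K VF), IsFrame LF x b)
    (hle : LG x ≤ LF x) (hspan : Submodule.span K (LG x : Set VF) = RG) :
    ∃ (r : ℕ) (b : Module.Basis (Fin r) K VF) (S : Set (Fin r)) (α : Fin r → ℕ),
      IsFrame LF x b ∧ Submodule.span K (b '' S) = RG ∧
      ∀ g, g ∈ LG x ↔ (∀ i ∈ S, z ^ (-(α i : ℤ)) * b.repr g i ∈ O x) ∧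
        ∀ i ∉ S, b.repr g i = 0 := by
  classical
  obtain ⟨r, n, b, f, a, hframe, ha, hLG⟩ := exists_smithFrame hA hF hle
  choose β u hu hu' hβ using fun i => hA.factor z hz (a i) (ha i).2
  have hu0 : ∀ i, u i ≠ 0 := fun i h => (ha i).2 (by rw [hβ, h, mul_zero])
  have hβ0 : ∀ i, 0 ≤ β i := fun i =>
    hz.zpow_mul_unit_mem (hu' i) (hu0 i) (hβ i ▸ (ha i).1)
  have hmemG : ∀ i, z ^ β i • b (f i) ∈ LG x := by
    intro i
    have h1 : a i • b (f i) ∈ LG x := hLG ▸ Submodule.subset_span ⟨i, rfl⟩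
    have h2 := smul_mem_stalk (hu' i) h1
    rwa [hβ, smul_smul, mul_comm, mul_assoc, mul_inv_cancel₀ (hu0 i), mul_one] at h2
  let S : Set (Fin r) := Set.range f
  let α : Fin r → ℕ := fun j => if h : ∃ i, f i = j then (β h.choose).toNat else 0
  have hα : ∀ i, (α (f i) : ℤ) = β i := by
    intro i
    have h : ∃ i', f i' = f i := ⟨i, rfl⟩
    have h1 : h.choose = i := f.injective h.choose_spec
    simp only [α, dif_pos h, h1]
    exact Int.toNat_of_nonneg (hβ0 i)
  have hG : ∀ g, g ∈ LG x ↔ (∀ i ∈ S, z ^ (-(α i : ℤ)) * b.repr g i ∈ O x) ∧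
      ∀ i ∉ S, b.repr g i = 0 := by
    intro g
    constructor
    · intro hg
      rw [hLG, Submodule.mem_span_range_iff_exists_fun] at hg
      obtain ⟨c, rfl⟩ := hg
      have hrep : ∀ j, b.repr (∑ i, c i • (a i • b (f i))) j =
          ∑ i, if f i = j then (c i).1 * a i else 0 := by
        intro j
        rw [map_sum, Finsupp.finsetSum_apply]
        refine Finset.sum_congr rfl fun i _ => ?_
        rw [Subalgebra.smul_def, map_smul, map_smul, Module.Basis.repr_self, Finsupp.smul_apply,
          Finsupp.smul_apply, Finsupp.single_apply]
        simp
      constructor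
      · rintro _ ⟨i, rfl⟩
        rw [hrep, Finset.sum_eq_single i (fun k _ hk => if_neg fun h => hk (f.injective h))
          (by simp), if_pos rfl, hα, hβ, mul_left_comm, ← mul_assoc (z ^ _),
          ← zpow_add₀ hz.ne_zero, neg_add_cancel, zpow_zero, one_mul]
        exact (O x).mul_mem (c i).2 (hu i)
      · intro j hj
        rw [hrep]
        exact Finset.sum_eq_zero fun i _ => if_neg fun h => hj ⟨i, h⟩
    · rintro ⟨h1, h2⟩
      rw [← b.sum_repr g]
      refine sum_mem fun j _ => ?_
      by_cases hj : j ∈ S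
      · obtain ⟨i, rfl⟩ := hj
        have h3 := smul_mem_stalk (h1 _ ⟨i, rfl⟩) (hmemG i)
        rwa [smul_smul, hα, mul_right_comm, ← zpow_add₀ hz.ne_zero, neg_add_cancel, zpow_zero,
          one_mul] at h3
      · rw [h2 j hj, zero_smul]
        exact zero_mem _
  refine ⟨r, b, S, α, hframe, ?_, hG⟩
  refine le_antisymm ?_ ?_
  · rw [Submodule.span_le]
    rintro _ ⟨_, ⟨i, rfl⟩, rfl⟩
    rw [← hspan]
    have h1 := Submodule.smul_mem _ (z ^ (-β i)) (Submodule.subset_span (R := K) (hmemG i))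
    rwa [smul_smul, ← zpow_add₀ hz.ne_zero, neg_add_cancel, zpow_zero, one_smul] at h1
  · rw [← hspan, Submodule.span_le]
    intro g hg
    exact (mem_iff_repr_eq_zero rfl).mpr ((hG g).mp hg).2

/-- The projection onto the span of part of a basis. -/
def partProj {ι : Type} [Fintype ι] (b : Module.Basis ι K VF) (S : Set ι) : VF →ₗ[K] VF :=
  open Classical in b.constr K fun i => if i ∈ S then b i else 0

theorem repr_partProj {ι : Type} [Fintype ι] (b : Module.Basis ι K VF) (S : Set ι) (v : VF)
    (i : ι) [Decidable (i ∈ S)] :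
    b.repr (partProj b S v) i = if i ∈ S then b.repr v i else 0 := by
  classical
  rw [partProj, Module.Basis.constr_apply_fintype, map_sum, Finsupp.finsetSum_apply]
  simp only [map_smul, Finsupp.smul_apply, Module.Basis.equivFun_apply, smul_eq_mul]
  rw [Finset.sum_eq_single i]
  · split_ifs <;> simp
  · intro j _ hj
    split_ifs <;> simp [hj]
  · simp

theorem partProj_of_mem {ι : Type} [Fintype ι] {b : Module.Basis ι K VF} {S : Set ι}
    (hS : Submodule.span K (b '' S) = RG) {v : VF} (hv : v ∈ RG) : partProj b S v = v := by
  classical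
  refine b.ext_elem fun i => ?_
  rw [repr_partProj]
  split_ifs with h
  · rfl
  · exact ((mem_iff_repr_eq_zero hS).mp hv i h).symm

theorem partProj_mem {ι : Type} [Fintype ι] {b : Module.Basis ι K VF} {S : Set ι}
    (hS : Submodule.span K (b '' S) = RG) (v : VF) : partProj b S v ∈ RG := by
  classical
  refine (mem_iff_repr_eq_zero hS).mpr fun i hi => ?_
  rw [repr_partProj, if_neg hi]

theorem IsFrame.partProj_mem {x : P} {ι : Type} [Fintype ι] {b : Module.Basis ι K VF}
    (hb : IsFrame LF x b) (S : Set ι) {v : VF} (hv : v ∈ LF x) : partProj b S v ∈ LF x := by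
  classical
  refine (hb.mem_iff _).mpr fun i => ?_
  rw [repr_partProj]
  split_ifs
  · exact (hb.mem_iff v).mp hv i
  · exact zero_mem _

variable {VE : Type} [AddCommGroup VE] [Module K VE] [Module ℂ VE] [IsScalarTower ℂ K VE]
variable {LE : ∀ x, Submodule (O x) VE}

/-- At a point where a subsheaf differs from the subbundle it generates, a filtration of the fibre
of the subbundle and vanishing orders describing the subsheaf exist: the orders are the positive
elementary divisors. -/
theorem nonempty_dropData {x : P} (hA : IsPlace (O x))
    (hF : ∃ (ι : Type) (_ : Fintype ι) (b : Module.Basis ι K VF), IsFrame LF x b)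
    (hE : ∃ (ι : Type) (_ : Fintype ι) (b : Module.Basis ι K VE), IsFrame LE x b)
    (hle : LG x ≤ LF x) (hspan : Submodule.span K (LG x : Set VF) = RG)
    (hx : x ∈ dropPoints LF RG LG) : Nonempty (DropData LF LE RG LG x) := by
  classical
  obtain ⟨z, hz⟩ := hA.exists_coord
  obtain ⟨r, b, S, α, hb, hS, hG⟩ := exists_adaptedFrame hA hz hF hle hspan
  obtain ⟨κ, _, c₀, hc₀⟩ := hE
  let c := c₀.reindex (Fintype.equivFin κ)
  have hc : IsFrame LE x c := by rw [IsFrame, Module.Basis.range_reindex]; exact hc₀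
  let T : Finset ℕ := ((Finset.univ.filter (· ∈ S)).image α).filter (0 < ·)
  have hT : ∀ n, n ∈ T ↔ 0 < n ∧ ∃ i ∈ S, α i = n := by
    intro n
    simp only [T, Finset.mem_filter, Finset.mem_image, Finset.mem_univ, true_and]
    exact and_comm
  have hTne : T.card ≠ 0 := by
    intro h0
    rw [Finset.card_eq_zero] at h0
    obtain ⟨v, hv, hvR, hvG⟩ := hx
    refine hvG ((hG v).mpr ⟨fun i hi => ?_, (mem_iff_repr_eq_zero hS).mp hvR⟩)
    have : α i = 0 := by
      by_contra h
      have := (hT (α i)).mpr ⟨Nat.pos_of_ne_zero h, i, hi, rfl⟩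
      simp [h0] at this
    simpa [this] using (hb.mem_iff v).mp hv i
  obtain ⟨m, hm⟩ := Nat.exists_eq_succ_of_ne_zero hTne
  let β : Fin (m + 1) ↪o ℕ := T.orderEmbOfFin hm
  have hβT : ∀ j, β j ∈ T := fun j => T.orderEmbOfFin_mem hm j
  have hβ : ∀ n ∈ T, ∃ j, β j = n := fun n hn => by
    have : n ∈ Set.range β := by
      rw [Finset.range_orderEmbOfFin]
      exact hn
    exact this
  have hpos : ∀ j, 0 < β j := fun j => ((hT _).mp (hβT j)).1
  let M : Fin (m + 1) → Submodule ℂ (Fin r → ℂ) := fun j =>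
    ⨅ i ∈ {i | i ∉ S ∨ β j ≤ α i}, LinearMap.ker (LinearMap.proj (R := ℂ) (φ := fun _ => ℂ) i)
  have hM : ∀ j u, u ∈ M j ↔ ∀ i, i ∉ S ∨ β j ≤ α i → u i = 0 := by
    intro j u
    simp [M, Submodule.mem_iInf]
  refine ⟨{ z := z, isCoord := hz, rF := r, bF := b, frameF := hb, S := S, span_S := hS,
            rE := _, bE := c, frameE := hc, m := m, M := M, k := fun j => β j - 1,
            strictMono_M := ?_, M_lt := ?_, strictMono_k := ?_, mem_iff := ?_ }⟩
  · intro j j' hjj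
    have hlt : β j < β j' := β.strictMono hjj
    refine lt_of_le_of_ne (fun u hu => (hM _ _).mpr fun i hi => (hM _ _).mp hu i ?_) fun h => ?_
    · exact hi.imp_right fun h => hlt.le.trans h
    · obtain ⟨-, i, hi, hαi⟩ := (hT _).mp (hβT j)
      have h1 : Pi.single i (1 : ℂ) ∈ M j' := (hM _ _).mpr fun k hk => by
        refine Pi.single_eq_of_ne ?_ _
        rintro rfl
        rcases hk with hk | hk
        · exact hk hi
        · omega
      rw [← h] at h1
      simpa using (hM _ _).mp h1 i (Or.inr hαi.ge)
  · refine lt_of_le_of_ne (fun u hu => ?_) fun h => ?_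
    · simp only [Submodule.mem_iInf, LinearMap.mem_ker, LinearMap.proj_apply]
      exact fun i hi => (hM _ _).mp hu i (Or.inl hi)
    · obtain ⟨-, i, hi, hαi⟩ := (hT _).mp (hβT (Fin.last m))
      have h1 : Pi.single i (1 : ℂ) ∈ M (Fin.last m) := by
        rw [h]
        simp only [Submodule.mem_iInf, LinearMap.mem_ker, LinearMap.proj_apply]
        intro k hk
        refine Pi.single_eq_of_ne ?_ _
        rintro rfl
        exact hk hi
      simpa using (hM _ _).mp h1 i (Or.inr hαi.ge)
  · intro j j' hjj
    have hlt : β j < β j' := β.strictMono hjj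
    have := hpos j
    change β j - 1 < β j' - 1
    omega
  · intro g hg hgR
    have h0 := (mem_iff_repr_eq_zero hS).mp hgR
    rw [hG]
    constructor
    · rintro ⟨h1, -⟩ j l hl
      refine (hM _ _).mpr fun i hi => ?_
      by_cases hiS : i ∈ S
      · have hle : β j ≤ α i := hi.resolve_left fun h => h hiS
        refine hA.coeff_of_mem hz (hz.zpow_mul_mem_mono ?_ (h1 i hiS))
        have := hpos j
        have hl' : l ≤ β j - 1 := hl
        omega
      · exact hA.coeff_of_mem hz (by simp [h0 i hiS])
    · intro h1
      refine ⟨fun i hi => ?_, h0⟩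
      have hgi := (hb.mem_iff g).mp hg i
      rcases Nat.eq_zero_or_pos (α i) with h2 | h2
      · simpa [h2] using hgi
      · obtain ⟨j, hj⟩ := hβ _ ((hT (α i)).mpr ⟨h2, i, hi, rfl⟩)
        refine hA.mem_of_coeff_eq_zero hz hgi fun l hl => ?_
        exact (hM _ _).mp (h1 j l (by omega)) i (Or.inr hj.le)

end Adapted

end CurveLifting

namespace CurveLifting

/-! ### The operators of type `(⋆)` and their principal parts -/

section Operators

variable {K : Type} [Field K] [Algebra ℂ K] {P : Type} {O : P → Subalgebra ℂ K}
variable {V : Type} [AddCommGroup V] [Module K V] [Module ℂ V] [IsScalarTower ℂ K V]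
variable {L : ∀ x, Submodule (O x) V}
variable {ι : Type} [Fintype ι]

/-- The local sections with constant coordinates in a frame, as a linear function of the
coordinates. -/
def constSectionHom (b : Module.Basis ι K V) : (ι → ℂ) →ₗ[ℂ] V where
  toFun := constSection b
  map_add' w w' := by simp [constSection, add_smul, Finset.sum_add_distrib]
  map_smul' c w := by simp [constSection, Finset.smul_sum, mul_smul]

theorem repr_constSection (b : Module.Basis ι K V) (w : ι → ℂ) (i : ι) :
    b.repr (constSection b w) i = algebraMap ℂ K (w i) := by
  have h : constSection b w = ∑ i, algebraMap ℂ K (w i) • b i := by simp [constSection]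
  rw [h]
  exact congrFun (b.repr_sum_self fun i => algebraMap ℂ K (w i)) i

/-- The principal part `m! z ^ (-m - 1) w`, for a section `w` with constant coordinates. Contracting
with it and taking residues is the operator `∂ᵐ/∂zᵐ` at `⟨w⟩`. -/
def polarPart (L : ∀ x, Submodule (O x) V) (b : Module.Basis ι K V) (x : P) (z : K) (m : ℕ) :
    (ι → ℂ) →ₗ[ℂ] families L :=
  singleFamily L x ∘ₗ ((m.factorial : ℂ) • Module.toModuleEnd ℂ V (S := K) (z ^ (-(m : ℤ) - 1))) ∘ₗ
    constSectionHom b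

theorem polarPart_apply (b : Module.Basis ι K V) (x : P) (z : K) (m : ℕ) (w : ι → ℂ) :
    polarPart L b x z m w =
      singleFamily L x ((m.factorial : ℂ) • z ^ (-(m : ℤ) - 1) • constSection b w) := rfl

theorem IsCurve.dzOp_eq (hC : IsCurve O) (b : Module.Basis ι K V) {x : P} {z : K}
    (hz : IsCoord (O x) z) (m : ℕ) (w : ι → ℂ) :
    (dzOp b x z m w : CoSection L → ℂ) = serreForm L (polarPart L b x z m w) := by
  funext s
  have e : s.1 ((m.factorial : ℂ) • z ^ (-(m : ℤ) - 1) • constSection b w) =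
      (m.factorial : ℂ) • z ^ (-(m : ℤ) - 1) • s.1 (constSection b w) := by
    rw [LinearMap.map_smul_of_tower, map_smul]
  rw [polarPart_apply, hC.serreForm_single, dzOp,
    (hC.place x).diffCoeff_eq hC.differentials hz, e, map_smul _ (m.factorial : ℂ),
    smul_eq_mul]

/-- The operator `∂ᵐ/∂zᵐ` is linear in the point `v`, so its derivative in the direction `d` is the
same operator at `d`. -/
theorem IsCurve.tangentDzOp_eq (hC : IsCurve O) (b : Module.Basis ι K V) {x : P} {z : K}
    (hz : IsCoord (O x) z) (m : ℕ) (v d : ι → ℂ) :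
    (tangentDzOp b x z m v d : CoSection L → ℂ) = serreForm L (polarPart L b x z m d) := by
  funext s
  simp only [tangentDzOp, hC.dzOp_eq b hz, ← hC.serreHom_apply, map_add, map_smul, smul_eq_mul]
  have h : HasDerivAt (fun t : ℂ => hC.serreHom s (polarPart L b x z m v) +
      t * hC.serreHom s (polarPart L b x z m d)) (1 * hC.serreHom s (polarPart L b x z m d)) 0 :=
    ((hasDerivAt_id' (0 : ℂ)).mul_const _).const_add _
  rw [h.deriv, one_mul]

/-- Classes in the first cohomology are determined by their pairing with the sections of the dual
bundle twisted by the canonical bundle. -/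
theorem IsCurve.mk_eq_of_serreForm_eq (hC : IsCurve O) (hL : IsBundle L) {p q : families L}
    (h : serreForm L p = serreForm L q) : H1.mk L p = H1.mk L q := by
  refine (Module.forall_dual_apply_eq_zero_iff ℂ (H1.mk L p - H1.mk L q)).mp (fun l => ?_) |>
    sub_eq_zero.mp
  obtain ⟨s, hs⟩ := hC.serre_duality hL l
  rw [map_sub, hs, hs, h, sub_self]

/-- A class given by an operator of type `(⋆)` is in any subspace that contains the classes of the
polar parts at the points of `Λ`. -/
theorem IsCurve.mk_mem_of_serreForm_mem_starForms (hC : IsCurve O) (hL : IsBundle L)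
    (b : Module.Basis ι K V) {x : P} {z : K} (hz : IsCoord (O x) z) {Λ : Submodule ℂ (ι → ℂ)}
    {k : ℕ} {v : ι → ℂ} (hv : v ∈ Λ) {p : families L}
    (hp : serreForm L p ∈ starForms b x z Λ k v) {T : Submodule ℂ (H1 L)}
    (hT : ∀ m < k, ∀ w ∈ Λ, H1.mk L (polarPart L b x z m w) ∈ T) : H1.mk L p ∈ T := by
  let Φ : families L →ₗ[ℂ] (CoSection L → ℂ) := LinearMap.pi fun s => hC.serreHom s
  have hΦ : ∀ q, Φ q = serreForm L q := fun q => rfl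
  have hle : starForms b x z Λ k v ≤ (T.comap (principal L).mkQ).map Φ := by
    rw [starForms, Submodule.span_le]
    rintro _ (⟨m, hm, rfl⟩ | ⟨m, hm, d, hd, rfl⟩)
    · rw [hC.dzOp_eq b hz]
      exact ⟨_, hT m hm v hv, rfl⟩
    · rw [hC.tangentDzOp_eq b hz]
      exact ⟨_, hT m hm d hd, rfl⟩
  obtain ⟨q, hq, hqp⟩ := hle hp
  rw [hC.mk_eq_of_serreForm_eq hL (hqp.symm.trans (hΦ q) : serreForm L p = serreForm L q)]
  exact hq

theorem IsCurve.serreForm_polarPart_mem_starForms (hC : IsCurve O)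
    (b : Module.Basis ι K V) {x : P} {z : K} (hz : IsCoord (O x) z) (Λ : Submodule ℂ (ι → ℂ))
    {k m : ℕ} (hm : m < k) (w : ι → ℂ) :
    serreForm L (polarPart L b x z m w) ∈ starForms b x z Λ k w := by
  rw [← hC.dzOp_eq b hz]
  exact Submodule.subset_span (Or.inl ⟨m, hm, rfl⟩)

/-- The expansion of a rational section in a frame, up to regular sections. -/
theorem IsFrame.sub_sum_polar_mem {x : P} (hA : IsPlace (O x)) {z : K} (hz : IsCoord (O x) z)
    {b : Module.Basis ι K V} (hb : IsFrame L x b) {N : ℕ} {v : V} (hv : z ^ (N : ℤ) • v ∈ L x) :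
    v - ∑ m ∈ Finset.range N, z ^ (-(m : ℤ) - 1) •
      constSection b (fun i => coeff (O x) z (-(m : ℤ) - 1) (b.repr v i)) ∈ L x := by
  rw [hb.mem_iff] at hv ⊢
  intro i
  have h1 : z ^ (N : ℤ) * b.repr v i ∈ O x := by simpa using hv i
  obtain ⟨a, ha⟩ := hA.exists_principalPart hz N h1
  have hcoeff : ∀ m < N, coeff (O x) z (-(m : ℤ) - 1) (b.repr v i) = a m := by
    intro m hm
    have e1 : ∀ f, coeff (O x) z (-(m : ℤ) - 1) f = hA.coeffHom hz (-(m : ℤ) - 1) f := fun _ => rfl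
    have e2 : coeff (O x) z (-(m : ℤ) - 1) (b.repr v i -
        ∑ i ∈ Finset.range N, algebraMap ℂ K (a i) * z ^ (-(i : ℤ) - 1)) = 0 := by
      refine hA.coeff_of_mem hz ?_
      exact (O x).mul_mem (hz.zpow_mem (by omega)) ha
    have e3 : ∀ k, k ≠ m → coeff (O x) z (-(m : ℤ) - 1) (algebraMap ℂ K (a k) * z ^ (-(k : ℤ) - 1))
        = 0 := by
      intro k hk
      refine hA.coeff_eq hz ⟨if k < m then 0 else Finsupp.single (-(k : ℤ) - 1) (a k), ?_, ?_,
        if k < m then algebraMap ℂ K (a k) * z ^ ((m : ℤ) - k - 1) else 0, ?_, ?_⟩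
      · intro j hj
        split_ifs with h
        · rfl
        · rw [Finsupp.single_apply, if_neg (by omega)]
      · split_ifs with h
        · rfl
        · rw [Finsupp.single_apply, if_neg (by omega)]
      · split_ifs with h
        · exact (O x).mul_mem ((O x).algebraMap_mem _) (hz.zpow_mem (by omega))
        · exact zero_mem _
      · split_ifs with h
        · rw [Finsupp.sum_zero_index, sub_zero, mul_left_comm, ← zpow_add₀ hz.ne_zero]
          congr 2
          ring
        · simp
    rw [e1, map_sub, map_sum, Finset.sum_eq_single m (fun k _ hk => (e1 _).symm.trans (e3 k hk))
      (fun h => absurd (Finset.mem_range.mpr hm) h), ← e1, ← e1,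
      hA.coeff_eq hz (HasCoeff.monomial _ (a m)), sub_eq_zero] at e2
    exact e2
  rw [map_sub, map_sum, Finsupp.sub_apply, Finsupp.finsetSum_apply]
  convert ha using 2
  refine Finset.sum_congr rfl fun m hm => ?_
  rw [map_smul, Finsupp.smul_apply, repr_constSection, hcoeff m (Finset.mem_range.mp hm),
    smul_eq_mul, mul_comm]

end Operators

end CurveLifting

set_option linter.unusedSectionVars false
namespace CurveLifting

/-! ### The classes killed by a subsheaf are spanned by the locus -/

section Locus

variable {K : Type} [Field K] [Algebra ℂ K] {P : Type} {O : P → Subalgebra ℂ K}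
variable {VF : Type} [AddCommGroup VF] [Module K VF] [Module ℂ VF] [IsScalarTower ℂ K VF]
variable {VE : Type} [AddCommGroup VE] [Module K VE] [Module ℂ VE] [IsScalarTower ℂ K VE]
variable (LF : ∀ x, Submodule (O x) VF) (LE : ∀ x, Submodule (O x) VE)
variable (RG : Submodule K VF) (LG : ∀ x, Submodule (O x) VF)

/-- The classes in `H¹(X, Hom(F, E))` that have a representative with values in the homomorphisms
that are regular on the subsheaf `G`, i.e. the classes that become trivial in `H¹(X, Hom(G, E))`. -/
def liftable : Submodule ℂ (H1 (homStalk LF LE)) where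
  carrier := {c | ∃ p : families (homStalk LF LE), H1.mk _ p = c ∧ ∀ x, ∀ g ∈ LG x, p.1 x g ∈ LE x}
  add_mem' := by
    rintro _ _ ⟨p, rfl, hp⟩ ⟨q, rfl, hq⟩
    exact ⟨p + q, rfl, fun x g hg => add_mem (hp x g hg) (hq x g hg)⟩
  zero_mem' := ⟨0, rfl, fun x g _ => zero_mem _⟩
  smul_mem' := by
    rintro c _ ⟨p, rfl, hp⟩
    exact ⟨c • p, rfl, fun x g hg => stalk_smul LE x c (hp x g hg)⟩

variable {LF LE RG LG}

theorem mk_singleFamily_mem_liftable {x : P} {φ : VF →ₗ[K] VE} (h : ∀ g ∈ LG x, φ g ∈ LE x) :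
    H1.mk _ (singleFamily (homStalk LF LE) x φ) ∈ liftable LF LE LG := by
  refine ⟨_, rfl, fun y g hg => ?_⟩
  by_cases hy : y = x
  · subst hy
    rw [singleFamily_same]
    exact h g hg
  · rw [singleFamily_of_ne _ hy]
    exact zero_mem _

theorem VanishesAt.inv_smul_mem {V : Type} [AddCommGroup V] [Module K V] [Module ℂ V]
    [IsScalarTower ℂ K V] {L : ∀ x, Submodule (O x) V} {x : P} {v : V} (h : VanishesAt L x v)
    {z : K} (hz : IsCoord (O x) z) : z⁻¹ • v ∈ L x := by
  obtain ⟨z', hz', u, hu, rfl⟩ := h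
  obtain ⟨g, hg, e⟩ := (hz.nonunit_iff hz'.mem).mp (Or.inl hz'.inv_notMem)
  rw [e, smul_smul, ← mul_assoc, inv_mul_cancel₀ hz.ne_zero, one_mul]
  exact smul_mem_stalk hg hu

theorem mk_singleFamily_eq_zero {V : Type} [AddCommGroup V] [Module K V] [Module ℂ V]
    [IsScalarTower ℂ K V] {L : ∀ x, Submodule (O x) V} {x : P} {v : V} (h : v ∈ L x) :
    H1.mk L (singleFamily L x v) = 0 := by
  refine (H1.mk_eq_zero_iff _).mpr ⟨0, fun y => ?_⟩
  rw [sub_zero]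
  by_cases hy : y = x
  · subst hy
    rwa [singleFamily_same]
  · rw [singleFamily_of_ne _ hy]
    exact zero_mem _

/-- The vectors of the points of the locus. -/
def locusVectors (D : ∀ x ∈ dropPoints LF RG LG, DropData LF LE RG LG x) :
    Set (H1 (homStalk LF LE)) :=
  {v | ∃ h : v ≠ 0, Projectivization.mk ℂ v h ∈ locus LF LE RG LG D}

theorem repr_frame_apply {x : P} (D : DropData LF LE RG LG x) (φ : VF →ₗ[K] VE) (v : VF)
    (i : Fin D.rE) :
    D.bE.repr (φ v) i = ∑ l, D.frame.repr φ (i, l) * D.bF.repr v l := by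
  conv_lhs => rw [← D.bF.sum_repr v]
  rw [map_sum, map_sum, Finsupp.finsetSum_apply]
  refine Finset.sum_congr rfl fun l _ => ?_
  rw [map_smul, map_smul, Finsupp.smul_apply, DropData.frame, linearMap_repr, smul_eq_mul, mul_comm]

theorem DropData.isFrame {x : P} (D : DropData LF LE RG LG x) :
    IsFrame (homStalk LF LE) x D.frame := D.frameF.hom D.frameE

/-- Maps with constant coordinates in `N j` can be divided by a power of the coordinate and remain
regular on the subsheaf. -/
theorem DropData.zpow_smul_constSection_mem {x : P} (hA : IsPlace (O x))
    (D : DropData LF LE RG LG x) (hle : LG x ≤ LF x) (hR : (LG x : Set VF) ⊆ RG)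
    {j : Fin (D.m + 1)} {w : Fin D.rE × Fin D.rF → ℂ} (hw : w ∈ D.N j) {m : ℕ} (hm : m ≤ D.k j)
    {g : VF} (hg : g ∈ LG x) :
    (D.z ^ (-(m : ℤ) - 1) • constSection D.frame w) g ∈ LE x := by
  have hz := D.isCoord
  have hgF := (D.frameF.mem_iff g).mp (hle hg)
  refine (D.frameE.mem_iff _).mpr fun i => ?_
  rw [LinearMap.smul_apply, map_smul, Finsupp.smul_apply, smul_eq_mul, repr_frame_apply]
  simp only [repr_constSection]
  refine hz.zpow_mul_mem_mono (m := -((D.k j + 1 : ℕ) : ℤ)) (by push_cast; omega)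
    (hA.mem_of_coeff_eq_zero hz ?_ fun l hl => ?_)
  · exact sum_mem fun l _ => (O x).mul_mem ((O x).algebraMap_mem _) (hgF l)
  · change hA.coeffHom hz l _ = 0
    simp only [map_sum, ← Algebra.smul_def, map_smul, smul_eq_mul]
    exact hw _ ((D.mem_iff g (hle hg) (hR hg)).mp hg j l (by omega)) i

variable (hC : IsCurve O) (hF : IsBundle LF) (hE : IsBundle LE)
variable (hle : ∀ x, LG x ≤ LF x) (hspan : ∀ x, Submodule.span K (LG x : Set VF) = RG)
variable (D : ∀ x ∈ dropPoints LF RG LG, DropData LF LE RG LG x)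

include hC hF hE hle hspan in
theorem locusVectors_subset_liftable :
    locusVectors D ⊆ liftable LF LE LG := by
  have hR : ∀ x, (LG x : Set VF) ⊆ RG := fun x g hg => hspan x ▸ Submodule.subset_span hg
  rintro v ⟨hv, hQ⟩
  suffices ∃ c ∈ liftable LF LE LG, ∃ h : c ≠ 0,
      Projectivization.mk ℂ v hv = Projectivization.mk ℂ c h by
    obtain ⟨c, hc, h, e⟩ := this
    obtain ⟨a, rfl⟩ := (Projectivization.mk_eq_mk_iff' ℂ _ _ _ _).mp e
    exact Submodule.smul_mem _ _ hc
  rcases hQ with ⟨x, φ, -, -, hφ, z, hz, h, e⟩ | ⟨x, hx, j, w, hw, -, p, hp, h, e⟩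
  · refine ⟨_, ?_, h, e⟩
    rw [psi, poleFamily_eq]
    exact mk_singleFamily_mem_liftable fun g hg =>
      (hφ g (hle x hg) (hR x hg)).inv_smul_mem hz
  · refine ⟨_, ?_, h, e⟩
    have hA := hC.place x
    refine hC.mk_mem_of_serreForm_mem_starForms (hF.hom hE) _ (D x hx).isCoord hw hp
      fun m hm w hw => ?_
    rw [polarPart_apply]
    refine mk_singleFamily_mem_liftable fun g hg => ?_
    rw [LinearMap.smul_apply]
    exact stalk_smul LE x _ ((D x hx).zpow_smul_constSection_mem hA (hle x) (hR x) hw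
      (by omega) hg)

/-- The class of the principal part `φ / z`, for `φ` regular and zero on the subsheaf, is in the
span of the locus. -/
theorem psi_mem_span_locusVectors {x : P} {z : K} (hz : IsCoord (O x) z) {φ : VF →ₗ[K] VE}
    (hφ : φ ∈ homStalk LF LE x) (h0 : ∀ g ∈ RG, φ g = 0) :
    psi (homStalk LF LE) x z φ ∈ Submodule.span ℂ (locusVectors D) := by
  by_cases h : psi (homStalk LF LE) x z φ = 0
  · rw [h]
    exact zero_mem _
  · refine Submodule.subset_span ⟨h, Or.inl ⟨x, φ, hφ, fun hv => h ?_, fun g _ hg => ?_, z, hz, h,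
      rfl⟩⟩
    · rw [psi, poleFamily_eq]
      exact mk_singleFamily_eq_zero (hv.inv_smul_mem hz)
    · exact ⟨z, hz, 0, zero_mem _, by rw [h0 g hg, smul_zero]⟩

include hC in
theorem polarPart_mem_span_locusVectors {x : P} (hx : x ∈ dropPoints LF RG LG)
    {j : Fin ((D x hx).m + 1)} {m : ℕ} (hm : m ≤ (D x hx).k j)
    {w : Fin (D x hx).rE × Fin (D x hx).rF → ℂ} (hw : w ∈ (D x hx).N j) :
    H1.mk _ (polarPart (homStalk LF LE) (D x hx).frame x (D x hx).z m w) ∈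
      Submodule.span ℂ (locusVectors D) := by
  by_cases h : H1.mk _ (polarPart (homStalk LF LE) (D x hx).frame x (D x hx).z m w) = 0
  · rw [h]
    exact zero_mem _
  · refine Submodule.subset_span ⟨h, Or.inr ⟨x, hx, j, w, hw, ?_, _,
      hC.serreForm_polarPart_mem_starForms _ (D x hx).isCoord _ (by omega) w, h, rfl⟩⟩
    rintro rfl
    refine h ?_
    rw [polarPart_apply]
    refine mk_singleFamily_eq_zero ?_
    have h0 : constSection (D x hx).frame (0 : Fin (D x hx).rE × Fin (D x hx).rF → ℂ) = 0 := by
      simp [constSection]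
    rw [h0, smul_zero, smul_zero]
    exact zero_mem _

include hC hF hE in
/-- A section of the dual twisted by the canonical bundle which is orthogonal to the locus is zero
on the homomorphisms that vanish on the subsheaf. -/
theorem apply_eq_zero_of_forall_mem_locusVectors {s : CoSection (homStalk LF LE)}
    (hs : ∀ p, H1.mk _ p ∈ Submodule.span ℂ (locusVectors D) → serreForm _ p s = 0)
    {φ : VF →ₗ[K] VE} (h0 : ∀ g ∈ RG, φ g = 0) : s.1 φ = 0 := by
  by_contra hne
  have hfin := (hC.finite_zeros hne).union ((hF.hom hE).finite_notMem hC φ)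
  have := hC.infinite_points
  obtain ⟨y, hy⟩ := hfin.infinite_compl.nonempty
  simp only [Set.mem_compl_iff, Set.mem_union, Set.mem_ofPred_eq, not_or, not_not, not_forall]
    at hy
  obtain ⟨⟨f, hf, hres⟩, hφ⟩ := hy
  have hz := hC.isCoord y
  refine hres ?_
  have h1 := psi_mem_span_locusVectors D hz (smul_mem_stalk hf hφ) fun g hg => by
    rw [LinearMap.smul_apply, h0 g hg, smul_zero]
  rw [psi, poleFamily_eq] at h1
  have h2 := hs _ h1
  rwa [hC.serreForm_single, smul_smul, ← mul_assoc, inv_mul_cancel₀ hz.ne_zero, one_mul,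
    map_smul] at h2

/-- If `φ` is regular on the subsheaf, then the polar coefficients of `φ` composed with the
projection to the subsheaf kill the vectors `u` such that `z ^ m u` is a section of the subsheaf. -/
theorem DropData.sum_coeff_mul_eq_zero {x : P} (hA : IsPlace (O x))
    (D : DropData LF LE RG LG x) {φ : VF →ₗ[K] VE} (hφ : ∀ g ∈ LG x, φ g ∈ LE x) {m : ℕ}
    {u : Fin D.rF → ℂ} (huS : ∀ l ∉ D.S, u l = 0)
    (hu : ∀ j, m ≤ D.k j → u ∈ D.M j) (i : Fin D.rE) :
    ∑ l, coeff (O x) D.z (-(m : ℤ) - 1) (D.frame.repr φ (i, l)) * u l = 0 := by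
  have hz := D.isCoord
  have hrep : ∀ l, D.bF.repr (D.z ^ (m : ℤ) • constSection D.bF u) l =
      algebraMap ℂ K (u l) * D.z ^ (m : ℤ) := fun l => by
    rw [map_smul, Finsupp.smul_apply, repr_constSection, smul_eq_mul, mul_comm]
  have hcoeff : ∀ n : ℕ, ∀ l, coeff (O x) D.z n (algebraMap ℂ K (u l) * D.z ^ (m : ℤ)) =
      if n = m then u l else 0 := by
    intro n l
    split_ifs with h
    · subst h
      exact hA.coeff_eq hz (HasCoeff.monomial _ _)
    · have e : algebraMap ℂ K (u l) * D.z ^ (m : ℤ) =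
          D.z ^ (m : ℤ) * (algebraMap ℂ K (u l) * D.z ^ (0 : ℤ)) := by
        rw [zpow_zero, mul_one, mul_comm]
      rcases lt_or_gt_of_ne h with h | h
      · refine hA.coeff_of_mem hz ?_
        rw [mul_left_comm, ← zpow_add₀ hz.ne_zero]
        exact (O x).mul_mem ((O x).algebraMap_mem _) (hz.zpow_mem (by omega))
      · refine hA.coeff_eq hz ⟨Finsupp.single (m : ℤ) (u l), fun k hk => ?_, ?_, 0, zero_mem _, ?_⟩
        · rw [Finsupp.single_apply, if_neg (by omega)]
        · rw [Finsupp.single_apply, if_neg (by omega)]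
        · simp
  have hgF : D.z ^ (m : ℤ) • constSection D.bF u ∈ LF x := (D.frameF.mem_iff _).mpr fun l => by
    rw [hrep]
    exact (O x).mul_mem ((O x).algebraMap_mem _) (hz.zpow_mem (by omega))
  have hgR : D.z ^ (m : ℤ) • constSection D.bF u ∈ RG :=
    (mem_iff_repr_eq_zero D.span_S).mpr fun l hl => by rw [hrep, huS l hl, map_zero, zero_mul]
  have hgG : D.z ^ (m : ℤ) • constSection D.bF u ∈ LG x := by
    refine (D.mem_iff _ hgF hgR).mpr fun j n hn => ?_
    simp only [hrep, hcoeff]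
    by_cases h : n = m
    · simp only [if_pos h]
      exact hu j (h ▸ hn)
    · simp only [if_neg h]
      exact zero_mem (D.M j)
  have h1 := (D.frameE.mem_iff _).mp (hφ _ hgG) i
  rw [map_smul, map_smul, Finsupp.smul_apply, smul_eq_mul, repr_frame_apply] at h1
  have h2 : coeff (O x) D.z (-(m : ℤ) - 1) (∑ l, D.frame.repr φ (i, l) *
      D.bF.repr (constSection D.bF u) l) = 0 := hA.coeff_of_mem hz (by simpa using h1)
  change hA.coeffHom hz _ _ = 0 at h2
  simp only [repr_constSection, map_sum, mul_comm _ (algebraMap ℂ K _), ← Algebra.smul_def,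
    map_smul, smul_eq_mul] at h2
  rw [← h2]
  exact Finset.sum_congr rfl fun l _ => mul_comm _ _

include hC hF hE in
/-- At a point where `G ≠ Ḡ`, let `φ` be regular on `G` and zero on the frame vectors outside `Ḡ`.
Its polar coefficients are in the spaces `N j`, so that the residue of its contraction with a
section orthogonal to the locus is a combination of operators of type `(⋆)`, hence zero. -/
theorem residue_eq_zero_of_drop {s : CoSection (homStalk LF LE)}
    (hs : ∀ p, H1.mk _ p ∈ Submodule.span ℂ (locusVectors D) → serreForm _ p s = 0)
    {x : P} (hx : x ∈ dropPoints LF RG LG) {φ : VF →ₗ[K] VE} (hφ : ∀ g ∈ LG x, φ g ∈ LE x)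
    (hφS : ∀ l ∉ (D x hx).S, φ ((D x hx).bF l) = 0) :
    (hC.place x).res (s.1 φ) = 0 := by
  set d := D x hx with hd
  have hA := hC.place x
  have hz := d.isCoord
  obtain ⟨N, hN⟩ := (hF.hom hE).exists_zpow_smul_mem hA hz φ
  have h1 := hC.res_eq_zero_of_mem s (d.isFrame.sub_sum_polar_mem hA hz hN)
  rw [map_sub, map_sub, map_sum, map_sum, sub_eq_zero] at h1
  rw [h1]
  refine Finset.sum_eq_zero fun m _ => ?_
  set w : Fin d.rE × Fin d.rF → ℂ :=
    fun i => coeff (O x) d.z (-(m : ℤ) - 1) (d.frame.repr φ i) with hw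
  have hw0 : ∀ i, ∀ l ∉ d.S, w (i, l) = 0 := by
    intro i l hl
    refine hA.coeff_of_mem hz ?_
    rw [DropData.frame, linearMap_repr, hφS l hl]
    simp
  by_cases hj : ∃ j, m ≤ d.k j
  · -- the least `j` with `m ≤ k j` has `z ^ m M j` inside the subsheaf
    obtain ⟨j, hj, hmin⟩ : ∃ j, m ≤ d.k j ∧ ∀ j', m ≤ d.k j' → j ≤ j' := by
      classical
      have hne : (Finset.univ.filter fun j => m ≤ d.k j).Nonempty := by
        obtain ⟨j, hj⟩ := hj
        exact ⟨j, by simpa using hj⟩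
      refine ⟨_, by simpa using Finset.min'_mem _ hne, fun j' hj' => Finset.min'_le _ _ ?_⟩
      simpa using hj'
    have hwN : w ∈ d.N j := by
      intro u hu i
      refine d.sum_coeff_mul_eq_zero hA hφ (fun l hl => ?_)
        (fun j' hj' => d.strictMono_M.monotone (hmin j' hj') hu) i
      have h2 := d.M_lt.le (d.strictMono_M.monotone (Fin.le_last j) hu)
      simp only [Submodule.mem_iInf, LinearMap.mem_ker, LinearMap.proj_apply] at h2
      exact h2 l hl
    have h2 := hs _ (polarPart_mem_span_locusVectors hC D hx hj hwN)
    rw [polarPart_apply, hC.serreForm_single, LinearMap.map_smul_of_tower, map_smul,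
      smul_eq_zero] at h2
    exact h2.resolve_left (by exact_mod_cast m.factorial_ne_zero)
  · -- beyond all the `k j`, the coefficients vanish on the fibre of the subbundle
    push Not at hj
    have hw1 : ∀ i, ∀ l ∈ d.S, w (i, l) = 0 := by
      intro i l hl
      have h2 := d.sum_coeff_mul_eq_zero hA hφ (m := m) (u := Pi.single l 1)
        (fun l' hl' => Pi.single_eq_of_ne (by rintro rfl; exact hl' hl) _)
        (fun j h => absurd h (by have := hj j; omega)) i
      simpa [Pi.single_apply] using h2
    have hw2 : w = 0 := by
      funext ⟨i, l⟩
      by_cases hl : l ∈ d.S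
      exacts [hw1 i l hl, hw0 i l hl]
    rw [hw2]
    simp [constSection]

include hC hF hE hle hspan in
/-- A class becomes trivial on the subsheaf if and only if it is in the span of the locus. -/
theorem liftable_eq_span_locusVectors :
    liftable LF LE LG = Submodule.span ℂ (locusVectors D) := by
  refine le_antisymm ?_
    (Submodule.span_le.mpr (locusVectors_subset_liftable hC hF hE hle hspan D))
  rintro _ ⟨p, rfl, hp⟩
  by_contra hnot
  obtain ⟨l, hl, hker⟩ := Submodule.exists_le_ker_of_notMem hnot
  obtain ⟨s, hls⟩ := hC.serre_duality (hF.hom hE) l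
  refine hl ?_
  have hs : ∀ p, H1.mk _ p ∈ Submodule.span ℂ (locusVectors D) → serreForm _ p s = 0 :=
    fun q hq => by rw [← hls]; exact hker hq
  rw [hls, serreForm]
  refine finsum_eq_zero_of_forall_eq_zero fun x => ?_
  rw [(hC.place x).residue_eq hC.differentials]
  have hproj : ∀ e : VF →ₗ[K] VF, (∀ g ∈ RG, e g = g) →
      s.1 (p.1 x) = s.1 (p.1 x ∘ₗ e) := by
    intro e he
    rw [← sub_eq_zero, ← map_sub]
    refine apply_eq_zero_of_forall_mem_locusVectors hC hF hE D hs fun g hg => ?_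
    rw [LinearMap.sub_apply, LinearMap.comp_apply, he g hg, sub_self]
  by_cases hx : x ∈ dropPoints LF RG LG
  · have hS := (D x hx).span_S
    rw [hproj (partProj (D x hx).bF (D x hx).S) fun g hg => partProj_of_mem hS hg]
    refine residue_eq_zero_of_drop hC hF hE D hs hx (fun g hg => ?_) fun l hl => ?_
    · have hgR : g ∈ RG := hspan x ▸ Submodule.subset_span hg
      rw [LinearMap.comp_apply, partProj_of_mem hS hgR]
      exact hp x g hg
    · classical
      have : partProj (D x hx).bF (D x hx).S ((D x hx).bF l) = 0 := by
        rw [partProj, Module.Basis.constr_basis, if_neg hl]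
      rw [LinearMap.comp_apply, this, map_zero]
  · have hA := hC.place x
    obtain ⟨r, b, S, α, hb, hS, -⟩ :=
      exists_adaptedFrame hA (hC.isCoord x) (hF.frame x) (hle x) (hspan x)
    rw [hproj (partProj b S) fun g hg => partProj_of_mem hS hg]
    refine hC.res_eq_zero_of_mem s fun v hv => ?_
    refine hp x _ ?_
    by_contra h
    exact hx ⟨_, hb.partProj_mem S hv, partProj_mem hS v, h⟩

include hC hF hE hle hspan in
/-- The projective form of the equality of `liftable` with the span of the locus. -/
theorem mem_span_locus_iff {c : H1 (homStalk LF LE)} (hc : c ≠ 0) :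
    Projectivization.mk ℂ c hc ∈ Projectivization.Subspace.span (locus LF LE RG LG D) ↔
      ∃ p : families (homStalk LF LE), H1.mk _ p = c ∧ ∀ x, ∀ g ∈ LG x, p.1 x g ∈ LE x := by
  change _ ↔ c ∈ liftable LF LE LG
  rw [liftable_eq_span_locusVectors hC hF hE hle hspan D]
  constructor
  · intro h
    rw [← Submodule.mk_mem_projectivization_iff _ hc]
    refine Projectivization.Subspace.span_le_subspace_iff.mpr (fun Q hQ => ?_) h
    induction Q using Projectivization.ind with
    | h v hv =>
      exact (Submodule.mk_mem_projectivization_iff _ hv).mpr (Submodule.subset_span ⟨hv, hQ⟩)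
  · intro h
    rw [← Projectivization.Subspace.mem_submodule_iff _ hc]
    refine Submodule.span_le.mpr (fun v hv => ?_) h
    obtain ⟨hv, hQ⟩ := hv
    exact (Projectivization.Subspace.mem_submodule_iff _ hv).mpr
      (Projectivization.Subspace.subset_span _ hQ)

end Locus

end CurveLifting

set_option linter.unusedSectionVars false
namespace CurveLifting

/-! ### Local rings of smooth affine curves -/

section LocalRing

open IsLocalRing

/-- If the residue field of a Noetherian local `ℂ`-algebra is `ℂ` and its differentials are
generated by one element, then its maximal ideal is principal: `f ↦ f - f(x)` is a derivation with
values in the cotangent space, so the cotangent space is a quotient of the differentials. -/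
theorem isPrincipal_maximalIdeal {R : Type} [CommRing R] [IsLocalRing R] [IsNoetherianRing R]
    [Algebra ℂ R] (hres : ∀ f : R, ∃ c : ℂ, f - algebraMap ℂ R c ∈ maximalIdeal R) {ω : Ω[R⁄ℂ]}
    (hω : Submodule.span R {ω} = ⊤) : (maximalIdeal R).IsPrincipal := by
  choose c hc using hres
  have huniq : ∀ a b : ℂ, algebraMap ℂ R a - algebraMap ℂ R b ∈ maximalIdeal R → a = b := by
    intro a b h
    by_contra hne
    rw [← map_sub, mem_maximalIdeal, mem_nonunits_iff] at h
    exact h ((IsUnit.mk0 _ (sub_ne_zero.mpr hne)).map _)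
  have hadd : ∀ f g, c (f + g) = c f + c g := fun f g => huniq _ _ (by
    have := sub_mem (add_mem (hc f) (hc g)) (hc (f + g))
    convert this using 1
    rw [map_add]
    ring)
  have hmul : ∀ f g, c (f * g) = c f * c g := fun f g => huniq _ _ (by
    have h1 := add_mem (Ideal.mul_mem_left _ f (hc g))
      (Ideal.mul_mem_left _ (algebraMap ℂ R (c g)) (hc f))
    have := sub_mem h1 (hc (f * g))
    convert this using 1
    rw [map_mul]
    ring)
  have halg : ∀ a, c (algebraMap ℂ R a) = a := fun a => huniq _ _ (by
    have := neg_mem (hc (algebraMap ℂ R a))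
    convert this using 1
    ring)
  let m : R → maximalIdeal R := fun f => ⟨_, hc f⟩
  let D : Derivation ℂ R (CotangentSpace R) := Derivation.mk'
    { toFun := fun f => (maximalIdeal R).toCotangent (m f)
      map_add' := fun f g => by
        rw [← map_add]
        congr 1
        refine Subtype.ext ?_
        simp only [m, hadd, map_add, Submodule.coe_add]
        ring
      map_smul' := fun a f => by
        rw [RingHom.id_apply, ← algebraMap_smul R a ((maximalIdeal R).toCotangent (m f)),
          ← map_smul]
        congr 1
        refine Subtype.ext ?_
        simp only [m, Algebra.smul_def, hmul, halg, map_mul, Submodule.coe_smul,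
          Algebra.algebraMap_self, RingHom.id_apply]
        ring } (fun f g => by
      change (maximalIdeal R).toCotangent (m (f * g)) = f • (maximalIdeal R).toCotangent (m g) +
        g • (maximalIdeal R).toCotangent (m f)
      rw [← map_smul, ← map_smul, ← map_add, Ideal.toCotangent_eq]
      have := neg_mem (Ideal.mul_mem_mul (hc f) (hc g))
      rw [pow_two]
      convert this using 1
      simp only [m, hmul, map_mul, Submodule.coe_add, Submodule.coe_smul, smul_eq_mul]
      ring)
  have hsurj : ∀ v : CotangentSpace R, ∃ f, D f = v := by
    intro v
    obtain ⟨f, rfl⟩ := (maximalIdeal R).toCotangent_surjective v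
    refine ⟨f.1, ?_⟩
    change (maximalIdeal R).toCotangent (m f.1) = _
    have h0 : c f.1 = 0 := huniq _ _ (by
      have := sub_mem f.2 (hc f.1)
      convert this using 1
      rw [map_zero]
      ring)
    congr 1
    refine Subtype.ext ?_
    simp [m, h0]
  rw [← finrank_cotangentSpace_le_one_iff, finrank_le_one_iff]
  refine ⟨D.liftKaehlerDifferential ω, fun v => ?_⟩
  obtain ⟨f, rfl⟩ := hsurj v
  obtain ⟨r, hr⟩ := Submodule.mem_span_singleton.mp
    (hω ▸ Submodule.mem_top : KaehlerDifferential.D ℂ R f ∈ Submodule.span R {ω})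
  refine ⟨algebraMap R _ r, ?_⟩
  rw [algebraMap_smul, ← map_smul, hr, Derivation.liftKaehlerDifferential_comp_D]

variable {K : Type} [Field K] [Algebra ℂ K]

theorem isPlace_of_isDiscreteValuationRing {R : Type} [CommRing R] [IsDomain R]
    [IsDiscreteValuationRing R] [Algebra R K] [IsFractionRing R K] {A : Subalgebra ℂ K}
    (hA : ∀ f, f ∈ A ↔ ∃ r, algebraMap R K r = f)
    (hres : ∀ r : R, ∃ c : ℂ, ∃ s ∈ maximalIdeal R, algebraMap R K r - algebraMap ℂ K c =
      algebraMap R K s) : IsPlace A := by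
  have hinj := IsFractionRing.injective R K
  have hunit : ∀ r : R, IsUnit r ↔ ∃ g ∈ A, algebraMap R K r * g = 1 := by
    intro r
    constructor
    · rintro ⟨u, rfl⟩
      exact ⟨_, (hA _).mpr ⟨(u⁻¹ : Rˣ), rfl⟩, by rw [← map_mul, Units.mul_inv, map_one]⟩
    · rintro ⟨g, hg, h⟩
      obtain ⟨s, rfl⟩ := (hA _).mp hg
      rw [← map_mul, ← map_one (algebraMap R K)] at h
      exact IsUnit.of_mul_eq_one s (hinj h)
  obtain ⟨ϖ, hϖ⟩ := IsDiscreteValuationRing.exists_irreducible R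
  have hmax := (IsDiscreteValuationRing.irreducible_iff_uniformizer ϖ).mp hϖ
  have hcoord : IsCoord A (algebraMap R K ϖ) := by
    refine ⟨(hA _).mpr ⟨_, rfl⟩, fun h => hϖ.ne_zero (hinj (by rw [h, map_zero])), fun f hf => ?_⟩
    obtain ⟨r, rfl⟩ := (hA _).mp hf
    rw [← hunit, ← mem_nonunits_iff, ← mem_maximalIdeal, hmax, Ideal.mem_span_singleton]
    constructor
    · rintro ⟨s, rfl⟩
      exact ⟨_, (hA _).mpr ⟨s, rfl⟩, map_mul _ _ _⟩
    · rintro ⟨g, hg, h⟩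
      obtain ⟨s, rfl⟩ := (hA _).mp hg
      exact ⟨s, hinj (by rw [h, map_mul])⟩
  refine ⟨⟨_, hcoord⟩, fun z hz f hf => ?_, fun f hf => ?_⟩
  · obtain ⟨t, rfl⟩ := (hA _).mp hz.1
    have ht : Irreducible t := by
      rw [IsDiscreteValuationRing.irreducible_iff_uniformizer]
      ext r
      rw [mem_maximalIdeal, mem_nonunits_iff, hunit, hz.2.2 _ ((hA _).mpr ⟨r, rfl⟩),
        Ideal.mem_span_singleton]
      constructor
      · rintro ⟨g, hg, h⟩
        obtain ⟨s, rfl⟩ := (hA _).mp hg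
        exact ⟨s, hinj (by rw [h, map_mul])⟩
      · rintro ⟨s, rfl⟩
        exact ⟨_, (hA _).mpr ⟨s, rfl⟩, map_mul _ _ _⟩
    obtain ⟨a, b, hb, rfl⟩ := IsFractionRing.div_surjective (A := R) f
    have ha0 : a ≠ 0 := by
      rintro rfl
      simp at hf
    have hb0 : b ≠ 0 := nonZeroDivisors.ne_zero hb
    obtain ⟨n, u, rfl⟩ := IsDiscreteValuationRing.eq_unit_mul_pow_irreducible ha0 ht
    obtain ⟨k, v, rfl⟩ := IsDiscreteValuationRing.eq_unit_mul_pow_irreducible hb0 ht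
    refine ⟨(n : ℤ) - k, algebraMap R K (u * v⁻¹ : Rˣ), (hA _).mpr ⟨_, rfl⟩, ?_, ?_⟩
    · rw [← map_units_inv]
      exact (hA _).mpr ⟨_, rfl⟩
    · have hv : algebraMap R K (v : R) ≠ 0 := fun h => v.ne_zero (hinj (by rw [h, map_zero]))
      have hz0 := hz.2.1
      have hvi : algebraMap R K ((v⁻¹ : Rˣ) : R) = (algebraMap R K v)⁻¹ := map_units_inv _ _
      rw [Units.val_mul, map_mul, map_mul, map_mul, map_pow, map_pow, zpow_sub₀ hz0, hvi]
      simp only [zpow_natCast]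
      field_simp
  · obtain ⟨r, rfl⟩ := (hA _).mp hf
    obtain ⟨c, s, hs, e⟩ := hres r
    refine ⟨c, fun g hg h => ?_⟩
    rw [e] at h
    exact (mem_nonunits_iff.mp ((mem_maximalIdeal s).mp hs)) ((hunit s).mpr ⟨g, hg, h⟩)

end LocalRing

/-! ### Smooth affine charts -/

section Chart

variable {K : Type} [Field K] [Algebra ℂ K]
variable {B : Type} [CommRing B] [IsDomain B] [Algebra ℂ B]

theorem exists_span_kaehlerDifferential_eq_top [Algebra.IsStandardSmoothOfRelativeDimension 1 ℂ B] :
    ∃ ω : Ω[B⁄ℂ], Submodule.span B {ω} = ⊤ ∧ ∀ b : B, b • ω = 0 → b = 0 := by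
  have := Algebra.IsStandardSmoothOfRelativeDimension.isStandardSmooth 1 (R := ℂ) (S := B)
  have h1 : Module.finrank B Ω[B⁄ℂ] = 1 := by
    rw [Module.finrank, Algebra.IsStandardSmoothOfRelativeDimension.rank_kaehlerDifferential 1]
    simp
  let b : Module.Basis Unit B Ω[B⁄ℂ] := Module.basisUnique Unit h1
  refine ⟨b (), ?_, fun c hc => ?_⟩
  · rw [← b.span_eq, Set.range_unique]
  · simpa using congrArg (fun v => b.repr v ()) hc

theorem exists_span_kaehlerDifferential_localization
    [Algebra.IsStandardSmoothOfRelativeDimension 1 ℂ B] {R : Type} [CommRing R] [Algebra ℂ R]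
    [Algebra B R] [IsScalarTower ℂ B R] (M : Submonoid B) [IsLocalization M R] (hM : 0 ∉ M) :
    ∃ ω : Ω[R⁄ℂ], Submodule.span R {ω} = ⊤ ∧ ω ≠ 0 := by
  obtain ⟨ω, hω, h0⟩ := exists_span_kaehlerDifferential_eq_top (B := B)
  refine ⟨KaehlerDifferential.map ℂ ℂ B R ω, ?_, fun h => ?_⟩
  · rw [← Set.image_singleton]
    have := span_eq_top_of_isLocalizedModule R M (KaehlerDifferential.map ℂ ℂ B R) (v := {ω}) hω
    exact this
  · obtain ⟨c, hc⟩ := (IsLocalizedModule.eq_zero_iff M (KaehlerDifferential.map ℂ ℂ B R)).mp h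
    exact hM (h0 c hc ▸ c.2)

theorem differentialsLine_of_span {ω : Ω[K⁄ℂ]} (hω : Submodule.span K {ω} = ⊤) :
    DifferentialsLine K := by
  intro α η hη
  obtain ⟨f, rfl⟩ := Submodule.mem_span_singleton.mp (hω ▸ Submodule.mem_top : η ∈ _)
  obtain ⟨g, rfl⟩ := Submodule.mem_span_singleton.mp (hω ▸ Submodule.mem_top : α ∈ _)
  have hf : f ≠ 0 := by
    rintro rfl
    simp at hη
  exact ⟨g * f⁻¹, by rw [smul_smul, mul_assoc, inv_mul_cancel₀ hf, mul_one]⟩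

open IsLocalRing in
/-- The Nullstellensatz: the residue field at a closed point is `ℂ`. -/
theorem exists_sub_mem_maximalIdeal [Algebra.FiniteType ℂ B] (p : Ideal B) [hp : p.IsMaximal]
    {R : Type} [CommRing R] [IsLocalRing R] [Algebra ℂ R] [Algebra B R] [IsScalarTower ℂ B R]
    [IsLocalization.AtPrime R p] (r : R) : ∃ c : ℂ, r - algebraMap ℂ R c ∈ maximalIdeal R := by
  let _ := Ideal.Quotient.field p
  have hfin : Module.Finite ℂ (B ⧸ p) := finite_of_finite_type_of_isJacobsonRing ℂ (B ⧸ p)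
  have hbij := IsAlgClosed.algebraMap_bijective_of_isIntegral (k := ℂ) (K := B ⧸ p)
  have hval : ∀ b : B, ∃ c : ℂ, b - algebraMap ℂ B c ∈ p := by
    intro b
    obtain ⟨c, hc⟩ := hbij.2 (Ideal.Quotient.mk p b)
    refine ⟨c, Ideal.Quotient.eq.mp ?_⟩
    rw [← hc]
    rfl
  obtain ⟨b, s, rfl⟩ := IsLocalization.exists_mk'_eq p.primeCompl r
  obtain ⟨cb, hcb⟩ := hval b
  obtain ⟨cs, hcs⟩ := hval s
  have hcs0 : cs ≠ 0 := by
    rintro rfl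
    exact s.2 (by simpa using hcs)
  refine ⟨cb / cs, ?_⟩
  have h1 : algebraMap B R (b - algebraMap ℂ B (cb / cs) * s) ∈ maximalIdeal R := by
    refine (IsLocalization.AtPrime.to_map_mem_maximal_iff R p _).mpr ?_
    have := sub_mem hcb (p.mul_mem_left (algebraMap ℂ B (cb / cs)) hcs)
    convert this using 1
    rw [mul_sub, ← map_mul, div_mul_cancel₀ cb hcs0]
    ring
  have h2 : algebraMap B R s * (IsLocalization.mk' R b s - algebraMap ℂ R (cb / cs)) =
      algebraMap B R (b - algebraMap ℂ B (cb / cs) * s) := by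
    rw [mul_sub, IsLocalization.mk'_spec', map_sub, map_mul, ← IsScalarTower.algebraMap_apply]
    ring
  rw [← h2] at h1
  exact (Ideal.unit_mul_mem_iff_mem _ (IsLocalization.map_units R s)).mp h1

open IsLocalRing in
/-- The local ring of a smooth affine curve at a closed point is a place of its function field. -/
theorem isPlace_of_chart [Algebra.FiniteType ℂ B]
    [Algebra.IsStandardSmoothOfRelativeDimension 1 ℂ B] (p : Ideal B) [hp : p.IsMaximal]
    {R : Type} [CommRing R] [IsDomain R] [IsLocalRing R] [Algebra ℂ R] [Algebra B R]
    [IsScalarTower ℂ B R] [IsLocalization.AtPrime R p] [Algebra R K] [IsFractionRing R K]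
    [IsScalarTower ℂ R K] {A : Subalgebra ℂ K}
    (hA : ∀ f, f ∈ A ↔ ∃ r, algebraMap R K r = f) :
    IsDiscreteValuationRing R ∧ IsPlace A := by
  have hB : IsNoetherianRing B := Algebra.FiniteType.isNoetherianRing ℂ B
  have hR : IsNoetherianRing R := IsLocalization.isNoetherianRing p.primeCompl R hB
  obtain ⟨ω, hω, hω0⟩ := exists_span_kaehlerDifferential_localization (R := R) p.primeCompl
    (fun h => h p.zero_mem)
  have hres := exists_sub_mem_maximalIdeal p (R := R)
  have hprin := isPrincipal_maximalIdeal hres hω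
  have hfield : ¬ IsField R := by
    intro h
    have hbot := isField_iff_maximalIdeal_eq.mp h
    refine hω0 ?_
    have hD : ∀ f : R, KaehlerDifferential.D ℂ R f = 0 := by
      intro f
      obtain ⟨c, hc⟩ := hres f
      rw [hbot, Ideal.mem_bot, sub_eq_zero] at hc
      rw [hc, Derivation.map_algebraMap]
    have htop : (⊤ : Submodule R Ω[R⁄ℂ]) = ⊥ := by
      rw [← KaehlerDifferential.span_range_derivation, Submodule.span_eq_bot]
      rintro _ ⟨f, rfl⟩
      exact hD f
    exact (Submodule.mem_bot R).mp (htop ▸ Submodule.mem_top)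
  have hdvr : IsDiscreteValuationRing R := ((IsDiscreteValuationRing.TFAE R hfield).out 0 4).mpr hprin
  refine ⟨hdvr, isPlace_of_isDiscreteValuationRing hA fun r => ?_⟩
  obtain ⟨c, hc⟩ := hres r
  exact ⟨c, _, hc, by rw [map_sub, ← IsScalarTower.algebraMap_apply]⟩

open scoped IntermediateField in
/-- A function field of a smooth affine curve is finite over the field generated by any function
with nonzero differential. -/
theorem exists_generator [Algebra B K] [IsScalarTower ℂ B K] [IsFractionRing B K]
    [Algebra.FiniteType ℂ B]
    [Algebra.IsStandardSmoothOfRelativeDimension 1 ℂ B] :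
    ∃ t : K, Transcendental ℂ t ∧ FiniteDimensional ℂ⟮t⟯ K := by
  obtain ⟨ω, hω, hω0⟩ := exists_span_kaehlerDifferential_localization (B := B) (R := K)
    (nonZeroDivisors B) (by simp)
  have hline := differentialsLine_of_span hω
  obtain ⟨t, ht⟩ : ∃ t : K, KaehlerDifferential.D ℂ K t ≠ 0 := by
    by_contra! h
    have htop : (⊤ : Submodule K Ω[K⁄ℂ]) = ⊥ := by
      rw [← KaehlerDifferential.span_range_derivation, Submodule.span_eq_bot]
      rintro _ ⟨f, rfl⟩
      exact h f
    exact hω0 ((Submodule.mem_bot K).mp (htop ▸ Submodule.mem_top))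
  refine ⟨t, fun halg => ht ?_, ?_⟩
  · obtain ⟨c, rfl⟩ : t ∈ (algebraMap ℂ K).range := by
      refine minpoly.mem_range_of_degree_eq_one ℂ t ?_
      exact IsAlgClosed.degree_eq_one_of_irreducible ℂ (minpoly.irreducible halg.isIntegral)
    exact Derivation.map_algebraMap _ c
  · have h1 : Algebra.EssFiniteType ℂ K := by
      have := Algebra.EssFiniteType.of_isLocalization K (nonZeroDivisors B)
      exact Algebra.EssFiniteType.comp ℂ B K
    have h2 : Algebra.EssFiniteType ℂ⟮t⟯ K := Algebra.EssFiniteType.of_comp ℂ ℂ⟮t⟯ K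
    have h3 : Algebra.FormallyUnramified ℂ⟮t⟯ K := by
      refine ⟨⟨fun a b => ?_⟩⟩
      suffices h : ∀ a : Ω[K⁄ℂ⟮t⟯], a = 0 by rw [h a, h b]
      have hD : ∀ f : K, KaehlerDifferential.D ℂ⟮t⟯ K f = 0 := by
        intro f
        obtain ⟨g, hg⟩ := hline (KaehlerDifferential.D ℂ K f) _ ht
        have h4 := congrArg (KaehlerDifferential.map ℂ ℂ⟮t⟯ K K) hg
        rw [map_smul, KaehlerDifferential.map_D, KaehlerDifferential.map_D] at h4
        simp only [Algebra.algebraMap_self, RingHom.id_apply] at h4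
        have h5 : KaehlerDifferential.D ℂ⟮t⟯ K t = 0 := Derivation.map_algebraMap
          (KaehlerDifferential.D ℂ⟮t⟯ K) (⟨t, IntermediateField.mem_adjoin_simple_self ℂ t⟩ : ℂ⟮t⟯)
        rw [h4, h5, smul_zero]
      have htop : (⊤ : Submodule K Ω[K⁄ℂ⟮t⟯]) = ⊥ := by
        rw [← KaehlerDifferential.span_range_derivation, Submodule.span_eq_bot]
        rintro _ ⟨f, rfl⟩
        exact hD f
      exact fun a => (Submodule.mem_bot K).mp (htop ▸ Submodule.mem_top)
    exact Algebra.FormallyUnramified.finite_of_free ℂ⟮t⟯ K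

end Chart

end CurveLifting

set_option linter.unusedSectionVars false
namespace CurveLifting

/-! ### The curve as a set of places of its function field -/

section SchemeCharts

variable (X : Scheme.{0}) [X.Over (Spec (.of ℂ))]

/-- The sections of the structure sheaf over an open set, as an algebra over the constants. -/
abbrev algebraSections (V : X.Opens) : Algebra ℂ Γ(X, V) :=
  (constants X ≫ X.presheaf.map (homOfLE le_top : V ⟶ ⊤).op).hom.toAlgebra

/-- The stalks of the structure sheaf, as algebras over the constants. -/
abbrev algebraStalk (x : X) : Algebra ℂ (X.presheaf.stalk x) :=
  (constants X ≫ X.presheaf.germ ⊤ x (TopologicalSpace.Opens.mem_top _)).hom.toAlgebra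

attribute [local instance] algebraSections algebraStalk

variable {X}

theorem exists_standardSmooth_chart [SmoothOfRelativeDimension 1 (X ↘ Spec (.of ℂ))] (x : X) :
    ∃ V : X.Opens, IsAffineOpen V ∧ x ∈ V ∧
      Algebra.IsStandardSmoothOfRelativeDimension 1 ℂ Γ(X, V) := by
  obtain ⟨U, hU, V, hV, hx, e, h⟩ :=
    SmoothOfRelativeDimension.exists_isStandardSmoothOfRelativeDimension
      (n := 1) (f := X ↘ Spec (.of ℂ)) x
  obtain rfl : U = ⊤ := by
    refine eq_top_iff.mpr fun y _ => ?_
    have : y = (X ↘ Spec (.of ℂ)) x := Subsingleton.elim (α := PrimeSpectrum ℂ) _ _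
    rw [this]
    exact e hx
  refine ⟨V, hV, hx, ?_⟩
  have h2 := RingHom.isStandardSmoothOfRelativeDimension_respectsIso.2 _
    (Scheme.ΓSpecIso (.of ℂ)).symm.commRingCatIsoToRingEquiv h
  exact h2

theorem isScalarTower_stalk (V : X.Opens) (x : V) :
    IsScalarTower ℂ Γ(X, V) (X.presheaf.stalk x.1) := by
  refine IsScalarTower.of_algebraMap_eq' ?_
  change _ = (((constants X ≫ X.presheaf.map (homOfLE le_top : V ⟶ ⊤).op)) ≫
    X.presheaf.germ V x.1 x.2).hom
  rw [Category.assoc, X.presheaf.germ_res]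
  rfl

instance [IsIntegral X] (x : X) : IsScalarTower ℂ (X.presheaf.stalk x) (Fun X) := by
  refine IsScalarTower.of_algebraMap_eq' ?_
  change _ = ((constants X ≫ X.presheaf.germ ⊤ x (TopologicalSpace.Opens.mem_top _)) ≫
    X.presheaf.stalkSpecializes ((genericPoint_spec X).specializes (Set.mem_univ x))).hom
  rw [Category.assoc, X.presheaf.germ_stalkSpecializes]
  rfl

instance [IsIntegral X] (V : X.Opens) [Nonempty V] : IsScalarTower ℂ Γ(X, V) (Fun X) := by
  refine IsScalarTower.of_algebraMap_eq' ?_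
  change _ = ((constants X ≫ X.presheaf.map (homOfLE le_top : V ⟶ ⊤).op) ≫
    X.germToFunctionField V).hom
  rw [Category.assoc]
  erw [X.presheaf.germ_res]
  rfl

theorem isMaximal_primeIdealOf {V : X.Opens} (hV : IsAffineOpen V) (x : V)
    (hx : IsClosed ({x.1} : Set X)) : (hV.primeIdealOf x).asIdeal.IsMaximal := by
  rw [← PrimeSpectrum.isClosed_singleton_iff_isMaximal]
  have h1 : IsClosed ({x} : Set V) := by
    have : ({x} : Set V) = Subtype.val ⁻¹' {x.1} := by
      ext y
      exact ⟨fun h => congrArg Subtype.val h, fun h => Subtype.ext h⟩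
    rw [this]
    exact hx.preimage continuous_subtype_val
  have h2 := hV.isoSpec.hom.homeomorph.isClosedMap _ h1
  have e : hV.isoSpec.hom.homeomorph '' ({x} : Set V) = {hV.primeIdealOf x} :=
    Set.image_singleton (α := V) (β := PrimeSpectrum Γ(X, V))
  exact e ▸ h2

variable [IsIntegral X]

theorem mem_localRing {x : Pt X} {f : Fun X} :
    f ∈ localRing X x ↔ ∃ r, algebraMap (X.presheaf.stalk x.1) (Fun X) r = f := Iff.rfl

theorem isPlace_localRing [SmoothOfRelativeDimension 1 (X ↘ Spec (.of ℂ))] (x : Pt X) :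
    IsDiscreteValuationRing (X.presheaf.stalk x.1) ∧ IsPlace (localRing X x) := by
  obtain ⟨V, hV, hx, hs⟩ := exists_standardSmooth_chart x.1
  have : Nonempty V := ⟨⟨x.1, hx⟩⟩
  have := isMaximal_primeIdealOf hV ⟨x.1, hx⟩ x.2
  have := hV.isLocalization_stalk ⟨x.1, hx⟩
  let _ := TopCat.Presheaf.algebra_section_stalk X.presheaf (⟨x.1, hx⟩ : V)
  have := isScalarTower_stalk V ⟨x.1, hx⟩
  have hsm := Algebra.IsStandardSmoothOfRelativeDimension.isStandardSmooth 1 (R := ℂ)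
    (S := Γ(X, V))
  have hfin : Algebra.FiniteType ℂ Γ(X, V) := inferInstance
  exact isPlace_of_chart (B := Γ(X, V)) (R := X.presheaf.stalk x.1)
    (hV.primeIdealOf ⟨x.1, hx⟩).asIdeal fun f => mem_localRing

end SchemeCharts

end CurveLifting

set_option linter.unusedSectionVars false
namespace CurveLifting

/-! ### The valuative criterion -/

section Valuative

/-- A discrete valuation ring is a maximal proper subring: a valuation subring containing it is
trivial or equal to it. -/
theorem IsPlace.mem_of_le_valuationSubring {K : Type} [Field K] [Algebra ℂ K] {A : Subalgebra ℂ K}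
    (hA : IsPlace A) {V : ValuationSubring K} (hle : ∀ f ∈ A, f ∈ V) (hV : V ≠ ⊤) {f : K}
    (hf : f ∈ V) : f ∈ A := by
  by_contra hfA
  refine hV (eq_top_iff.mpr fun h _ => ?_)
  obtain ⟨z, hz⟩ := hA.exists_coord
  have hf0 : f ≠ 0 := fun h => hfA (h ▸ A.zero_mem)
  have hfi := hA.inv_mem hfA
  obtain ⟨g, hg, e⟩ := (hz.nonunit_iff hfi).mp (Or.inl (by rwa [inv_inv]))
  have hzi : z⁻¹ ∈ V := by
    have h1 : z⁻¹ = g * f := by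
      have hz0 := hz.ne_zero
      have hg0 : g ≠ 0 := by
        rintro rfl
        simp [hf0] at e
      have e' : f = (z * g)⁻¹ := by rw [← e, inv_inv]
      rw [e']
      field_simp
    rw [h1]
    exact V.mul_mem _ _ (hle g hg) hf
  by_cases h0 : h = 0
  · rw [h0]
    exact V.zero_mem
  obtain ⟨n, u, hu, -, rfl⟩ := hA.factor z hz h h0
  refine V.mul_mem _ _ ?_ (hle u hu)
  rcases Int.le_total 0 n with hn | hn
  · exact hle _ (hz.zpow_mem hn)
  · obtain ⟨k, rfl⟩ := Int.eq_ofNat_of_zero_le (neg_nonneg.mpr hn) |>.imp fun k hk =>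
      (neg_eq_iff_eq_neg.mp hk)
    rw [zpow_neg, zpow_natCast, ← inv_pow]
    exact pow_mem hzi k

variable {X : Scheme.{0}} [X.Over (Spec (.of ℂ))]

attribute [local instance] algebraSections algebraStalk

theorem fromSpecStalk_comp_over (x : X) :
    X.fromSpecStalk x ≫ (X ↘ Spec (.of ℂ)) =
      Spec.map (CommRingCat.ofHom (algebraMap ℂ (X.presheaf.stalk x))) := by
  refine ext_of_isAffine ?_
  rw [Scheme.Hom.comp_appTop, Scheme.fromSpecStalk_appTop, ← cancel_epi (Scheme.ΓSpecIso (.of ℂ)).inv]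
  refine Eq.trans ?_ (Scheme.ΓSpecIso_inv_naturality _)
  have h : (Spec (X.presheaf.stalk x)).presheaf.map
      (homOfLE le_top : (⊤ : (Spec (X.presheaf.stalk x)).Opens) ⟶ ⊤).op = 𝟙 _ :=
    (Spec (X.presheaf.stalk x)).presheaf.map_id _
  erw [h, Category.comp_id]
  rfl

variable [IsIntegral X]

/-- The uniqueness part of the valuative criterion, applied to the local ring at a closed point. -/
theorem eq_of_localRing_eq [IsSeparated (X ↘ Spec (.of ℂ))]
    [SmoothOfRelativeDimension 1 (X ↘ Spec (.of ℂ))] {x y : Pt X}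
    (h : localRing X x = localRing X y) : x = y := by
  have hx := (isPlace_localRing x).1
  have hinj := IsFractionRing.injective (X.presheaf.stalk x.1) (Fun X)
  have hinj' := IsFractionRing.injective (X.presheaf.stalk y.1) (Fun X)
  -- the isomorphism of the stalks
  have he : ∀ r : X.presheaf.stalk y.1, ∃ s : X.presheaf.stalk x.1,
      algebraMap _ (Fun X) s = algebraMap _ (Fun X) r := fun r => by
    have : algebraMap _ (Fun X) r ∈ localRing X x := h ▸ ⟨r, rfl⟩
    exact this
  choose e he using he
  let E : X.presheaf.stalk y.1 →+* X.presheaf.stalk x.1 :=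
    { toFun := e
      map_one' := hinj (by rw [he, map_one, map_one])
      map_zero' := hinj (by rw [he, map_zero, map_zero])
      map_mul' := fun a b => hinj (by rw [he, map_mul, map_mul, he, he])
      map_add' := fun a b => hinj (by rw [he, map_add, map_add, he, he]) }
  have hE : (algebraMap (X.presheaf.stalk x.1) (Fun X)).comp E =
      algebraMap (X.presheaf.stalk y.1) (Fun X) := RingHom.ext he
  have hloc : IsLocalHom E := by
    refine ⟨fun a ha => ?_⟩
    obtain ⟨b, hb⟩ := ha.exists_right_inv
    have hbm : algebraMap _ (Fun X) b ∈ localRing X y := h ▸ ⟨b, rfl⟩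
    obtain ⟨c, hc⟩ := hbm
    refine IsUnit.of_mul_eq_one c (hinj' ?_)
    rw [map_mul, ← he, map_one, ← map_one (algebraMap (X.presheaf.stalk x.1) (Fun X)), ← hb,
      map_mul]
    congr 1
  let Φ : X.presheaf.stalk y.1 ⟶ X.presheaf.stalk x.1 := CommRingCat.ofHom E
  let ι : X.presheaf.stalk x.1 ⟶ X.functionField :=
    CommRingCat.ofHom (algebraMap (X.presheaf.stalk x.1) (Fun X))
  have hι : Spec.map ι ≫ X.fromSpecStalk x.1 = X.fromSpecStalk (genericPoint X) :=
    Scheme.SpecMap_stalkSpecializes_fromSpecStalk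
      ((genericPoint_spec X).specializes (Set.mem_univ x.1))
  have hΦι : Φ ≫ ι = CommRingCat.ofHom (algebraMap (X.presheaf.stalk y.1) (Fun X)) :=
    CommRingCat.hom_ext hE
  have hι' : Spec.map ι ≫ Spec.map Φ ≫ X.fromSpecStalk y.1 = X.fromSpecStalk (genericPoint X) := by
    rw [← Category.assoc, ← Spec.map_comp, hΦι]
    exact Scheme.SpecMap_stalkSpecializes_fromSpecStalk
      ((genericPoint_spec X).specializes (Set.mem_univ y.1))
  have hover : (Spec.map Φ ≫ X.fromSpecStalk y.1) ≫ (X ↘ Spec (.of ℂ)) =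
      X.fromSpecStalk x.1 ≫ (X ↘ Spec (.of ℂ)) := by
    rw [Category.assoc, fromSpecStalk_comp_over, fromSpecStalk_comp_over, ← Spec.map_comp]
    congr 1
    refine CommRingCat.hom_ext (RingHom.ext fun c => hinj ?_)
    change algebraMap _ (Fun X) (e (algebraMap ℂ _ c)) = algebraMap _ (Fun X) (algebraMap ℂ _ c)
    rw [he, ← IsScalarTower.algebraMap_apply, ← IsScalarTower.algebraMap_apply]
  let S : ValuativeCommSq (X ↘ Spec (.of ℂ)) :=
    { R := X.presheaf.stalk x.1
      commRing := inferInstance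
      domain := inferInstanceAs (IsDomain (X.presheaf.stalk x.1))
      valuationRing := inferInstanceAs (ValuationRing (X.presheaf.stalk x.1))
      K := Fun X
      i₁ := X.fromSpecStalk (genericPoint X)
      i₂ := X.fromSpecStalk x.1 ≫ (X ↘ Spec (.of ℂ))
      commSq := ⟨by rw [← hι, Category.assoc]; rfl⟩ }
  have huniq := IsSeparated.valuativeCriterion (X ↘ Spec (.of ℂ)) S
  have h3 : X.fromSpecStalk x.1 = Spec.map Φ ≫ X.fromSpecStalk y.1 := by
    let l₁ : S.commSq.LiftStruct := ⟨X.fromSpecStalk x.1, hι, rfl⟩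
    let l₂ : S.commSq.LiftStruct := ⟨Spec.map Φ ≫ X.fromSpecStalk y.1, hι', hover⟩
    exact congrArg CommSq.LiftStruct.l (Subsingleton.elim l₁ l₂)
  have h4 := congrArg (fun f : Spec (X.presheaf.stalk x.1) ⟶ X =>
    f (IsLocalRing.closedPoint (X.presheaf.stalk x.1))) h3
  have : IsLocalHom Φ.hom := hloc
  have h5 : (Spec.map Φ ≫ X.fromSpecStalk y.1)
      (IsLocalRing.closedPoint (X.presheaf.stalk x.1)) = y.1 := by
    refine (Scheme.Hom.comp_apply _ _ _).trans ?_
    exact (congrArg _ (Spec_closedPoint (f := Φ))).trans Scheme.fromSpecStalk_closedPoint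
  exact Subtype.ext (Scheme.fromSpecStalk_closedPoint.symm.trans (h4.trans h5))

/-- The existence part of the valuative criterion: the valuation ring dominates the local ring at
the image of its closed point, and is equal to it because that local ring is a maximal proper
subring. -/
theorem exists_localRing_eq [IsProper (X ↘ Spec (.of ℂ))]
    [SmoothOfRelativeDimension 1 (X ↘ Spec (.of ℂ))] (V : ValuationSubring (Fun X))
    (hV : ∀ c, algebraMap ℂ (Fun X) c ∈ V) (hVtop : V ≠ ⊤) :
    ∃ x : Pt X, ∀ f, f ∈ localRing X x ↔ f ∈ V := by
  suffices ∃ x : Pt X, ∀ f ∈ localRing X x, f ∈ V by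
    obtain ⟨x, hx⟩ := this
    exact ⟨x, fun f => ⟨hx f, (isPlace_localRing x).2.mem_of_le_valuationSubring hx hVtop⟩⟩
  let ψ : ℂ →+* V := (algebraMap ℂ (Fun X)).codRestrict V.toSubring hV
  let S : ValuativeCommSq (X ↘ Spec (.of ℂ)) :=
    { R := V
      K := Fun X
      i₁ := X.fromSpecStalk (genericPoint X)
      i₂ := Spec.map (CommRingCat.ofHom ψ)
      commSq := ⟨by
        rw [fromSpecStalk_comp_over, ← Spec.map_comp]
        rfl⟩ }
  have hex : ValuativeCriterion.Existence (X ↘ Spec (.of ℂ)) := by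
    have h := (inferInstance : UniversallyClosed (X ↘ Spec (.of ℂ)))
    rw [UniversallyClosed.eq_valuativeCriterion] at h
    exact h.1
  obtain ⟨⟨l⟩⟩ := hex S
  have : CompactSpace X := by
    have : QuasiCompact (X ↘ Spec (.of ℂ)) := inferInstance
    exact (quasiCompact_iff_compactSpace (f := X ↘ Spec (.of ℂ))).mp this
  let f : Spec (.of V) ⟶ X := l.l
  set x₀ := f (IsLocalRing.closedPoint V)
  obtain ⟨y, hy, hyc⟩ := (isClosed_closure (s := ({x₀} : Set X))).exists_closed_singleton
    ⟨x₀, subset_closure rfl⟩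
  have hspec : x₀ ⤳ y := specializes_iff_mem_closure.mpr hy
  refine ⟨⟨y, hyc⟩, ?_⟩
  rintro _ ⟨r, rfl⟩
  have key : Scheme.stalkClosedPointTo f ≫ CommRingCat.ofHom (algebraMap V (Fun X)) =
      X.presheaf.stalkSpecializes ((genericPoint_spec X).specializes (Set.mem_univ x₀)) := by
    refine Spec.map_injective ((cancel_mono (X.fromSpecStalk x₀)).mp ?_)
    rw [Scheme.SpecMap_stalkSpecializes_fromSpecStalk, Spec.map_comp, Category.assoc]
    have h1 : Spec.map (Scheme.stalkClosedPointTo f) ≫ X.fromSpecStalk x₀ = f :=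
      Scheme.Spec_stalkClosedPointTo_fromSpecStalk f
    rw [h1]
    exact l.fac_left
  have h2 : algebraMap (X.presheaf.stalk y) (Fun X) r =
      (Scheme.stalkClosedPointTo f (X.presheaf.stalkSpecializes hspec r) : V).1 := by
    have h3 := congr($(key).hom (X.presheaf.stalkSpecializes hspec r))
    refine Eq.trans ?_ h3.symm
    have h4 := X.presheaf.stalkSpecializes_comp
      ((genericPoint_spec X).specializes (Set.mem_univ x₀)) hspec
    exact congr($(h4.symm).hom r)
  change algebraMap (X.presheaf.stalk y) (Fun X) r ∈ V
  rw [h2]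
  exact Subtype.property _

end Valuative

end CurveLifting

set_option linter.unusedSectionVars false
namespace CurveLifting

/-! ### The local rings at the closed points -/

section SchemeCurve

variable {X : Scheme.{0}} [IsIntegral X]

theorem genericPoint_mem (U : X.Opens) {x : X} (hx : x ∈ U) : genericPoint X ∈ U :=
  ((genericPoint_spec X).mem_open_set_iff U.isOpen).mpr (by simpa using ⟨x, hx⟩)

variable [X.Over (Spec (.of ℂ))]

theorem compactSpace_of_isProper [IsProper (X ↘ Spec (.of ℂ))] : CompactSpace X := by
  have : QuasiCompact (X ↘ Spec (.of ℂ)) := inferInstance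
  exact (quasiCompact_iff_compactSpace (f := X ↘ Spec (.of ℂ))).mp this

/-- The curve has dimension one: every point specializing to a closed point is that point or the
generic point. -/
theorem eq_or_eq_genericPoint_of_specializes [SmoothOfRelativeDimension 1 (X ↘ Spec (.of ℂ))]
    (x : Pt X) {y : X} (h : y ⤳ x.1) : y = x.1 ∨ y = genericPoint X := by
  have hdvr := (isPlace_localRing x).1
  have hr := X.range_fromSpecStalk (x := x.1)
  have key : ∀ p : Spec (X.presheaf.stalk x.1),
      p = IsLocalRing.closedPoint (X.presheaf.stalk x.1) ∨
      p = (⊥ : PrimeSpectrum (X.presheaf.stalk x.1)) := by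
    intro p
    by_cases hp : p.asIdeal = ⊥
    · exact Or.inr (PrimeSpectrum.ext hp)
    · left
      have := p.2
      exact PrimeSpectrum.ext (IsLocalRing.eq_maximalIdeal (this.isMaximal hp))
  obtain ⟨p, hp⟩ : y ∈ Set.range (X.fromSpecStalk x.1) := hr ▸ h
  obtain ⟨q, hq⟩ : genericPoint X ∈ Set.range (X.fromSpecStalk x.1) :=
    hr ▸ (genericPoint_spec X).specializes (Set.mem_univ x.1)
  rcases key p with rfl | rfl
  · exact Or.inl (hp.symm.trans Scheme.fromSpecStalk_closedPoint)
  rcases key q with rfl | rfl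
  · have e : genericPoint X = x.1 := hq.symm.trans Scheme.fromSpecStalk_closedPoint
    refine Or.inl ((x.2.closure_eq ▸ specializes_iff_mem_closure.mp ?_ : y ∈ ({x.1} : Set X)))
    exact e ▸ (genericPoint_spec X).specializes (Set.mem_univ y)
  · exact Or.inr (hp.symm.trans hq)

/-- A nonempty open set contains almost all closed points: a closed point outside it is the generic
point of an irreducible component of the complement. -/
theorem finite_notMem_opens [IsProper (X ↘ Spec (.of ℂ))]
    [SmoothOfRelativeDimension 1 (X ↘ Spec (.of ℂ))] (U : X.Opens) {x : X} (hx : x ∈ U) :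
    {y : Pt X | y.1 ∉ U}.Finite := by
  have := compactSpace_of_isProper (X := X)
  have : IsLocallyNoetherian X := LocallyOfFiniteType.isLocallyNoetherian (X ↘ Spec (.of ℂ))
  have : IsNoetherian X := {}
  obtain ⟨S, hS, hcl, hirr, hU⟩ := TopologicalSpace.NoetherianSpace.exists_finite_set_isClosed_irreducible
    (U.isOpen.isClosed_compl)
  refine Set.Finite.of_finite_image (f := fun y : Pt X => ({y.1} : Set X)) (hS.subset ?_)
    fun a _ b _ h => Subtype.ext (Set.singleton_injective h)
  rintro _ ⟨y, hy, rfl⟩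
  obtain ⟨t, ht, hyt⟩ : y.1 ∈ ⋃₀ S := hU ▸ hy
  obtain ⟨g, hg⟩ := QuasiSober.sober (hirr t ht) (hcl t ht)
  have hgt : g ∈ t := hg.mem
  rcases eq_or_eq_genericPoint_of_specializes y (hg.specializes hyt) with rfl | rfl
  · have : t = {y.1} := hg.symm.trans y.2.closure_eq
    change ({y.1} : Set X) ∈ S
    rwa [← this]
  · have : genericPoint X ∈ (U : Set X)ᶜ := hU ▸ Set.mem_sUnion_of_mem hgt ht
    exact absurd (genericPoint_mem U hx) this

theorem germ_mem_localRing (U : X.Opens) (x : Pt X) (hx : x.1 ∈ U) (s : Γ(X, U)) :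
    X.presheaf.germ U (genericPoint X) (genericPoint_mem U hx) s ∈ localRing X x := by
  refine ⟨X.presheaf.germ U x.1 hx s, ?_⟩
  have := X.presheaf.germ_stalkSpecializes (U := U) hx
    ((genericPoint_spec X).specializes (Set.mem_univ x.1))
  exact congr($(this).hom s)

attribute [local instance] algebraSections algebraStalk

theorem isCurve_localRing [IsProper (X ↘ Spec (.of ℂ))]
    [SmoothOfRelativeDimension 1 (X ↘ Spec (.of ℂ))] : IsCurve (localRing X) := by
  obtain ⟨V, hV, hx, hs⟩ := exists_standardSmooth_chart (genericPoint X)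
  have hne : Nonempty V := ⟨⟨_, hx⟩⟩
  have := functionField_isFractionRing_of_isAffineOpen X V hV
  have hsm := Algebra.IsStandardSmoothOfRelativeDimension.isStandardSmooth 1 (R := ℂ)
    (S := Γ(X, V))
  have hfin : Algebra.FiniteType ℂ Γ(X, V) := inferInstance
  refine ⟨fun x => (isPlace_localRing x).2, fun x y h => eq_of_localRing_eq h, exists_localRing_eq,
    fun f => ?_, ?_, ?_⟩
  · obtain ⟨U, hU, s, rfl⟩ := X.presheaf.exists_germ_eq (x := genericPoint X) f
    refine (finite_notMem_opens U hU).subset fun y hy hyU => hy ?_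
    exact germ_mem_localRing U y hyU s
  · obtain ⟨ω, hω, -⟩ := exists_span_kaehlerDifferential_localization (B := Γ(X, V)) (R := Fun X)
      (nonZeroDivisors Γ(X, V)) (by simp)
    exact differentialsLine_of_span hω
  · exact exists_generator (B := Γ(X, V))

end SchemeCurve

end CurveLifting

set_option linter.unusedSectionVars false
namespace CurveLifting

/-! ### Rational sections and stalks of vector bundles -/

section RationalSections

variable {X : Scheme.{0}}

theorem mem_opens_inf {U V : X.Opens} {x : X} (hU : x ∈ U) (hV : x ∈ V) : x ∈ U ⊓ V := ⟨hU, hV⟩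

theorem exists_common_open {ι : Type} [Finite ι] {x : X} {U : X.Opens} (hx : x ∈ U)
    {W : ι → X.Opens} (hW : ∀ j, x ∈ W j) : ∃ V ≤ U, x ∈ V ∧ ∀ j, V ≤ W j := by
  have := Fintype.ofFinite ι
  refine ⟨U ⊓ Finset.univ.inf W, inf_le_left, mem_opens_inf hx ?_, fun j =>
    inf_le_right.trans (Finset.inf_le (Finset.mem_univ j))⟩
  have h : x ∈ ((Finset.univ.inf W : X.Opens) : Set X) := by
    rw [TopologicalSpace.Opens.coe_finset_inf]
    simpa using hW
  exact h

variable [IsIntegral X]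

theorem exists_germ_family {ι : Type} [Finite ι] (x : X) {U : X.Opens} (hx : x ∈ U)
    (f : ι → X.presheaf.stalk x) : ∃ V ≤ U, ∃ hxV : x ∈ V, ∃ a : ι → Γ(X, V),
      ∀ j, X.presheaf.germ V x hxV (a j) = f j := by
  choose W hW s hs using fun j => X.presheaf.exists_germ_eq (f j)
  obtain ⟨V, hVU, hxV, hle⟩ := exists_common_open hx hW
  refine ⟨V, hVU, hxV, fun j => X.presheaf.map (homOfLE (hle j)).op (s j), fun j => ?_⟩
  rw [← hs j]
  exact X.presheaf.germ_res_apply _ _ _ _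

section

variable (M : X.Modules)

theorem toRat_smul {U : X.Opens} {x : X} (hx : x ∈ U) (r : Γ(X, U)) (m : Γ(M, U)) :
    toRat M hx (r • m) =
      (X.presheaf.germ U (genericPoint X) (genericPoint_mem U hx) r : Fun X) • toRat M hx m :=
  PresheafOfModules.germ_smul (R := X.presheaf) M.val (genericPoint X) U _ r m

theorem toRat_map {U V : X.Opens} {x y : X} (hx : x ∈ U) (hy : y ∈ V) (i : V ⟶ U) (m : Γ(M, U)) :
    toRat M hy (M.presheaf.map i.op m) = toRat M hx m :=
  TopCat.Presheaf.germ_res_apply M.presheaf i _ _ m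

theorem exists_toRat (v : Rat M) :
    ∃ (U : X.Opens) (hU : genericPoint X ∈ U) (m : Γ(M, U)), toRat M hU m = v :=
  TopCat.Presheaf.exists_germ_eq M.presheaf v

theorem exists_map_eq_of_toRat_eq {U V : X.Opens} {x y : X} (hx : x ∈ U) (hy : y ∈ V)
    {m : Γ(M, U)} {n : Γ(M, V)} (h : toRat M hx m = toRat M hy n) :
    ∃ (W : X.Opens) (_ : genericPoint X ∈ W) (i : W ⟶ U) (j : W ⟶ V),
      M.presheaf.map i.op m = M.presheaf.map j.op n :=
  TopCat.Presheaf.germ_eq M.presheaf _ _ _ m n h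

theorem toRat_sum_smul {ι : Type} [Fintype ι] {U V : X.Opens} {x y : X} (hx : x ∈ U) (hy : y ∈ V)
    (i : V ⟶ U) (s : ι → Γ(M, U)) (a : ι → Γ(X, V)) :
    toRat M hy (∑ j, a j • M.presheaf.map i.op (s j)) =
      ∑ j, (X.presheaf.germ V (genericPoint X) (genericPoint_mem V hy) (a j) : Fun X) •
        toRat M hx (s j) := by
  rw [map_sum]
  refine Finset.sum_congr rfl fun j _ => ?_
  rw [toRat_smul, toRat_map M hx hy i]

end

variable [X.Over (Spec (.of ℂ))]

theorem exists_germ_of_mem_localRing {x : Pt X} {f : Fun X} (hf : f ∈ localRing X x) :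
    ∃ (U : X.Opens) (hx : x.1 ∈ U) (s : Γ(X, U)),
      X.presheaf.germ U (genericPoint X) (genericPoint_mem U hx) s = f := by
  obtain ⟨r, rfl⟩ := hf
  obtain ⟨U, hU, s, rfl⟩ := X.presheaf.exists_germ_eq r
  refine ⟨U, hU, s, ?_⟩
  have := X.presheaf.germ_stalkSpecializes (U := U) hU
    ((genericPoint_spec X).specializes (Set.mem_univ x.1))
  exact congr($(this).hom s).symm

theorem mem_stalkAt_iff {M : X.Modules} {x : Pt X} {v : Rat M} : v ∈ stalkAt M x ↔
    ∃ (U : X.Opens) (hx : x.1 ∈ U) (m : Γ(M, U)), toRat M hx m = v := by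
  refine ⟨fun hv => ?_, fun h => Submodule.subset_span h⟩
  induction hv using Submodule.span_induction with
  | mem v h => exact h
  | zero => exact ⟨⊤, trivial, 0, map_zero _⟩
  | add v w _ _ hv hw =>
    obtain ⟨U, hU, m, rfl⟩ := hv
    obtain ⟨V, hV, n, rfl⟩ := hw
    refine ⟨U ⊓ V, mem_opens_inf hU hV, M.presheaf.map (homOfLE inf_le_left).op m +
      M.presheaf.map (homOfLE inf_le_right).op n, ?_⟩
    rw [map_add, toRat_map M hU, toRat_map M hV]
  | smul c v _ hv =>
    obtain ⟨U, hU, m, rfl⟩ := hv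
    obtain ⟨c, hc⟩ := c
    obtain ⟨V, hV, s, rfl⟩ := exists_germ_of_mem_localRing hc
    refine ⟨U ⊓ V, mem_opens_inf hU hV, X.presheaf.map (homOfLE inf_le_right : U ⊓ V ⟶ V).op s •
      M.presheaf.map (homOfLE inf_le_left : U ⊓ V ⟶ U).op m, ?_⟩
    rw [toRat_smul, toRat_map M hU, Subalgebra.smul_def]
    congr 1
    exact X.presheaf.germ_res_apply _ _ _ _

theorem toRat_mem_stalkAt {M : X.Modules} {U : X.Opens} {x : X} (hx : x ∈ U) {y : Pt X}
    (hy : y.1 ∈ U) (m : Γ(M, U)) : toRat M hx m ∈ stalkAt M y :=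
  mem_stalkAt_iff.mpr ⟨U, hy, m, rfl⟩

/-- The sections `s` over `U` form a local frame. -/
def IsLocalFrame (M : X.Modules) {U : X.Opens} {ι : Type} [Fintype ι] (s : ι → Γ(M, U)) : Prop :=
  ∀ (V : X.Opens) (i : V ⟶ U),
    Function.Bijective fun a : ι → Γ(X, V) => ∑ j, a j • M.presheaf.map i.op (s j)

/-- A local frame is a basis of the rational sections, and a frame at the points where it is
defined. -/
theorem IsLocalFrame.exists_basis {M : X.Modules} {U : X.Opens} {x : X} (hx : x ∈ U) {ι : Type}
    [Fintype ι] {s : ι → Γ(M, U)} (hs : IsLocalFrame M s) :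
    ∃ b : Module.Basis ι (Fun X) (Rat M), (∀ j, b j = toRat M hx (s j)) ∧
      ∀ y : Pt X, y.1 ∈ U → IsFrame (stalkAt M) y b := by
  have hη := genericPoint_mem U hx
  have hcoord : ∀ (V : X.Opens) (y : X) (hy : y ∈ V) (i : V ⟶ U) (m : Γ(M, V)),
      ∃ a : ι → Γ(X, V), toRat M hy m =
        ∑ j, (X.presheaf.germ V (genericPoint X) (genericPoint_mem V hy) (a j) : Fun X) •
          toRat M hx (s j) := by
    intro V y hy i m
    obtain ⟨a, rfl⟩ := (hs V i).2 m
    exact ⟨a, toRat_sum_smul M hx hy i s a⟩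
  have hli : LinearIndependent (Fun X) fun j => toRat M hx (s j) := by
    rw [Fintype.linearIndependent_iff]
    intro f hf
    obtain ⟨V, hVU, hV, a, ha⟩ := exists_germ_family (genericPoint X) hη f
    have h0 : toRat M hV (∑ j, a j • M.presheaf.map (homOfLE hVU).op (s j)) = toRat M hV 0 := by
      rw [toRat_sum_smul M hx hV, map_zero, ← hf]
      exact Finset.sum_congr rfl fun j _ => congrArg (· • toRat M hx (s j)) (ha j)
    obtain ⟨W, hW, i, k, h⟩ := exists_map_eq_of_toRat_eq M hV hV h0
    rw [map_zero, map_sum] at h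
    have h1 := (hs W (i ≫ homOfLE hVU)).1
      (a₁ := fun j => X.presheaf.map i.op (a j)) (a₂ := 0) (by
        simp only [Pi.zero_apply, zero_smul, Finset.sum_const_zero]
        rw [← h]
        refine Finset.sum_congr rfl fun j _ => ?_
        rw [Scheme.Modules.map_smul, op_comp, Functor.map_comp]
        rfl)
    intro j
    rw [← ha j, ← X.presheaf.germ_res_apply i (genericPoint X) hW]
    have h2 := congrFun h1 j
    exact (congrArg _ h2).trans (map_zero _)
  have hspan : ⊤ ≤ Submodule.span (Fun X) (Set.range fun j => toRat M hx (s j)) := by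
    intro v _
    obtain ⟨V, hV, m, rfl⟩ := exists_toRat M v
    obtain ⟨a, ha⟩ := hcoord (V ⊓ U) (genericPoint X) (mem_opens_inf hV hη) (homOfLE inf_le_right)
      (M.presheaf.map (homOfLE inf_le_left).op m)
    rw [toRat_map M hV] at ha
    rw [ha]
    exact Submodule.sum_mem _ fun j _ => Submodule.smul_mem _ _ (Submodule.subset_span ⟨j, rfl⟩)
  refine ⟨Module.Basis.mk hli hspan, fun j => Module.Basis.mk_apply _ _ _, fun y hy => ?_⟩
  rw [IsFrame, Module.Basis.coe_mk]
  apply le_antisymm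
  · rw [Submodule.span_le]
    rintro _ ⟨j, rfl⟩
    exact toRat_mem_stalkAt hx hy _
  · intro v hv
    obtain ⟨V, hV, m, rfl⟩ := mem_stalkAt_iff.mp hv
    obtain ⟨a, ha⟩ := hcoord (V ⊓ U) y.1 (mem_opens_inf hV hy) (homOfLE inf_le_right)
      (M.presheaf.map (homOfLE inf_le_left).op m)
    rw [toRat_map M hV] at ha
    rw [ha]
    refine Submodule.sum_mem _ fun j _ => ?_
    exact Submodule.smul_mem _ (⟨_, germ_mem_localRing _ y (mem_opens_inf hV hy) (a j)⟩ : localRing X y)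
      (Submodule.subset_span ⟨j, rfl⟩)

theorem IsVectorBundle.exists_isLocalFrame {M : X.Modules} (hM : IsVectorBundle M) (x : X) :
    ∃ U : X.Opens, x ∈ U ∧ ∃ (n : ℕ) (s : Fin n → Γ(M, U)), IsLocalFrame M s :=
  hM x

theorem IsVectorBundle.isBundle [IsProper (X ↘ Spec (.of ℂ))]
    [SmoothOfRelativeDimension 1 (X ↘ Spec (.of ℂ))] {M : X.Modules} (hM : IsVectorBundle M) :
    IsBundle (stalkAt M) := by
  constructor
  · intro x
    obtain ⟨U, hx, n, s, hs⟩ := hM.exists_isLocalFrame x.1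
    obtain ⟨b, -, hb⟩ := hs.exists_basis hx
    exact ⟨Fin n, inferInstance, b, hb x hx⟩
  · obtain ⟨U, hx, n, s, hs⟩ := hM.exists_isLocalFrame (genericPoint X)
    obtain ⟨b, -, hb⟩ := hs.exists_basis hx
    exact ⟨Fin n, inferInstance, b, (finite_notMem_opens U hx).subset
      fun y hy hyU => hy (hb y hyU)⟩

/-- Sections of a vector bundle are determined by the rational sections they define. -/
theorem IsVectorBundle.section_ext {M : X.Modules} (hM : IsVectorBundle M) {U : X.Opens}
    {m n : Γ(M, U)} (h : ∀ x, ∀ hx : x ∈ U, toRat M hx m = toRat M hx n) : m = n := by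
  rw [← sub_eq_zero]
  choose W hW k s hs using fun x => hM.exists_isLocalFrame x
  refine TopCat.Sheaf.eq_of_locally_eq' (F := ⟨M.presheaf, M.isSheaf⟩) (fun x : U => U ⊓ W x.1) U
    (fun x => homOfLE inf_le_left) (fun x hx => ?_) _ _ fun x => ?_
  · exact TopologicalSpace.Opens.mem_iSup.mpr ⟨⟨x, hx⟩, hx, hW x⟩
  · change M.presheaf.map _ (m - n) = M.presheaf.map _ 0
    rw [map_zero]
    obtain ⟨a, ha⟩ := (hs x.1 (U ⊓ W x.1) (homOfLE inf_le_right)).2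
      (M.presheaf.map (homOfLE inf_le_left : U ⊓ W x.1 ⟶ U).op (m - n))
    have h0 : toRat M (mem_opens_inf x.2 (hW x.1))
        (M.presheaf.map (homOfLE inf_le_left : U ⊓ W x.1 ⟶ U).op (m - n)) = 0 := by
      rw [toRat_map M x.2, map_sub, h, sub_self]
    obtain ⟨b, hb, -⟩ := (hs x.1).exists_basis (hW x.1)
    rw [← ha] at h0
    rw [← ha]
    change ∑ j, a j • M.presheaf.map (homOfLE inf_le_right : U ⊓ W x.1 ⟶ W x.1).op (s x.1 j) = 0
    have h1 : toRat M (mem_opens_inf x.2 (hW x.1))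
        (∑ j, a j • M.presheaf.map (homOfLE inf_le_right : U ⊓ W x.1 ⟶ W x.1).op (s x.1 j)) = 0 := h0
    rw [toRat_sum_smul M (hW x.1)] at h1
    simp only [← hb] at h1
    have h2 := Fintype.linearIndependent_iff.mp b.linearIndependent _ h1
    refine Finset.sum_eq_zero fun j _ => ?_
    have : Nonempty (U ⊓ W x.1 : X.Opens) := ⟨⟨x.1, x.2, hW x.1⟩⟩
    have h3 : a j = 0 := by
      refine X.germToFunctionField_injective (U ⊓ W x.1) ?_
      exact (h2 j).trans (map_zero _).symm
    rw [h3, zero_smul]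

/-- A rational section of a vector bundle that is regular at the closed points of an open set comes
from a section over this set. -/
theorem IsVectorBundle.exists_section [IsProper (X ↘ Spec (.of ℂ))] {M : X.Modules}
    (hM : IsVectorBundle M) (U : X.Opens) (v : Rat M) (hv : ∀ y : Pt X, y.1 ∈ U → v ∈ stalkAt M y) :
    ∃ m : Γ(M, U), ∀ x, ∀ hx : x ∈ U, toRat M hx m = v := by
  have hJ : JacobsonSpace X := LocallyOfFiniteType.jacobsonSpace (X ↘ Spec (.of ℂ))
  choose W hW s hs using fun y : {y : Pt X // y.1 ∈ U} => mem_stalkAt_iff.mp (hv y.1 y.2)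
  have hs' : ∀ y, ∀ x, ∀ hx : x ∈ W y, toRat M hx (s y) = v := fun y _ _ => hs y
  have hcover : U ≤ ⨆ y, (U ⊓ W y) := by
    intro x hx
    by_contra hxW
    have hlc : IsLocallyClosed ((U : Set X) ∩ ((⨆ y, (U ⊓ W y) : X.Opens) : Set X)ᶜ) :=
      U.isOpen.isLocallyClosed.inter (TopologicalSpace.Opens.isOpen _).isClosed_compl.isLocallyClosed
    obtain ⟨y, ⟨hyU, hyW⟩, hyc⟩ := nonempty_inter_closedPoints
      (Z := (U : Set X) ∩ ((⨆ y, (U ⊓ W y) : X.Opens) : Set X)ᶜ) ⟨x, hx, hxW⟩ hlc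
    exact hyW (TopologicalSpace.Opens.mem_iSup.mpr ⟨⟨⟨y, hyc⟩, hyU⟩, hyU, hW _⟩)
  obtain ⟨m, hm, -⟩ := TopCat.Sheaf.existsUnique_gluing' (⟨M.presheaf, M.isSheaf⟩ : TopCat.Sheaf Ab X)
    (fun y => U ⊓ W y) U (fun y => homOfLE inf_le_left) hcover
    (fun y => M.presheaf.map (homOfLE inf_le_right).op (s y)) (fun y z => by
      refine hM.section_ext fun x hx => ?_
      refine (toRat_map M hx.1 hx (TopologicalSpace.Opens.infLELeft _ _) _).trans ?_
      refine Eq.trans ?_ (toRat_map M hx.2 hx (TopologicalSpace.Opens.infLERight _ _) _).symm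
      rw [toRat_map M hx.1.2, toRat_map M hx.2.2, hs', hs'])
  refine ⟨m, fun x hx => ?_⟩
  obtain ⟨y, hy⟩ := TopologicalSpace.Opens.mem_iSup.mp (hcover hx)
  rw [← toRat_map M hx hy (homOfLE inf_le_left) m]
  refine (congrArg (toRat M hy) (hm y)).trans ?_
  rw [toRat_map M hy.2, hs']

end RationalSections

end CurveLifting

set_option linter.unusedSectionVars false
namespace CurveLifting

/-! ### Morphisms of sheaves of modules and rational sections -/

section Morphisms

variable {X : Scheme.{0}} [IsIntegral X] {M N L : X.Modules}

theorem ratMap_toRat (f : M ⟶ N) {U : X.Opens} {x : X} (hx : x ∈ U) (m : Γ(M, U)) :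
    ratMap f (toRat M hx m) = toRat N hx (f.app U m) :=
  TopCat.Presheaf.stalkFunctor_map_germ_apply U (genericPoint X) _ f.mapPresheaf m

theorem ratMap_smul (f : M ⟶ N) (c : Fun X) (v : Rat M) : ratMap f (c • v) = c • ratMap f v := by
  obtain ⟨U, hU, m, rfl⟩ := exists_toRat M v
  obtain ⟨V, hVU, hV, a, ha⟩ := exists_germ_family (genericPoint X) hU fun _ : Unit => c
  have hc : (X.presheaf.germ V (genericPoint X) (genericPoint_mem V hV) (a ()) : Fun X) = c := ha ()
  rw [← hc, ← toRat_map M hU hV (homOfLE hVU), ← toRat_smul, ratMap_toRat, ratMap_toRat,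
    Scheme.Modules.Hom.app_smul, toRat_smul]

/-- The map induced on rational sections, as a linear map. -/
def ratLin (f : M ⟶ N) : Rat M →ₗ[Fun X] Rat N where
  __ := ratMap f
  map_smul' := ratMap_smul f

@[simp]
theorem ratLin_apply (f : M ⟶ N) (v : Rat M) : ratLin f v = ratMap f v := rfl

theorem ratMap_comp (f : M ⟶ N) (g : N ⟶ L) (v : Rat M) : ratMap (f ≫ g) v = ratMap g (ratMap f v) := by
  obtain ⟨U, hU, m, rfl⟩ := exists_toRat M v
  simp only [ratMap_toRat]
  rfl

theorem ratMap_id (v : Rat M) : ratMap (𝟙 M) v = v := by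
  obtain ⟨U, hU, m, rfl⟩ := exists_toRat M v
  rw [ratMap_toRat]
  rfl

theorem ratMap_zero (v : Rat M) : ratMap (0 : M ⟶ N) v = 0 := by
  obtain ⟨U, hU, m, rfl⟩ := exists_toRat M v
  rw [ratMap_toRat]
  exact map_zero (toRat N hU)

variable [X.Over (Spec (.of ℂ))]

theorem ratMap_mem_stalkAt (f : M ⟶ N) {x : Pt X} {v : Rat M} (hv : v ∈ stalkAt M x) :
    ratMap f v ∈ stalkAt N x := by
  obtain ⟨U, hU, m, rfl⟩ := mem_stalkAt_iff.mp hv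
  rw [ratMap_toRat]
  exact toRat_mem_stalkAt hU hU _

theorem IsVectorBundle.hom_ext (hN : IsVectorBundle N) {f g : M ⟶ N}
    (h : ∀ v, ratMap f v = ratMap g v) : f = g := by
  refine Scheme.Modules.hom_ext f g fun U => ?_
  ext m
  refine hN.section_ext fun x hx => ?_
  rw [← ratMap_toRat, ← ratMap_toRat, h]

/-- A linear map between rational sections that preserves regularity at all closed points comes
from a morphism. -/
theorem IsVectorBundle.exists_hom [IsProper (X ↘ Spec (.of ℂ))] (hN : IsVectorBundle N)
    (φ : Rat M →ₗ[Fun X] Rat N) (hφ : ∀ x, ∀ v ∈ stalkAt M x, φ v ∈ stalkAt N x) :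
    ∃ f : M ⟶ N, ∀ v, ratMap f v = φ v := by
  have key : ∀ (U : X.Opens) (m : Γ(M, U)), ∃ n : Γ(N, U), ∀ x, ∀ hx : x ∈ U,
      toRat N hx n = φ (toRat M hx m) := by
    intro U m
    by_cases hU : ∃ x, x ∈ U
    · obtain ⟨x, hx⟩ := hU
      exact hN.exists_section U (φ (toRat M hx m)) fun y hy => hφ y _ (toRat_mem_stalkAt hx hy m)
    · exact ⟨0, fun x hx => absurd ⟨x, hx⟩ hU⟩
  choose F hF using key
  let f : M.presheaf ⟶ N.presheaf :=
    { app := fun U => AddCommGrpCat.ofHom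
        { toFun := F U.unop
          map_zero' := hN.section_ext fun x hx =>
            (hF U.unop (0 : Γ(M, U.unop)) x hx).trans (by simp only [map_zero]; exact (map_zero (toRat N hx)).symm)
          map_add' := fun m n => hN.section_ext fun x hx =>
            (hF U.unop ((m : Γ(M, U.unop)) + (n : Γ(M, U.unop))) x hx).trans
              ((congrArg φ (map_add (toRat M hx) _ _)).trans ((map_add φ _ _).trans
                ((congrArg₂ (· + ·) (hF _ _ x hx) (hF _ _ x hx)).symm.trans
                  (map_add (toRat N hx) _ _).symm))) }
      naturality := fun U V i => by
        ext m
        refine hN.section_ext fun x hx => ?_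
        have hxU : x ∈ U.unop := i.unop.le hx
        refine (hF V.unop (M.presheaf.map i.unop.op m) x hx).trans ?_
        rw [toRat_map M hxU hx]
        exact ((toRat_map N hxU hx i.unop (F U.unop m)).trans (hF U.unop m x hxU)).symm }
  let f' : M ⟶ N := ⟨PresheafOfModules.homMk (M₁ := M.val) (M₂ := N.val) f fun U r m => by
    refine hN.section_ext (U := U.unop) fun x hx => ?_
    refine (hF U.unop (HSMul.hSMul (α := Γ(X, U.unop)) (β := Γ(M, U.unop)) r m) x hx).trans ?_
    refine Eq.trans ?_ (toRat_smul N hx (r : Γ(X, U.unop)) (F U.unop m)).symm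
    refine (congrArg φ (toRat_smul M hx (r : Γ(X, U.unop)) (m : Γ(M, U.unop)))).trans ?_
    rw [map_smul, hF U.unop m x hx]⟩
  refine ⟨f', fun v => ?_⟩
  obtain ⟨U, hU, m, rfl⟩ := exists_toRat M v
  rw [ratMap_toRat]
  exact hF U m _ hU

end Morphisms

end CurveLifting

set_option linter.unusedSectionVars false
namespace CurveLifting

/-! ### Short exact sequences of sheaves of modules -/

section Extensions

variable {X : Scheme.{0}}

/-- An epimorphism of sheaves of modules is surjective on sections locally: the cokernel of the
underlying morphism of presheaves has zero sheafification. -/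
theorem exists_locally_lift {M N : X.Modules} (q : M ⟶ N) [Epi q] {U : X.Opens} (n : Γ(N, U)) {x : X}
    (hx : x ∈ U) : ∃ (V : X.Opens) (i : V ⟶ U) (_ : x ∈ V) (m : Γ(M, V)),
      q.app V m = N.presheaf.map i.op n := by
  -- the map from `N` to the sheafification `S` of the cokernel is zero after `q`, hence zero
  let π := Limits.cokernel.π q.val
  let C := Limits.cokernel q.val
  let S : X.Modules := (PresheafOfModules.sheafification (𝟙 X.ringCatSheaf.obj)).obj C
  let u : C ⟶ _ := (PresheafOfModules.sheafificationAdjunction (𝟙 X.ringCatSheaf.obj)).unit.app C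
  let t : N.val ⟶ S.val := PresheafOfModules.homMk (M₁ := N.val) (M₂ := S.val)
    ((PresheafOfModules.toPresheaf _).map (π ≫ u)) fun U r m => ((π ≫ u).app U).hom.map_smul r m
  let t' : N ⟶ S := ⟨t⟩
  have h0 : q ≫ t' = 0 := by
    refine Scheme.Modules.hom_ext _ _ fun V => ?_
    ext m
    have e : ((q.val ≫ π) ≫ u).app (.op V) = 0 := by
      rw [Limits.cokernel.condition, Limits.zero_comp]
      rfl
    exact congr($(e).hom m)
  have h1 : t' = 0 := (cancel_epi q).mp (by rw [h0, Limits.comp_zero])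
  have h2 : (CategoryTheory.toSheafify (Opens.grothendieckTopology X) C.presheaf).app (.op U)
      (π.app (.op U) n) = 0 := by
    have e : t'.app U = 0 := by
      rw [h1]
      rfl
    exact congr($(e).hom n)
  -- a section of the cokernel that dies in the sheafification is locally zero
  have h3 := Presheaf.equalizerSieve_mem (Opens.grothendieckTopology X)
    (CategoryTheory.toSheafify (Opens.grothendieckTopology X) C.presheaf) (X := .op U)
    (π.app (.op U) n) 0 (by rw [h2, map_zero])
  obtain ⟨V, i, hi, hV⟩ := h3 x hx
  have h4 : π.app (.op V) (N.presheaf.map i.op n) = 0 := by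
    refine (PresheafOfModules.naturality_apply π i.op n).trans ?_
    exact hi.trans (map_zero _)
  have h5 := (ShortComplex.exact_cokernel q.val).map (PresheafOfModules.evaluation _ (.op V))
  obtain ⟨m, hm⟩ := (ShortComplex.moduleCat_exact_iff _).mp h5 (N.presheaf.map i.op n) h4
  exact ⟨V, i, hV, m, hm⟩

section Sections

variable {E F W : X.Modules} {i : E ⟶ W} {q : W ⟶ F} {w : i ≫ q = 0}

/-- The sections over an open set, as a functor. -/
def sectionsFunctor (U : X.Opens) : X.Modules ⥤ Ab :=
  Scheme.Modules.toPresheaf X ⋙ (evaluation (TopologicalSpace.Opens X)ᵒᵖ Ab).obj (.op U)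

instance (U : X.Opens) : (sectionsFunctor U).PreservesZeroMorphisms where
  map_zero _ _ := rfl

instance (U : X.Opens) : Limits.PreservesFiniteLimits (sectionsFunctor U) := by
  have h1 : Limits.PreservesFiniteLimits (Scheme.Modules.toPresheaf X) := inferInstance
  have h2 : Limits.PreservesFiniteLimits
      ((evaluation (TopologicalSpace.Opens X)ᵒᵖ Ab).obj (.op U)) := inferInstance
  exact Limits.comp_preservesFiniteLimits _ _

theorem app_injective_of_shortExact (hS : (ShortComplex.mk i q w).ShortExact) (U : X.Opens) :
    Function.Injective (i.app U) := by
  have := hS.mono_f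
  have h : Mono ((sectionsFunctor U).map i) := inferInstanceAs
    (Mono ((sectionsFunctor U).map (ShortComplex.mk i q w).f))
  exact (AddCommGrpCat.mono_iff_injective _).mp h

theorem exists_app_eq_of_shortExact (hS : (ShortComplex.mk i q w).ShortExact) {U : X.Opens}
    {m : Γ(W, U)} (hm : q.app U m = 0) : ∃ e, i.app U e = m := by
  have := hS.mono_f
  have h := hS.exact.map_of_mono_of_preservesKernel (sectionsFunctor U) inferInstance inferInstance
  exact (ShortComplex.ab_exact_iff _).mp h m hm

end Sections

end Extensions

end CurveLifting

set_option linter.unusedSectionVars false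
namespace CurveLifting

/-! ### Extensions of vector bundles -/

section Extensions

variable {X : Scheme.{0}} {E F W : X.Modules} {i : E ⟶ W} {q : W ⟶ F} {w : i ≫ q = 0}

theorem app_map_opens {M N : X.Modules} (f : M ⟶ N) {U V : X.Opens} (j : V ⟶ U) (m : Γ(M, U)) :
    f.app V (M.presheaf.map j.op m) = N.presheaf.map j.op (f.app U m) :=
  NatTrans.naturality_apply f.mapPresheaf j.op m

theorem map_map_opens (M : X.Modules) {U V V' : X.Opens} (j : V ⟶ U) (k : V' ⟶ V) (l : V' ⟶ U)
    (m : Γ(M, U)) : M.presheaf.map k.op (M.presheaf.map j.op m) = M.presheaf.map l.op m := by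
  rw [← ConcreteCategory.comp_apply, ← Functor.map_comp, ← op_comp]
  rfl

theorem app_app_eq_zero (w : i ≫ q = 0) {U : X.Opens} (e : Γ(E, U)) : q.app U (i.app U e) = 0 := by
  have h : (i ≫ q).app U = 0 := by
    rw [w]
    rfl
  exact congr($(h).hom e)

/-- Locally, a frame of the quotient lifts. -/
theorem exists_isLocalFrame_lift [Epi q] {U : X.Opens} {x : X} (hx : x ∈ U) {ι : Type} [Fintype ι]
    (f : ι → Γ(F, U)) : ∃ (V : X.Opens) (j : V ⟶ U) (_ : x ∈ V) (m : ι → Γ(W, V)),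
      ∀ l, q.app V (m l) = F.presheaf.map j.op (f l) := by
  choose V j hV m hm using fun l => exists_locally_lift q (f l) hx
  obtain ⟨V', hV'U, hxV', hle⟩ := exists_common_open hx hV
  refine ⟨V', homOfLE hV'U, hxV', fun l => W.presheaf.map (homOfLE (hle l)).op (m l), fun l => ?_⟩
  rw [app_map_opens, hm, map_map_opens]

end Extensions

section Extensions

variable {X : Scheme.{0}} [IsIntegral X] [X.Over (Spec (.of ℂ))]
variable {E F W : X.Modules} {i : E ⟶ W} {q : W ⟶ F} {w : i ≫ q = 0}

theorem IsLocalFrame.map {M : X.Modules} {U V : X.Opens} {ι : Type} [Fintype ι]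
    {s : ι → Γ(M, U)} (hs : IsLocalFrame M s) (j : V ⟶ U) :
    IsLocalFrame M fun l => M.presheaf.map j.op (s l) := by
  intro V' k
  have h := hs V' (k ≫ j)
  refine (iff_of_eq (congrArg Function.Bijective (funext fun a => ?_))).mp h
  refine Finset.sum_congr rfl fun l _ => ?_
  rw [map_map_opens M j k (k ≫ j)]

/-- In an extension, a frame of the first term and lifts of a frame of the quotient form a frame. -/
theorem IsLocalFrame.extension (hS : (ShortComplex.mk i q w).ShortExact) {U : X.Opens}
    {ι κ : Type} [Fintype ι] [Fintype κ] {e : ι → Γ(E, U)} {f : κ → Γ(F, U)}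
    (he : IsLocalFrame E e) (hf : IsLocalFrame F f) {m : κ → Γ(W, U)}
    (hm : ∀ l, q.app U (m l) = f l) :
    IsLocalFrame W (Sum.elim (fun l => i.app U (e l)) m) := by
  intro V j
  have hq : ∀ b : κ → Γ(X, V), q.app V (∑ l, b l • W.presheaf.map j.op (m l)) =
      ∑ l, b l • F.presheaf.map j.op (f l) := by
    intro b
    rw [map_sum]
    refine Finset.sum_congr rfl fun l _ => ?_
    rw [Scheme.Modules.Hom.app_smul, app_map_opens, hm]
  have hi : ∀ a : ι → Γ(X, V), i.app V (∑ l, a l • E.presheaf.map j.op (e l)) =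
      ∑ l, a l • W.presheaf.map j.op (i.app U (e l)) := by
    intro a
    rw [map_sum]
    refine Finset.sum_congr rfl fun l _ => ?_
    rw [Scheme.Modules.Hom.app_smul, app_map_opens]
  have hsum : ∀ a : ι ⊕ κ → Γ(X, V),
      ∑ l, a l • W.presheaf.map j.op (Sum.elim (fun l => i.app U (e l)) m l) =
        i.app V (∑ l, a (Sum.inl l) • E.presheaf.map j.op (e l)) +
          ∑ l, a (Sum.inr l) • W.presheaf.map j.op (m l) := by
    intro a
    rw [hi, Fintype.sum_sum_type]
    rfl
  constructor
  · intro a b hab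
    simp only [hsum] at hab
    have h1 := congrArg (q.app V) hab
    rw [map_add, map_add, app_app_eq_zero w, app_app_eq_zero w, zero_add, zero_add, hq, hq] at h1
    have h2 : (fun l => a (Sum.inr l)) = fun l => b (Sum.inr l) := (hf V j).1 h1
    have h3 : ∀ l, a (Sum.inr l) = b (Sum.inr l) := congrFun h2
    simp only [h3] at hab
    have h4 : (fun l => a (Sum.inl l)) = fun l => b (Sum.inl l) :=
      (he V j).1 (app_injective_of_shortExact hS V (add_right_cancel hab))
    funext l
    cases l with
    | inl l => exact congrFun h4 l
    | inr l => exact h3 l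
  · intro v
    obtain ⟨b, hb⟩ := (hf V j).2 (q.app V v)
    obtain ⟨u, hu⟩ := exists_app_eq_of_shortExact hS
      (m := v - ∑ l, b l • W.presheaf.map j.op (m l)) (by
        rw [map_sub, hq, sub_eq_zero]
        exact hb.symm)
    obtain ⟨a, ha⟩ := (he V j).2 u
    refine ⟨Sum.elim a b, ?_⟩
    change ∑ l, Sum.elim a b l • W.presheaf.map j.op (Sum.elim (fun l => i.app U (e l)) m l) = v
    rw [hsum]
    have ha' : ∑ l, a l • E.presheaf.map j.op (e l) = u := ha
    simp only [Sum.elim_inl, Sum.elim_inr]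
    rw [ha', hu, sub_add_cancel]

theorem IsLocalFrame.reindex {M : X.Modules} {U : X.Opens} {ι κ : Type} [Fintype ι] [Fintype κ]
    (ε : κ ≃ ι) {s : ι → Γ(M, U)} (hs : IsLocalFrame M s) : IsLocalFrame M fun l => s (ε l) := by
  intro V j
  have h : (fun a : κ → Γ(X, V) => ∑ l, a l • M.presheaf.map j.op (s (ε l))) =
      (fun a : ι → Γ(X, V) => ∑ l, a l • M.presheaf.map j.op (s l)) ∘
        Equiv.arrowCongr ε (Equiv.refl _) := by
    funext a
    refine Fintype.sum_equiv ε _ _ fun l => ?_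
    simp
  rw [h]
  exact (hs V j).comp (Equiv.bijective _)

theorem IsVectorBundle.extension (hS : (ShortComplex.mk i q w).ShortExact)
    (hE : IsVectorBundle E) (hF : IsVectorBundle F) : IsVectorBundle W := by
  intro x
  have := hS.epi_g
  obtain ⟨U, hU, n, e, he⟩ := hE.exists_isLocalFrame x
  obtain ⟨U', hU', k, f, hf⟩ := hF.exists_isLocalFrame x
  obtain ⟨V, j, hV, m, hm⟩ := exists_isLocalFrame_lift (q := q) hU' f
  refine ⟨U ⊓ V, mem_opens_inf hU hV, n + k, _, IsLocalFrame.reindex finSumFinEquiv.symm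
    (IsLocalFrame.extension hS (he.map (homOfLE inf_le_left))
      (hf.map (homOfLE inf_le_right ≫ j : U ⊓ V ⟶ U'))
      (m := fun l => W.presheaf.map (homOfLE inf_le_right).op (m l)) fun l => ?_)⟩
  rw [app_map_opens, hm, map_map_opens]

theorem ratMap_comp_eq_zero (w : i ≫ q = 0) (u : Rat E) : ratMap q (ratMap i u) = 0 := by
  rw [← ratMap_comp, w, ratMap_zero]

theorem ratMap_injective_of_shortExact (hS : (ShortComplex.mk i q w).ShortExact) :
    Function.Injective (ratMap i) := by
  refine (injective_iff_map_eq_zero _).mpr fun u hu => ?_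
  obtain ⟨U, hU, m, rfl⟩ := exists_toRat E u
  rw [ratMap_toRat, ← map_zero (toRat W hU)] at hu
  obtain ⟨V, hV, j, k, h⟩ := exists_map_eq_of_toRat_eq W hU hU hu
  rw [map_zero, ← app_map_opens] at h
  have h' := app_injective_of_shortExact hS V (h.trans (map_zero (i.app V).hom).symm)
  rw [← toRat_map E hU hV j]
  exact (congrArg (toRat E hV) h').trans (map_zero (toRat E hV))

theorem exists_ratMap_eq_of_shortExact (hS : (ShortComplex.mk i q w).ShortExact) {v : Rat W}
    (hv : ratMap q v = 0) : ∃ u, ratMap i u = v := by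
  obtain ⟨U, hU, m, rfl⟩ := exists_toRat W v
  rw [ratMap_toRat, ← map_zero (toRat F hU)] at hv
  obtain ⟨V, hV, j, k, h⟩ := exists_map_eq_of_toRat_eq F hU hU hv
  rw [map_zero, ← app_map_opens] at h
  obtain ⟨e, he⟩ := exists_app_eq_of_shortExact hS h
  exact ⟨toRat E hV e, by rw [ratMap_toRat, he, toRat_map W hU hV]⟩

/-- A rational section of the first term that is regular in the middle term is regular. -/
theorem mem_stalkAt_of_ratMap_mem (hS : (ShortComplex.mk i q w).ShortExact)
    (hF : IsVectorBundle F) {x : Pt X} {u : Rat E} (hu : ratMap i u ∈ stalkAt W x) :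
    u ∈ stalkAt E x := by
  obtain ⟨U, hU, m, hm⟩ := mem_stalkAt_iff.mp hu
  have h0 : q.app U m = 0 := by
    refine hF.section_ext fun y hy => ?_
    have hm' : toRat W hy m = ratMap i u := hm
    rw [← ratMap_toRat, hm', ratMap_comp_eq_zero w, map_zero]
  obtain ⟨e, he⟩ := exists_app_eq_of_shortExact hS h0
  refine mem_stalkAt_iff.mpr ⟨U, hU, e, ratMap_injective_of_shortExact hS ?_⟩
  rw [ratMap_toRat, he, hm]

/-- Extensions split locally. -/
theorem exists_local_splitting [Epi q] (hF : IsVectorBundle F) (x : X) :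
    ∃ U : X.Opens, x ∈ U ∧ ∃ τ : Rat F →ₗ[Fun X] Rat W, (∀ v, ratMap q (τ v) = v) ∧
      ∀ y : Pt X, y.1 ∈ U → ∀ v ∈ stalkAt F y, τ v ∈ stalkAt W y := by
  obtain ⟨U, hU, n, f, hf⟩ := hF.exists_isLocalFrame x
  obtain ⟨V, j, hV, m, hm⟩ := exists_isLocalFrame_lift (q := q) hU f
  obtain ⟨b, hb, hfr⟩ := (hf.map j).exists_basis hV
  refine ⟨V, hV, b.constr (Fun X) fun l => toRat W hV (m l), fun v => ?_, fun y hy v hv => ?_⟩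
  · have h : ratLin q ∘ₗ (b.constr (Fun X) fun l => toRat W hV (m l)) = LinearMap.id := by
      refine b.ext fun l => ?_
      rw [LinearMap.comp_apply, Module.Basis.constr_basis, ratLin_apply, ratMap_toRat, hm,
        LinearMap.id_apply, hb]
    exact congr($h v)
  · rw [← hfr y hy] at hv
    induction hv using Submodule.span_induction with
    | mem v h =>
      obtain ⟨l, rfl⟩ := h
      rw [Module.Basis.constr_basis]
      exact toRat_mem_stalkAt hV hy _
    | zero =>
      rw [map_zero]
      exact Submodule.zero_mem _
    | add v v' _ _ h h' =>
      rw [map_add]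
      exact Submodule.add_mem _ h h'
    | smul c v _ h =>
      rw [Subalgebra.smul_def, map_smul]
      exact Submodule.smul_mem _ c h

/-- A map to the middle term of an extension that vanishes in the quotient factors through the
first term. -/
theorem exists_factor_of_shortExact (hS : (ShortComplex.mk i q w).ShortExact) {V : Type}
    [AddCommGroup V] [Module (Fun X) V] (φ : V →ₗ[Fun X] Rat W) (hφ : ∀ v, ratMap q (φ v) = 0) :
    ∃ κ : V →ₗ[Fun X] Rat E, ∀ v, ratMap i (κ v) = φ v := by
  obtain ⟨r, hr⟩ := (ratLin i).exists_leftInverse_of_injective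
    (LinearMap.ker_eq_bot.mpr (ratMap_injective_of_shortExact hS))
  refine ⟨r ∘ₗ φ, fun v => ?_⟩
  obtain ⟨u, hu⟩ := exists_ratMap_eq_of_shortExact hS (hφ v)
  have h : r (ratMap i u) = u := congr($hr u)
  rw [LinearMap.comp_apply, ← hu, h]

/-- A splitting over a nonempty open set `U₀` is a rational splitting. Its differences with local
splittings can be taken to be zero at the points of `U₀`, hence at almost all points. -/
theorem exists_isExtClass [IsProper (X ↘ Spec (.of ℂ))]
    [SmoothOfRelativeDimension 1 (X ↘ Spec (.of ℂ))] (hS : (ShortComplex.mk i q w).ShortExact)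
    (hF : IsVectorBundle F) : ∃ c, IsExtClass i q c := by
  classical
  have := hS.epi_g
  choose U hU τ hτ hreg using fun x => exists_local_splitting (q := q) hF x
  set U₀ := U (genericPoint X)
  set σ := τ (genericPoint X)
  choose κ hκ using fun x : Pt X => exists_factor_of_shortExact hS (σ - τ x.1) fun v => by
    rw [LinearMap.sub_apply, map_sub, hτ, hτ, sub_self]
  let p : families (homBundle E F) := ⟨fun x => if x.1 ∈ U₀ then 0 else κ x, by
    refine (finite_notMem_opens U₀ (hU _)).subset fun x hx hxU => hx ?_
    have : (if x.1 ∈ U₀ then 0 else κ x) = 0 := if_pos hxU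
    change (if x.1 ∈ U₀ then 0 else κ x) ∈ homBundle E F x
    rw [this]
    exact Submodule.zero_mem _⟩
  refine ⟨_, σ, hτ _, p, rfl, fun x => ?_⟩
  by_cases hx : x.1 ∈ U₀
  · refine ⟨σ, hτ _, hreg _ x hx, fun v => ?_⟩
    have : p.1 x = 0 := if_pos hx
    rw [this, LinearMap.zero_apply, map_zero, sub_self]
  · refine ⟨τ x.1, hτ _, hreg _ x (hU _), fun v => ?_⟩
    have : p.1 x = κ x := if_neg hx
    rw [this, hκ, LinearMap.sub_apply]

theorem isExtClass_extClass [IsProper (X ↘ Spec (.of ℂ))]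
    [SmoothOfRelativeDimension 1 (X ↘ Spec (.of ℂ))] (hS : (ShortComplex.mk i q w).ShortExact)
    (hF : IsVectorBundle F) : IsExtClass i q (extClass i q) :=
  Classical.epsilon_spec (exists_isExtClass hS hF)

/-- The class of a non-split extension is not zero. -/
theorem IsExtClass.ne_zero [IsProper (X ↘ Spec (.of ℂ))]
    (hS : (ShortComplex.mk i q w).ShortExact) (hE : IsVectorBundle E) (hF : IsVectorBundle F)
    {c : H1 (homBundle E F)} (hc : IsExtClass i q c) (hsplit : ¬ ∃ s : F ⟶ W, s ≫ q = 𝟙 F) :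
    c ≠ 0 := by
  rintro rfl
  obtain ⟨σ, hσ, p, hp, hτ⟩ := hc
  obtain ⟨u, hu⟩ := (H1.mk_eq_zero_iff p).mp hp
  obtain ⟨s, hs⟩ := (IsVectorBundle.extension hS hE hF).exists_hom (σ - ratLin i ∘ₗ u)
    fun x v hv => by
      obtain ⟨τ, -, hreg, h⟩ := hτ x
      have h1 := ratMap_mem_stalkAt i (hu x v hv)
      have h2 := Submodule.add_mem _ (hreg v hv) h1
      rw [LinearMap.sub_apply, map_sub, h] at h2
      convert h2 using 1
      simp only [LinearMap.sub_apply, LinearMap.comp_apply, ratLin_apply]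
      abel
  refine hsplit ⟨s, hF.hom_ext fun v => ?_⟩
  rw [ratMap_comp, hs, ratMap_id, LinearMap.sub_apply, map_sub, hσ, LinearMap.comp_apply,
    ratLin_apply, ratMap_comp_eq_zero w, sub_zero]

variable {G : X.Modules} {γ : G ⟶ F}

theorem mem_of_forall_imageStalk {V : Type} [AddCommGroup V] [Module (Fun X) V]
    {x : Pt X} {L : Submodule (localRing X x) V} (φ : Rat F →ₗ[Fun X] V)
    (h : ∀ v ∈ stalkAt G x, φ (ratMap γ v) ∈ L) : ∀ v ∈ imageStalk γ x, φ v ∈ L := by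
  have hle : imageStalk γ x ≤ L.comap (φ.restrictScalars (localRing X x)) := by
    refine Submodule.span_le.mpr ?_
    rintro _ ⟨v, hv, rfl⟩
    exact h v hv
  exact fun v hv => hle hv

theorem imageStalk_le (x : Pt X) : imageStalk γ x ≤ stalkAt F x := by
  refine Submodule.span_le.mpr ?_
  rintro _ ⟨v, hv, rfl⟩
  exact ratMap_mem_stalkAt γ hv

theorem span_imageStalk (hG : IsVectorBundle G) (x : Pt X) :
    Submodule.span (Fun X) (imageStalk γ x : Set (Rat F)) = ratImage γ := by
  apply le_antisymm
  · refine Submodule.span_le.mpr fun v hv => ?_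
    exact mem_of_forall_imageStalk (L := (ratImage γ).restrictScalars (localRing X x))
      LinearMap.id (fun v _ => Submodule.subset_span ⟨v, rfl⟩) v hv
  · refine Submodule.span_le.mpr ?_
    rintro _ ⟨v, rfl⟩
    obtain ⟨U, hU, n, s, hs⟩ := hG.exists_isLocalFrame x.1
    obtain ⟨b, hb, -⟩ := hs.exists_basis hU
    have h : ratLin γ (∑ l, b.repr v l • b l) = ratMap γ v := congrArg (ratLin γ) (b.sum_repr v)
    rw [SetLike.mem_coe, ← h, map_sum]
    refine Submodule.sum_mem _ fun l _ => ?_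
    rw [map_smul]
    refine Submodule.smul_mem _ _ (Submodule.subset_span (Submodule.subset_span ⟨b l, ?_, rfl⟩))
    rw [hb]
    exact toRat_mem_stalkAt hU hU _

/-- A morphism lifts to an extension if and only if the class of the extension has a representative
that sends the image of the morphism to regular sections. -/
theorem IsExtClass.exists_lift_iff [IsProper (X ↘ Spec (.of ℂ))]
    [SmoothOfRelativeDimension 1 (X ↘ Spec (.of ℂ))]
    (hS : (ShortComplex.mk i q w).ShortExact) (hE : IsVectorBundle E) (hF : IsVectorBundle F)
    (hγ : Function.Injective (ratMap γ)) {c : H1 (homBundle E F)} (hc : IsExtClass i q c) :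
    (∃ g : G ⟶ W, g ≫ q = γ) ↔ ∃ p : families (homBundle E F), H1.mk _ p = c ∧
      ∀ x, ∀ v ∈ imageStalk γ x, p.1 x v ∈ stalkAt E x := by
  obtain ⟨σ, hσ, p, rfl, hτ⟩ := hc
  constructor
  · rintro ⟨g, hg⟩
    obtain ⟨κ, hκ⟩ := exists_factor_of_shortExact hS (σ ∘ₗ ratLin γ - ratLin g) fun v => by
      rw [LinearMap.sub_apply, map_sub, LinearMap.comp_apply, hσ, ratLin_apply, ratLin_apply,
        ← ratMap_comp, hg, sub_self]
    obtain ⟨r, hr⟩ := (ratLin γ).exists_leftInverse_of_injective (LinearMap.ker_eq_bot.mpr hγ)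
    have hr' : ∀ v, r (ratMap γ v) = v := fun v => congr($hr v)
    -- `σ ∘ γ - g` has values in `E`; an extension of it to `F` changes the representative
    let u : families (homBundle E F) := ⟨fun _ => κ ∘ₗ r,
      (hF.isBundle.hom hE.isBundle).finite_notMem isCurve_localRing _⟩
    refine ⟨p - u, ?_, fun x => mem_of_forall_imageStalk _ fun v hv => ?_⟩
    · rw [← sub_eq_zero, H1.mk, H1.mk, ← map_sub, sub_sub_cancel_left]
      refine (H1.mk_eq_zero_iff (-u)).mpr ⟨-(κ ∘ₗ r), fun x => ?_⟩
      have h : (-u).1 x - -(κ ∘ₗ r) = 0 := sub_self _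
      rw [h]
      exact Submodule.zero_mem _
    · obtain ⟨τ, -, hreg, h⟩ := hτ x
      refine mem_stalkAt_of_ratMap_mem hS hF ?_
      have h1 := Submodule.sub_mem _ (ratMap_mem_stalkAt g hv)
        (hreg _ (ratMap_mem_stalkAt γ hv))
      convert h1 using 1
      change ratMap i (p.1 x (ratMap γ v) - κ (r (ratMap γ v))) = _
      rw [map_sub, h, hr', hκ]
      simp only [LinearMap.sub_apply, LinearMap.comp_apply, ratLin_apply]
      abel
  · rintro ⟨p', hp', hreg'⟩
    have hpp : H1.mk (homBundle E F) (p - p') = 0 := by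
      rw [H1.mk, map_sub, sub_eq_zero]
      exact hp'.symm
    obtain ⟨u, hu⟩ := (H1.mk_eq_zero_iff (p - p')).mp hpp
    -- correct the rational splitting by the rational map whose principal part is `p - p'`
    obtain ⟨g, hg⟩ := (IsVectorBundle.extension hS hE hF).exists_hom
      ((σ - ratLin i ∘ₗ u) ∘ₗ ratLin γ) fun x v hv => by
        obtain ⟨τ, -, hreg, h⟩ := hτ x
        have h0 := ratMap_mem_stalkAt γ hv
        have h1 := ratMap_mem_stalkAt i (hu x _ h0)
        have h2 := ratMap_mem_stalkAt i (hreg' x _ (Submodule.subset_span ⟨v, hv, rfl⟩))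
        have h3 := Submodule.add_mem _ (hreg _ h0) (Submodule.add_mem _ h1 h2)
        have h4 : ((p - p').1 x - u) (ratMap γ v) =
          p.1 x (ratMap γ v) - p'.1 x (ratMap γ v) - u (ratMap γ v) := rfl
        rw [h4, map_sub, map_sub, h] at h3
        convert h3 using 1
        simp only [LinearMap.sub_apply, LinearMap.comp_apply, ratLin_apply]
        abel
    refine ⟨g, hF.hom_ext fun v => ?_⟩
    rw [ratMap_comp, hg, LinearMap.comp_apply, LinearMap.sub_apply, map_sub, hσ,
      LinearMap.comp_apply, ratLin_apply, ratLin_apply, ratMap_comp_eq_zero w, sub_zero]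

end Extensions

end CurveLifting













theorem theorem3 (X : Scheme.{0}) [IsIntegral X] [X.Over (Spec (.of ℂ))]
    [IsProper (X ↘ Spec (.of ℂ))] [SmoothOfRelativeDimension 1 (X ↘ Spec (.of ℂ))]
    (E F G : X.Modules) (hE : CurveLifting.IsVectorBundle E) (hF : CurveLifting.IsVectorBundle F)
    (hG : CurveLifting.IsVectorBundle G)
    (hψ : CurveLifting.PsiIsEmbedding (CurveLifting.homBundle E F))
    (γ : G ⟶ F) (hγ : Function.Injective (CurveLifting.ratMap γ)) :
    (∀ x ∈ CurveLifting.dropSet γ, Nonempty (CurveLifting.Drop E γ x)) ∧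
    ∀ (D : ∀ x ∈ CurveLifting.dropSet γ, CurveLifting.Drop E γ x)
      (W : X.Modules) (i : E ⟶ W) (q : W ⟶ F) (w : i ≫ q = 0),
      (ShortComplex.mk i q w).ShortExact → (¬ ∃ s : F ⟶ W, s ≫ q = 𝟙 F) →
      ∃ hδ : CurveLifting.extClass i q ≠ 0,
        (∃ g : G ⟶ W, g ≫ q = γ) ↔
          Projectivization.mk ℂ (CurveLifting.extClass i q) hδ ∈
            Projectivization.Subspace.span (CurveLifting.lociN E γ D) := by
  have hC := CurveLifting.isCurve_localRing (X := X)
  refine ⟨fun x hx => ?_, fun D W i q w hS hsplit => ?_⟩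
  · exact CurveLifting.nonempty_dropData (hC.place x) (hF.isBundle.frame x) (hE.isBundle.frame x)
      (CurveLifting.imageStalk_le x) (CurveLifting.span_imageStalk hG x) hx
  · have hc := CurveLifting.isExtClass_extClass hS hF
    refine ⟨hc.ne_zero hS hE hF hsplit, ?_⟩
    rw [hc.exists_lift_iff hS hE hF hγ]
    exact (CurveLifting.mem_span_locus_iff hC hF.isBundle hE.isBundle CurveLifting.imageStalk_le
      (CurveLifting.span_imageStalk hG) D _).symm
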